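/- Let $\mathfrak g$ be a finite-dimensional real Lie algebra and $\mathfrak h\subset\mathfrak g$ an Abelian Lie subalgebra, with basis $h_1,\dots,h_l$ and induced linear coordinates $\lambda^1,\dots,\lambda^l$ on $\mathfrak h^*$. Let $[\cdot,\cdot]:\wedge^k\mathfrak g\otimes\wedge^m\mathfrak g\to\wedge^{k+m-1}\mathfrak g$ be the Schouten bracket induced by the Lie bracket of $\mathfrak g$, $$[x_1\wedge\dots\wedge x_k,\,y_1\wedge\dots\wedge y_m]=\sum_{i,j}(-1)^{i+j}[x_i,y_j]\wedge x_1\wedge\dots\widehat{x_i}\dots\wedge x_k\wedge y_1\wedge\dots\widehat{y_j}\dots\wedge y_m .$$ A triangular dynamical $r$-matrix is a smooth map $r:\mathfrak h^*\to\wedge^2\mathfrak g$ such that $[h,r(\lambda)]=0$ for all $h\in\mathfrak h$, $\lambda\in\mathfrak h^*$, and $\sum_i h_i\wedge\frac{\partial r}{\partial\lambda^i}+\frac12[r,r]=0$. For $\lambda\in\mathfrak h^*$ put $\mathfrak g_\lambda=\mathfrak h+r(\lambda)^{\#}\mathfrak h^{\perp}$, where $\mathfrak h^\perp\subset\mathfrak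 g^*$ is the annihilator of $\mathfrak h$ and $r(\lambda)^{\#}:\mathfrak g^*\to\mathfrak g$ is given by $\langle\eta,r(\lambda)^{\#}\xi\rangle=r(\lambda)(\xi,\eta)$; $r$ is non-degenerate if its rank $\dim\mathfrak g_\lambda-\dim\mathfrak h$ equals $\dim\mathfrak g-\dim\mathfrak h$ for all $\lambda$. Let $C^k=C^\infty(\mathfrak h^*,(\wedge^k\mathfrak g)^{\mathfrak h})$ and $\delta_r\tau=\sum_i h_i\wedge\frac{\partial\tau}{\partial\lambda^i}+[r,\tau]$. Let $C^k(\mathfrak g,\mathfrak h)$ be the space of alternating $k$-forms on $\mathfrak g$ that vanish when one argument lies in $\mathfrak h$ and are $\mathfrak h$-invariant, with the Chevalley–Eilenberg differential $d$ (trivial coefficients $\mathbb R$). **Theorem.** Let $r:\mathfrak h^*\to\wedge^2\mathfrak g$ be a non-degenerate triangular dynamical $r$-matrix. Then $(C^\bullet,\delta_r)$ and $(C^\bullet(\mathfrak g,\mathfrak h),d)$ are cochain complexes (the differentials map $k$-cochains to $(k+1)$-cochains and square to zero), and for every $k\ge 0$ the dynamical $r$-matrix cohomology $H^k_{r}(\mathfrak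 g,\mathfrak h)=H^k(C^\bullet,\delta_r)$ is isomorphic, as a real vector space, to the relative Lie algebra cohomology $H^k(\mathfrak g,\mathfrak h)=H^k(C^\bullet(\mathfrak g,\mathfrak h),d)$. -/

import Mathlib

open scoped ContDiff
open Module

noncomputable section

namespace DynR

section Subquotient

variable {V : Type*} [AddCommGroup V] [Module ℝ V]

/-- The subquotient `Z / B` (cocycles modulo coboundaries) for subspaces `B ≤ Z` of `V`. -/
def Subquotient (Z B : Submodule ℝ V) : Type _ := Z ⧸ B.submoduleOf Z

instance (Z B : Submodule ℝ V) : AddCommGroup (Subquotient Z B) :=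
  inferInstanceAs (AddCommGroup (Z ⧸ B.submoduleOf Z))

instance (Z B : Submodule ℝ V) : Module ℝ (Subquotient Z B) :=
  inferInstanceAs (Module ℝ (Z ⧸ B.submoduleOf Z))

end Subquotient

/-! ### Smooth maps between finite dimensional real vector spaces

A finite dimensional real vector space carries a canonical smooth structure, given by any linear
coordinate system.  We use the coordinates of the basis `Module.finBasis`; smoothness and
directional derivatives do not depend on this choice. -/

section Smooth

variable {W V V₁ V₂ : Type*}
  [AddCommGroup W] [Module ℝ W] [FiniteDimensional ℝ W]
  [AddCommGroup V] [Module ℝ V] [FiniteDimensional ℝ V]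
  [AddCommGroup V₁] [Module ℝ V₁] [FiniteDimensional ℝ V₁]
  [AddCommGroup V₂] [Module ℝ V₂] [FiniteDimensional ℝ V₂]

variable (V) in
/-- Linear coordinates on a finite dimensional real vector space. -/
def coords : V ≃ₗ[ℝ] (Fin (finrank ℝ V) → ℝ) := (Module.finBasis ℝ V).equivFun

/-- A map between finite dimensional real vector spaces, read in linear coordinates. -/
def inCoords (f : W → V) : (Fin (finrank ℝ W) → ℝ) → (Fin (finrank ℝ V) → ℝ) :=
  fun x => coords V (f ((coords W).symm x))

/-- `f` is smooth (of class `C^∞`). -/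
def IsSmooth (f : W → V) : Prop := ContDiff ℝ ∞ (inCoords f)

/-- The directional derivative `∂_v f : W → V` of a smooth map `f : W → V` along `v : W`. -/
def dirDeriv (v : W) (f : W → V) : W → V :=
  fun x => (coords V).symm (fderiv ℝ (inCoords f) (coords W x) (coords W v))

lemma IsSmooth.zero : IsSmooth (0 : W → V) := by
  have : inCoords (0 : W → V) = fun _ => 0 := by funext x; simp [inCoords]
  unfold IsSmooth
  rw [this]
  exact contDiff_const

lemma inCoords_add (f g : W → V) : inCoords (f + g) = inCoords f + inCoords g := by
  funext x; simp [inCoords]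

lemma inCoords_smul (c : ℝ) (f : W → V) : inCoords (c • f) = c • inCoords f := by
  funext x; simp [inCoords]

lemma IsSmooth.add {f g : W → V} (hf : IsSmooth f) (hg : IsSmooth g) : IsSmooth (f + g) := by
  unfold IsSmooth at *
  rw [inCoords_add]
  exact ContDiff.add hf hg

lemma IsSmooth.smul (c : ℝ) {f : W → V} (hf : IsSmooth f) : IsSmooth (c • f) := by
  unfold IsSmooth at *
  rw [inCoords_smul]
  exact contDiff_const.smul hf

lemma IsSmooth.bilin (B : V₁ →ₗ[ℝ] V₂ →ₗ[ℝ] V) {f : W → V₁} {g : W → V₂}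
    (hf : IsSmooth f) (hg : IsSmooth g) : IsSmooth (fun x => B (f x) (g x)) := by
  unfold IsSmooth at *
  have key : inCoords (fun x => B (f x) (g x)) = fun y =>
      ∑ i, ∑ j, (inCoords f y i * inCoords g y j) •
        coords V (B (Module.finBasis ℝ V₁ i) (Module.finBasis ℝ V₂ j)) := by
    funext y
    have h1 := (Module.finBasis ℝ V₁).sum_equivFun (f ((coords W).symm y))
    have h2 := (Module.finBasis ℝ V₂).sum_equivFun (g ((coords W).symm y))
    simp only [inCoords]
    conv_lhs => rw [← h1, ← h2]
    simp only [map_sum, LinearMap.sum_apply, map_smul, LinearMap.smul_apply, smul_smul,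
      Finset.smul_sum, coords]
    rw [Finset.sum_comm]
    simp only [mul_comm]
  rw [key]
  refine ContDiff.sum fun i _ => ContDiff.sum fun j _ => ?_
  have h1 := contDiff_pi.1 hf i
  have h2 := contDiff_pi.1 hg j
  fun_prop

lemma IsSmooth.const (c : V) : IsSmooth (fun _ : W => c) := by
  unfold IsSmooth inCoords
  exact contDiff_const

lemma IsSmooth.sum {ι : Type*} (s : Finset ι) {f : ι → W → V} (hf : ∀ i ∈ s, IsSmooth (f i)) :
    IsSmooth (∑ i ∈ s, f i) :=
  Finset.sum_induction f IsSmooth (fun _ _ => IsSmooth.add) IsSmooth.zero hf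

lemma IsSmooth.dirDeriv {f : W → V} (hf : IsSmooth f) (v : W) : IsSmooth (dirDeriv v f) := by
  unfold IsSmooth at *
  have : inCoords (DynR.dirDeriv v f) = fun y => fderiv ℝ (inCoords f) y (coords W v) := by
    funext y; simp [inCoords, DynR.dirDeriv]
  rw [this]
  exact (hf.fderiv_right (m := ∞) (by simp)).clm_apply contDiff_const

lemma IsSmooth.dirDeriv_add {f g : W → V} (hf : IsSmooth f) (hg : IsSmooth g) (v : W) :
    DynR.dirDeriv v (f + g) = DynR.dirDeriv v f + DynR.dirDeriv v g := by
  funext x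
  simp only [DynR.dirDeriv, Pi.add_apply, inCoords_add]
  rw [fderiv_add (ContDiff.differentiable hf (by simp) _)
    (ContDiff.differentiable hg (by simp) _)]
  simp

lemma IsSmooth.dirDeriv_smul (c : ℝ) {f : W → V} (hf : IsSmooth f) (v : W) :
    DynR.dirDeriv v (c • f) = c • DynR.dirDeriv v f := by
  funext x
  simp only [DynR.dirDeriv, Pi.smul_apply, inCoords_smul]
  rw [fderiv_const_smul (ContDiff.differentiable hf (by simp) _)]
  simp

end Smooth

section Algebra

variable {𝔤 : Type*} [LieRing 𝔤] [LieAlgebra ℝ 𝔤]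

/-- The interior product `ξ ⌋ P` of a multivector `P` by a covector `ξ`: the antiderivation
of `∧𝔤` with `ξ ⌋ x = ξ x` for `x : 𝔤`. -/
def interiorProduct (ξ : Dual ℝ 𝔤) : ExteriorAlgebra ℝ 𝔤 →ₗ[ℝ] ExteriorAlgebra ℝ 𝔤 :=
  CliffordAlgebra.contractLeft (Q := (0 : QuadraticForm ℝ 𝔤)) ξ

lemma interiorProduct_ιMulti (ξ : Dual ℝ 𝔤) {k : ℕ} (v : Fin (k + 1) → 𝔤) :
    interiorProduct ξ (ExteriorAlgebra.ιMulti ℝ (k + 1) v) =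
      ∑ i : Fin (k + 1), ((-1) ^ (i : ℕ) * ξ (v i)) •
        ExteriorAlgebra.ιMulti ℝ k (i.removeNth v) := by
  have step : ∀ (a : 𝔤) (b : ExteriorAlgebra ℝ 𝔤),
      interiorProduct ξ (ExteriorAlgebra.ι ℝ a * b) =
        ξ a • b - ExteriorAlgebra.ι ℝ a * interiorProduct ξ b := fun a b =>
    CliffordAlgebra.contractLeft_ι_mul ξ a b
  induction k with
  | zero =>
    rw [ExteriorAlgebra.ιMulti_succ_apply, step, ExteriorAlgebra.ιMulti_zero_apply]
    have : interiorProduct ξ (1 : ExteriorAlgebra ℝ 𝔤) = 0 :=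
      CliffordAlgebra.contractLeft_one (Q := (0 : QuadraticForm ℝ 𝔤)) ξ
    simp [this]
  | succ k ih =>
    rw [ExteriorAlgebra.ιMulti_succ_apply, step, ih, Fin.sum_univ_succ (n := k + 1), sub_eq_add_neg]
    congr 1
    · have h1 : Matrix.vecTail v = (0 : Fin (k + 2)).removeNth v := by
        funext m
        simp [Matrix.vecTail, Fin.removeNth]
      rw [h1]
      simp
    · rw [Finset.mul_sum, ← Finset.sum_neg_distrib]
      refine Finset.sum_congr rfl fun j _ => ?_
      rw [ExteriorAlgebra.ιMulti_succ_apply]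
      have h1 : Matrix.vecTail (j.succ.removeNth v) = j.removeNth (Matrix.vecTail v) := by
        funext m
        simp [Matrix.vecTail, Fin.removeNth]
      rw [h1, mul_smul_comm, ← neg_smul]
      simp [Matrix.vecTail, Fin.removeNth, pow_succ]

variable [FiniteDimensional ℝ 𝔤]

instance : FiniteDimensional ℝ (ExteriorAlgebra ℝ 𝔤) :=
  (Module.finBasis ℝ 𝔤).ExteriorAlgebra.finiteDimensional_of_finite

/-- The Schouten bracket `∧^k 𝔤 ⊗ ∧^l 𝔤 → ∧^(k+l-1) 𝔤` induced by the Lie bracket of `𝔤`,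
`[x₁∧…∧x_k, y₁∧…∧y_l] = ∑_{i,j} (-1)^(i+j) [x_i,y_j] ∧ x₁∧…x̂_i…∧x_k ∧ y₁∧…ŷ_j…∧y_l`,
written as `[P,Q] = ∑_{a,b} [e_a,e_b] ∧ (e^a ⌋ P) ∧ (e^b ⌋ Q)` in a basis `e` of `𝔤` with dual
basis `e^a`; see `schouten_ιMulti` for the formula on decomposable multivectors. -/
def schouten :
    ExteriorAlgebra ℝ 𝔤 →ₗ[ℝ] ExteriorAlgebra ℝ 𝔤 →ₗ[ℝ] ExteriorAlgebra ℝ 𝔤 :=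
  ∑ a, ∑ b, (LinearMap.mul ℝ (ExteriorAlgebra ℝ 𝔤)).compl₁₂
    (LinearMap.mulLeft ℝ (ExteriorAlgebra.ι ℝ ⁅Module.finBasis ℝ 𝔤 a, Module.finBasis ℝ 𝔤 b⁆) ∘ₗ
      interiorProduct ((Module.finBasis ℝ 𝔤).coord a))
    (interiorProduct ((Module.finBasis ℝ 𝔤).coord b))

lemma schouten_apply (P Q : ExteriorAlgebra ℝ 𝔤) :
    schouten P Q = ∑ a, ∑ b,
      ExteriorAlgebra.ι ℝ ⁅Module.finBasis ℝ 𝔤 a, Module.finBasis ℝ 𝔤 b⁆ *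
        interiorProduct ((Module.finBasis ℝ 𝔤).coord a) P *
        interiorProduct ((Module.finBasis ℝ 𝔤).coord b) Q := by
  simp [schouten, LinearMap.sum_apply]

/-- The Schouten bracket of decomposable multivectors. -/
lemma schouten_ιMulti {k l : ℕ} (x : Fin (k + 1) → 𝔤) (y : Fin (l + 1) → 𝔤) :
    schouten (ExteriorAlgebra.ιMulti ℝ (k + 1) x) (ExteriorAlgebra.ιMulti ℝ (l + 1) y) =
      ∑ i : Fin (k + 1), ∑ j : Fin (l + 1), (-1 : ℝ) ^ (i + j : ℕ) •
        (ExteriorAlgebra.ι ℝ ⁅x i, y j⁆ * ExteriorAlgebra.ιMulti ℝ k (i.removeNth x) *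
          ExteriorAlgebra.ιMulti ℝ l (j.removeNth y)) := by
  have key : ∀ u w : 𝔤, ⁅u, w⁆ = ∑ a, ∑ b,
      ((Module.finBasis ℝ 𝔤).coord a u * (Module.finBasis ℝ 𝔤).coord b w) •
        ⁅Module.finBasis ℝ 𝔤 a, Module.finBasis ℝ 𝔤 b⁆ := by
    intro u w
    conv_lhs => rw [← (Module.finBasis ℝ 𝔤).sum_repr u, ← (Module.finBasis ℝ 𝔤).sum_repr w]
    simp only [sum_lie, lie_sum, lie_smul, smul_lie, Module.Basis.coord_apply, Finset.smul_sum,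
      smul_smul]
    rw [Finset.sum_comm]
    simp only [mul_comm]
  have lhs : ∀ a b, ExteriorAlgebra.ι ℝ ⁅Module.finBasis ℝ 𝔤 a, Module.finBasis ℝ 𝔤 b⁆ *
        interiorProduct ((Module.finBasis ℝ 𝔤).coord a) (ExteriorAlgebra.ιMulti ℝ (k + 1) x) *
        interiorProduct ((Module.finBasis ℝ 𝔤).coord b) (ExteriorAlgebra.ιMulti ℝ (l + 1) y) =
      ∑ i : Fin (k + 1), ∑ j : Fin (l + 1), ((-1 : ℝ) ^ (i + j : ℕ) *
        ((Module.finBasis ℝ 𝔤).coord a (x i) * (Module.finBasis ℝ 𝔤).coord b (y j))) •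
        (ExteriorAlgebra.ι ℝ ⁅Module.finBasis ℝ 𝔤 a, Module.finBasis ℝ 𝔤 b⁆ *
          ExteriorAlgebra.ιMulti ℝ k (i.removeNth x) *
          ExteriorAlgebra.ιMulti ℝ l (j.removeNth y)) := by
    intro a b
    rw [interiorProduct_ιMulti, interiorProduct_ιMulti, Finset.mul_sum (a := ExteriorAlgebra.ι ℝ _),
      Finset.sum_mul_sum]
    refine Finset.sum_congr rfl fun i _ => Finset.sum_congr rfl fun j _ => ?_
    rw [mul_smul_comm, mul_smul_comm, smul_mul_assoc, smul_smul]
    congr 1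
    ring
  rw [schouten_apply]
  simp only [lhs]
  rw [Finset.sum_congr rfl fun a _ => Finset.sum_comm, Finset.sum_comm]
  refine Finset.sum_congr rfl fun i _ => ?_
  rw [Finset.sum_congr rfl fun a _ => Finset.sum_comm, Finset.sum_comm]
  refine Finset.sum_congr rfl fun j _ => ?_
  rw [key (x i) (y j)]
  simp only [map_sum, map_smul, Finset.sum_mul, smul_mul_assoc, Finset.smul_sum, smul_smul]

end Algebra

section Dynamical

variable {𝔤 : Type*} [LieRing 𝔤] [LieAlgebra ℝ 𝔤] [FiniteDimensional ℝ 𝔤]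

/-- The space `C^∞(𝔥*, ∧𝔤)` of smooth maps from `𝔥*` to the exterior algebra of `𝔤`. -/
def SmoothMaps (𝔥 : LieSubalgebra ℝ 𝔤) : Submodule ℝ (Dual ℝ 𝔥 → ExteriorAlgebra ℝ 𝔤) where
  carrier := {τ | IsSmooth τ}
  add_mem' hf hg := hf.add hg
  zero_mem' := IsSmooth.zero
  smul_mem' c _ hf := hf.smul c

variable {𝔥 : LieSubalgebra ℝ 𝔤} {ι : Type*} [Fintype ι] [DecidableEq ι]

/-- The operator `τ ↦ ∑ᵢ hᵢ ∧ ∂τ/∂λⁱ`, where `h` is a basis of `𝔥` and `λⁱ` are the induced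
linear coordinates on `𝔥*`, so that `∂/∂λⁱ` is the derivative along the `i`-th dual basis
vector. -/
def wedgeDeriv (h : Basis ι ℝ 𝔥) : SmoothMaps 𝔥 →ₗ[ℝ] SmoothMaps 𝔥 where
  toFun τ := ⟨∑ i, fun l => ExteriorAlgebra.ι ℝ (h i : 𝔤) * dirDeriv (h.dualBasis i) τ.1 l,
    IsSmooth.sum _ fun i _ => IsSmooth.bilin (LinearMap.mul ℝ (ExteriorAlgebra ℝ 𝔤))
      (IsSmooth.const _) (IsSmooth.dirDeriv τ.2 _)⟩
  map_add' τ σ := by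
    ext l
    simp [IsSmooth.dirDeriv_add τ.2 σ.2, mul_add, Finset.sum_add_distrib]
  map_smul' c τ := by
    ext l
    simp [IsSmooth.dirDeriv_smul c τ.2, Finset.smul_sum]

/-- The pointwise Schouten bracket `[r, τ]`. -/
def bracket (r : SmoothMaps 𝔥) : SmoothMaps 𝔥 →ₗ[ℝ] SmoothMaps 𝔥 where
  toFun τ := ⟨fun l => schouten (r.1 l) (τ.1 l), IsSmooth.bilin schouten r.2 τ.2⟩
  map_add' τ σ := by ext l; simp
  map_smul' c τ := by ext l; simp

/-- `δ_r τ = ∑ᵢ hᵢ ∧ ∂τ/∂λⁱ + [r, τ]`. -/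
def delta (h : Basis ι ℝ 𝔥) (r : SmoothMaps 𝔥) : SmoothMaps 𝔥 →ₗ[ℝ] SmoothMaps 𝔥 :=
  wedgeDeriv h + bracket r

variable (𝔥) in
/-- `C^k = C^∞(𝔥*, (∧^k 𝔤)^𝔥)`. -/
def cochains (k : ℕ) : Submodule ℝ (SmoothMaps 𝔥) where
  carrier := {τ | ∀ l : Dual ℝ 𝔥, τ.1 l ∈ ⋀[ℝ]^k 𝔤 ∧
    ∀ x : 𝔥, schouten (ExteriorAlgebra.ι ℝ (x : 𝔤)) (τ.1 l) = 0}
  add_mem' hf hg l := ⟨add_mem (hf l).1 (hg l).1, fun x => by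
    simp [(hf l).2 x, (hg l).2 x]⟩
  zero_mem' l := ⟨zero_mem _, fun x => by simp⟩
  smul_mem' c _ hf l := ⟨Submodule.smul_mem _ c (hf l).1, fun x => by simp [(hf l).2 x]⟩

/-- `r` is a triangular dynamical `r`-matrix: a smooth map `𝔥* → ∧² 𝔤` of zero weight
satisfying the classical dynamical Yang–Baxter equation
`∑ᵢ hᵢ ∧ ∂r/∂λⁱ + ½ [r, r] = 0`. -/
structure IsTriangular (h : Basis ι ℝ 𝔥) (r : SmoothMaps 𝔥) : Prop where
  bivector : ∀ l : Dual ℝ 𝔥, r.1 l ∈ ⋀[ℝ]^2 𝔤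
  zero_weight : ∀ (l : Dual ℝ 𝔥) (x : 𝔥), schouten (ExteriorAlgebra.ι ℝ (x : 𝔤)) (r.1 l) = 0
  cdybe : wedgeDeriv h r + (1 / 2 : ℝ) • bracket r r = 0

/-- The map `P^# : 𝔤* → 𝔤`, `η (P^# ξ) = P(ξ, η)`, of a bivector `P`; thus
`(x ∧ y)^# ξ = ξ x • y - ξ y • x`.  (`ιInv` identifies `∧¹ 𝔤` with `𝔤`.) -/
def sharp (P : ExteriorAlgebra ℝ 𝔤) : Dual ℝ 𝔤 →ₗ[ℝ] 𝔤 where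
  toFun ξ := ExteriorAlgebra.ιInv (interiorProduct ξ P)
  map_add' ξ η := by simp [interiorProduct]
  map_smul' c ξ := by simp [interiorProduct]

/-- `𝔤_λ = 𝔥 + r(λ)^# 𝔥^⊥`. -/
def gSub (r : SmoothMaps 𝔥) (l : Dual ℝ 𝔥) : Submodule ℝ 𝔤 :=
  𝔥.toSubmodule ⊔ 𝔥.toSubmodule.dualAnnihilator.map (sharp (r.1 l))

/-- The rank `dim 𝔤_λ - dim 𝔥` of `r` at `λ`. -/
def rankAt (r : SmoothMaps 𝔥) (l : Dual ℝ 𝔥) : ℤ :=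
  (finrank ℝ (gSub r l) : ℤ) - finrank ℝ 𝔥

/-- `r` is non-degenerate if its rank is `dim 𝔤 - dim 𝔥`. -/
def IsNondegenerate (r : SmoothMaps 𝔥) : Prop :=
  ∀ l : Dual ℝ 𝔥, rankAt r l = (finrank ℝ 𝔤 : ℤ) - finrank ℝ 𝔥

/-- The `k`-cocycles of the complex `(C^•, δ_r)`. -/
def cocycles (h : Basis ι ℝ 𝔥) (r : SmoothMaps 𝔥) (k : ℕ) : Submodule ℝ (SmoothMaps 𝔥) :=
  cochains 𝔥 k ⊓ LinearMap.ker (delta h r)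

/-- The `k`-coboundaries `δ_r (C^(k-1))` of the complex `(C^•, δ_r)`, with `C^(-1) = 0`. -/
def coboundaries (h : Basis ι ℝ 𝔥) (r : SmoothMaps 𝔥) : ℕ → Submodule ℝ (SmoothMaps 𝔥)
  | 0 => ⊥
  | k + 1 => (cochains 𝔥 k).map (delta h r)

/-- The dynamical `r`-matrix cohomology `H^k_r(𝔤, 𝔥)`. -/
abbrev Cohomology (h : Basis ι ℝ 𝔥) (r : SmoothMaps 𝔥) (k : ℕ) : Type _ :=
  Subquotient (cocycles h r k) (coboundaries h r k)

end Dynamical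

section Relative

variable {𝔤 : Type*} [LieRing 𝔤] [LieAlgebra ℝ 𝔤]

/-- The Lie derivative of an alternating form,
`(L_x α)(y₁,…,y_k) = -∑ⱼ α(y₁,…,[x,yⱼ],…,y_k)`. -/
def lieDeriv {k : ℕ} (x : 𝔤) (α : 𝔤 [⋀^Fin k]→ₗ[ℝ] ℝ) : 𝔤 [⋀^Fin k]→ₗ[ℝ] ℝ where
  toFun y := -∑ j, α (Function.update y j ⁅x, y j⁆)
  map_update_add' := by
    intro inst y i a b
    obtain rfl : inst = instDecidableEqFin k := Subsingleton.elim _ _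
    rw [← neg_add, ← Finset.sum_add_distrib]
    congr 1
    refine Finset.sum_congr rfl fun j _ => ?_
    by_cases hij : j = i
    · subst hij
      simp
    · simp only [Function.update_of_ne hij]
      simp [Function.update_comm (Ne.symm hij)]
  map_update_smul' := by
    intro inst y i c a
    obtain rfl : inst = instDecidableEqFin k := Subsingleton.elim _ _
    rw [smul_neg, Finset.smul_sum]
    congr 1
    refine Finset.sum_congr rfl fun j _ => ?_
    by_cases hij : j = i
    · subst hij
      simp
    · simp only [Function.update_of_ne hij]
      simp [Function.update_comm (Ne.symm hij)]
  map_eq_zero_of_eq' := by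
    intro y i j hy hij
    rw [neg_eq_zero, Fintype.sum_eq_add i j hij]
    · have h1 : Function.update y j ⁅x, y j⁆ =
          (Function.update y i ⁅x, y i⁆) ∘ Equiv.swap i j := by
        funext m
        by_cases hmi : m = i
        · subst hmi
          simp [Function.update_of_ne hij, Function.update_of_ne hij.symm, hy]
        · by_cases hmj : m = j
          · subst hmj
            simp [hy]
          · simp [Equiv.swap_apply_of_ne_of_ne hmi hmj, hmi, hmj]
      rw [h1, AlternatingMap.map_swap _ _ hij]
      simp
    · rintro m ⟨hmi, hmj⟩
      refine α.map_eq_zero_of_eq _ ?_ hij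
      rw [Function.update_of_ne hmi.symm, Function.update_of_ne hmj.symm, hy]

/-- The Lie derivative, as a map linear in the vector and in the form. -/
def lieDerivₗ (k : ℕ) : (𝔤 [⋀^Fin k]→ₗ[ℝ] ℝ) →ₗ[ℝ] 𝔤 →ₗ[ℝ] 𝔤 [⋀^Fin k]→ₗ[ℝ] ℝ :=
  LinearMap.mk₂ ℝ (fun α x => lieDeriv x α)
    (fun α η x => by ext y; simp [lieDeriv, Finset.sum_add_distrib]; ring)
    (fun c α x => by ext y; simp [lieDeriv, Finset.mul_sum])
    (fun α x x' => by ext y; simp [lieDeriv, Finset.sum_add_distrib]; ring)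
    (fun c α x => by ext y; simp [lieDeriv, Finset.mul_sum])

/-- The Chevalley–Eilenberg differential with trivial coefficients,
`(dα)(x₀,…,x_k) = ∑_{i<j} (-1)^(i+j) α([xᵢ,xⱼ],x₀,…,x̂ᵢ,…,x̂ⱼ,…,x_k)`,
in the form `(dα)(x₀,…,x_k) = ½ ∑ᵢ (-1)^i (L_{xᵢ} α)(x₀,…,x̂ᵢ,…,x_k)`;
see `ceDiff_apply` for the first formula. -/
def ceDiff (k : ℕ) : (𝔤 [⋀^Fin k]→ₗ[ℝ] ℝ) →ₗ[ℝ] (𝔤 [⋀^Fin (k + 1)]→ₗ[ℝ] ℝ) :=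
  (1 / 2 : ℝ) • (AlternatingMap.alternatizeUncurryFinLM ∘ₗ lieDerivₗ k)

/-- The usual formula for the Chevalley–Eilenberg differential.  The pair `i ≤ j` of indices
corresponds to the pair `i < j + 1` of positions, whence the sign. -/
lemma ceDiff_apply {k : ℕ} (α : 𝔤 [⋀^Fin (k + 1)]→ₗ[ℝ] ℝ) (x : Fin (k + 2) → 𝔤) :
    ceDiff (k + 1) α x = -∑ i : Fin (k + 1), ∑ j ≥ i, (-1) ^ (i + j : ℕ) *
      α (Matrix.vecCons ⁅x i.castSucc, x j.succ⁆ (j.removeNth (i.castSucc.removeNth x))) := by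
  have h0 : ceDiff (k + 1) α x = (1 / 2 : ℝ) * ∑ i : Fin (k + 2), ∑ j : Fin (k + 1),
      (-1) ^ (i : ℕ) * -α (j.insertNth ⁅x i, i.removeNth x j⁆ (j.removeNth (i.removeNth x))) := by
    simp only [ceDiff, LinearMap.smul_apply, LinearMap.comp_apply,
      AlternatingMap.alternatizeUncurryFinLM_apply, AlternatingMap.smul_apply,
      AlternatingMap.alternatizeUncurryFin_apply, smul_eq_mul]
    congr 1
    refine Finset.sum_congr rfl fun i _ => ?_
    rw [← Finset.mul_sum, Finset.sum_neg_distrib]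
    simp [lieDerivₗ, lieDeriv, Fin.insertNth_removeNth]
  rw [h0, Fin.sum_sum_eq_sum_triangle_add, ← Finset.sum_neg_distrib, Finset.mul_sum]
  refine Finset.sum_congr rfl fun i _ => ?_
  rw [← Finset.sum_neg_distrib, Finset.mul_sum]
  refine Finset.sum_congr rfl fun j hj => ?_
  rw [Finset.mem_Ici] at hj
  have H₁ : i.castSucc.succAbove j = j.succ := by simp [Fin.succAbove_of_le_castSucc, hj]
  have H₂ : j.predAbove i.castSucc = i := by simp [Fin.predAbove_of_le_castSucc, hj]
  have H₃ : j.succ.succAbove i = i.castSucc := by simp [Fin.succAbove_of_castSucc_lt, hj]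
  have H₄ := Fin.removeNth_removeNth_eq_swap x j i.castSucc
  rw [H₁, H₂] at H₄
  rw [← H₄, AlternatingMap.map_insertNth, AlternatingMap.map_insertNth,
    show i.castSucc.removeNth x j = x j.succ by simp [Fin.removeNth, H₁],
    show j.succ.removeNth x i = x i.castSucc by simp [Fin.removeNth, H₃],
    ← lie_skew (x i.castSucc) (x j.succ)]
  have H₅ : ∀ (a : 𝔤) (w : Fin k → 𝔤),
      α (Matrix.vecCons (-a) w) = -α (Matrix.vecCons a w) := fun a w => by
    have := AlternatingMap.map_vecCons_smul α w (-1 : ℝ) a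
    simpa using this
  rw [H₅]
  simp only [zsmul_eq_mul, Fin.val_castSucc, Fin.val_succ, pow_add, pow_one]
  push_cast
  ring

/-- The relative cochains `C^k(𝔤, 𝔥) = ((∧^k (𝔤/𝔥))*)^𝔥`: alternating `k`-forms on `𝔤` which
vanish when one argument lies in `𝔥` and are `𝔥`-invariant. -/
def relCochains (𝔥 : LieSubalgebra ℝ 𝔤) (k : ℕ) : Submodule ℝ (𝔤 [⋀^Fin k]→ₗ[ℝ] ℝ) where
  carrier := {α | (∀ y : Fin k → 𝔤, (∃ i, y i ∈ 𝔥) → α y = 0) ∧ ∀ x ∈ 𝔥, lieDerivₗ k α x = 0}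
  add_mem' hf hg := ⟨fun y hy => by simp [hf.1 y hy, hg.1 y hy], fun x hx => by
    simp [hf.2 x hx, hg.2 x hx]⟩
  zero_mem' := ⟨fun y hy => by simp, fun x hx => by simp⟩
  smul_mem' c _ hf := ⟨fun y hy => by simp [hf.1 y hy], fun x hx => by simp [hf.2 x hx]⟩

/-- The `k`-cocycles of the relative complex `(C^•(𝔤, 𝔥), d)`. -/
def relCocycles (𝔥 : LieSubalgebra ℝ 𝔤) (k : ℕ) : Submodule ℝ (𝔤 [⋀^Fin k]→ₗ[ℝ] ℝ) :=
  relCochains 𝔥 k ⊓ LinearMap.ker (ceDiff k)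

/-- The `k`-coboundaries `d (C^(k-1)(𝔤, 𝔥))` of the relative complex, with `C^(-1) = 0`. -/
def relCoboundaries (𝔥 : LieSubalgebra ℝ 𝔤) : (k : ℕ) → Submodule ℝ (𝔤 [⋀^Fin k]→ₗ[ℝ] ℝ)
  | 0 => ⊥
  | k + 1 => (relCochains 𝔥 k).map (ceDiff k)

/-- The relative Lie algebra cohomology `H^k(𝔤, 𝔥)` with trivial coefficients. -/
abbrev RelCohomology (𝔥 : LieSubalgebra ℝ 𝔤) (k : ℕ) : Type _ :=
  Subquotient (relCocycles 𝔥 k) (relCoboundaries 𝔥 k)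

end Relative

end DynR

end

/-! The cochains `C^•` are recognised as a disguised de Rham complex on 𝔥* with values in relative
Lie algebra cochains, and the Poincaré lemma on 𝔥* removes the de Rham factor.

Let G be a group with Lie algebra 𝔤. Forms on 𝔥* × G which are left invariant along G are functions
from 𝔥* to ∧(𝔥 × 𝔤*) (`Forms`), since the cotangent space of 𝔥* is 𝔥. Their exterior derivative is D
= ∑ hᵢ ∧ ∂/∂λⁱ + d (`totalDiff`), with d the Chevalley–Eilenberg differential (`gDiff`). Only the
algebra is used; the group never appears.

For each λ the map (v, ξ) ↦ v - r(λ)^# ξ (`frame`) extends to an algebra homomorphism `frameMap`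
from forms to multivectors. The Yang–Baxter equation contracted with a covector compares D with δ_r
on generators (`contract_cdybe`). A Leibniz argument extends this to all forms (`frameMap_gDiff`):
the two differentials correspond up to ∑ ∂r/∂λⁱ ∧ `frameMap`(hᵢ ⌋ w), which vanishes on horizontal
forms, those killed by contraction with 𝔥 ⊂ 𝔤. Zero weight of r and commutativity of 𝔥 make
`frameMap` equivariant under 𝔥 (`frameMap_gLie`).

Non-degeneracy says that `frame` restricts to a bijection 𝔥 × 𝔥^⊥ → 𝔤
(`frame_horizontalIncl_bijective`). Hence `frameMap` identifies basic forms with invariant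
multivectors, smoothly in λ (`coframeMap_frameMap`, `coframeMap_mem`, `isSmooth_coframeMap`), and
(C^•, δ_r) becomes the complex of smooth families of basic forms under D (`delta_frameSmooth`,
`exists_frameSmooth_eq`). That δ_r squares to zero is then D² = 0.

Finally, contracting 𝔥* to the origin (`totalDiff_homotopy_add`) shows that a D-closed family
differs by a D-exact one from the constant family given by its value at 0 with all 𝔥-components
removed, which is a relative cocycle. In the other direction, evaluating at 0 and dropping
𝔥-components commutes with the differentials (`toAlt_totalDiff`), so it turns primitives into
primitives. So `comparison`, which sends a relative cochain to the image of the constant family, is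
an isomorphism on cohomology. -/

noncomputable section

namespace DynR

/-! ### Differential calculus for `IsSmooth` and `dirDeriv`. -/

section SmoothCalculus

variable {W V U V₁ V₂ : Type*}
  [AddCommGroup W] [Module ℝ W] [FiniteDimensional ℝ W]
  [AddCommGroup V] [Module ℝ V] [FiniteDimensional ℝ V]
  [AddCommGroup U] [Module ℝ U] [FiniteDimensional ℝ U]
  [AddCommGroup V₁] [Module ℝ V₁] [FiniteDimensional ℝ V₁]
  [AddCommGroup V₂] [Module ℝ V₂] [FiniteDimensional ℝ V₂]
  {E F : Type*} [NormedAddCommGroup E] [NormedSpace ℝ E] [FiniteDimensional ℝ E]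
  [NormedAddCommGroup F] [NormedSpace ℝ F]

lemma inCoords_comp (f : V → U) (g : W → V) :
    inCoords (fun x => f (g x)) = fun x => inCoords f (inCoords g x) := by
  funext x; simp [inCoords]

lemma coords_dirDeriv (v : W) (f : W → V) (x : W) :
    coords V (dirDeriv v f x) = fderiv ℝ (inCoords f) (coords W x) (coords W v) := by
  simp [dirDeriv]

lemma IsSmooth.contDiff_inCoords {f : W → V} (hf : IsSmooth f) : ContDiff ℝ ∞ (inCoords f) := hf

lemma IsSmooth.differentiableAt {f : W → V} (hf : IsSmooth f) (x : Fin (finrank ℝ W) → ℝ) :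
    DifferentiableAt ℝ (inCoords f) x :=
  ContDiff.differentiable hf (by simp) x

/-- Together with `IsSmooth.hasFDerivAt` and `IsSmooth.of_contDiff`, this trades the fixed
coordinates `coords` for any normed model. Such freedom is needed where the natural model is a
product `(Fin n → ℝ) × ℝ` or a Banach algebra of endomorphisms. -/
lemma IsSmooth.contDiff {f : W → V} (hf : IsSmooth f) (A : E →ₗ[ℝ] W) (B : V →ₗ[ℝ] F) :
    ContDiff ℝ ∞ (fun x => B (f (A x))) := by
  have : (fun x => B (f (A x))) = fun x =>
      (B ∘ₗ (coords V).symm.toLinearMap).toContinuousLinearMap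
        (inCoords f ((coords W).toLinearMap ∘ₗ A |>.toContinuousLinearMap x)) := by
    funext x; simp [inCoords]
  rw [this]
  exact (ContinuousLinearMap.contDiff _).comp (hf.contDiff_inCoords.comp (ContinuousLinearMap.contDiff _))

lemma IsSmooth.hasFDerivAt {f : W → V} (hf : IsSmooth f) (A : E →ₗ[ℝ] W) (B : V →ₗ[ℝ] F)
    (x : E) : ∃ D : E →L[ℝ] F, HasFDerivAt (fun x => B (f (A x))) D x ∧
      ∀ v, D v = B (DynR.dirDeriv (A v) f (A x)) := by
  have h : (fun x => B (f (A x))) = fun x =>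
      (B ∘ₗ (coords V).symm.toLinearMap).toContinuousLinearMap
        (inCoords f ((coords W).toLinearMap ∘ₗ A |>.toContinuousLinearMap x)) := by
    funext x; simp [inCoords]
  rw [h]
  refine ⟨_, ((ContinuousLinearMap.hasFDerivAt _).comp x
    ((hf.differentiableAt _).hasFDerivAt.comp x (ContinuousLinearMap.hasFDerivAt _))), fun v => ?_⟩
  simp [DynR.dirDeriv]

omit [FiniteDimensional ℝ E] in
lemma IsSmooth.of_contDiff {f : W → V} (A : E ≃ₗ[ℝ] W) (B : V ≃ₗ[ℝ] F)
    (hf : ContDiff ℝ ∞ (fun x => B (f (A x)))) : IsSmooth f := by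
  have : FiniteDimensional ℝ F := B.finiteDimensional
  have h : inCoords f = fun x => (B.symm ≪≫ₗ coords V).toLinearMap.toContinuousLinearMap
      ((fun x => B (f (A x)))
        (((coords W).symm ≪≫ₗ A.symm).toLinearMap.toContinuousLinearMap x)) := by
    funext x; simp [inCoords]
  unfold IsSmooth
  rw [h]
  exact (ContinuousLinearMap.contDiff _).comp (hf.comp (ContinuousLinearMap.contDiff _))

lemma IsSmooth.comp {f : V → U} {g : W → V} (hf : IsSmooth f) (hg : IsSmooth g) :
    IsSmooth (fun x => f (g x)) := by
  unfold IsSmooth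
  rw [inCoords_comp]
  exact hf.contDiff_inCoords.comp hg.contDiff_inCoords

lemma dirDeriv_comp {f : V → U} {g : W → V} (hf : IsSmooth f) (hg : IsSmooth g) (v x : W) :
    dirDeriv v (fun x => f (g x)) x = dirDeriv (dirDeriv v g x) f (g x) := by
  apply (coords U).injective
  rw [coords_dirDeriv, coords_dirDeriv, coords_dirDeriv, inCoords_comp]
  have := (hf.differentiableAt (inCoords g (coords W x))).hasFDerivAt.comp (coords W x)
    (hg.differentiableAt (coords W x)).hasFDerivAt
  have h2 : fderiv ℝ (fun x => inCoords f (inCoords g x)) (coords W x) = _ := this.fderiv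
  rw [h2]
  simp [inCoords]

lemma inCoords_linear (L : V →ₗ[ℝ] U) : inCoords L =
    ((coords U).toLinearMap ∘ₗ L ∘ₗ (coords V).symm.toLinearMap).toContinuousLinearMap := by
  funext x; simp [inCoords]

lemma IsSmooth.linear (L : V →ₗ[ℝ] U) : IsSmooth L := by
  unfold IsSmooth
  rw [inCoords_linear]
  exact ContinuousLinearMap.contDiff _

lemma dirDeriv_linear (L : V →ₗ[ℝ] U) (v x : V) : dirDeriv v L x = L v := by
  apply (coords U).injective
  rw [coords_dirDeriv, inCoords_linear, ContinuousLinearMap.fderiv]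
  simp

lemma IsSmooth.linear_comp (L : V →ₗ[ℝ] U) {f : W → V} (hf : IsSmooth f) :
    IsSmooth (fun x => L (f x)) := (IsSmooth.linear L).comp hf

lemma dirDeriv_linear_comp (L : V →ₗ[ℝ] U) {f : W → V} (hf : IsSmooth f) (v x : W) :
    dirDeriv v (fun x => L (f x)) x = L (dirDeriv v f x) := by
  rw [dirDeriv_comp (IsSmooth.linear L) hf, dirDeriv_linear]

lemma dirDeriv_const (c : V) (v x : W) : dirDeriv v (fun _ => c) x = 0 := by
  have : inCoords (fun _ : W => c) = fun _ => coords V c := rfl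
  simp [dirDeriv, this]

/-- The directional derivative is linear in the direction. -/
def dirDerivₗ (f : W → V) (x : W) : W →ₗ[ℝ] V :=
  (coords V).symm.toLinearMap ∘ₗ (fderiv ℝ (inCoords f) (coords W x)).toLinearMap ∘ₗ
    (coords W).toLinearMap

lemma dirDerivₗ_apply (f : W → V) (x v : W) : dirDerivₗ f x v = dirDeriv v f x := rfl

lemma dirDeriv_bilin (B : V₁ →ₗ[ℝ] V₂ →ₗ[ℝ] V) {f : W → V₁} {g : W → V₂}
    (hf : IsSmooth f) (hg : IsSmooth g) (v x : W) :
    dirDeriv v (fun x => B (f x) (g x)) x = B (dirDeriv v f x) (g x) + B (f x) (dirDeriv v g x) := by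
  apply (coords V).injective
  rw [coords_dirDeriv]
  let B' : (Fin (finrank ℝ V₁) → ℝ) →L[ℝ] (Fin (finrank ℝ V₂) → ℝ) →L[ℝ]
      (Fin (finrank ℝ V) → ℝ) :=
    (LinearMap.toContinuousLinearMap.toLinearMap ∘ₗ
      (B.compl₁₂ (coords V₁).symm.toLinearMap (coords V₂).symm.toLinearMap).compr₂
        (coords V).toLinearMap).toContinuousLinearMap
  have hB : ∀ a b, B' a b = coords V (B ((coords V₁).symm a) ((coords V₂).symm b)) := by
    intro a b; simp [B']
  have h : inCoords (fun x => B (f x) (g x)) = fun y => B' (inCoords f y) (inCoords g y) := by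
    funext y; simp [hB, inCoords]
  rw [h]
  have := (B'.hasFDerivAt.comp (coords W x) (hf.differentiableAt (coords W x)).hasFDerivAt).clm_apply
    (hg.differentiableAt (coords W x)).hasFDerivAt
  erw [HasFDerivAt.fderiv this]
  simp [hB, dirDeriv, inCoords, add_comm]

lemma dirDeriv_comm {f : W → V} (hf : IsSmooth f) (v w x : W) :
    dirDeriv v (dirDeriv w f) x = dirDeriv w (dirDeriv v f) x := by
  apply (coords V).injective
  have key : ∀ w : W, inCoords (dirDeriv w f) = fun y => fderiv ℝ (inCoords f) y (coords W w) := by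
    intro w; funext y; simp [inCoords, dirDeriv]
  have hd : DifferentiableAt ℝ (fderiv ℝ (inCoords f)) (coords W x) :=
    ((ContDiff.fderiv_right (m := ∞) hf (by simp)).differentiable (by simp)) _
  have key2 : ∀ u w : W, coords V (dirDeriv u (dirDeriv w f) x) =
      fderiv ℝ (fderiv ℝ (inCoords f)) (coords W x) (coords W u) (coords W w) := by
    intro u w
    rw [coords_dirDeriv, key, fderiv_clm_apply hd (by fun_prop)]
    simp
  rw [key2, key2]
  have hs : IsSymmSndFDerivAt ℝ (inCoords f) (coords W x) :=
    ContDiffAt.isSymmSndFDerivAt (contDiff_infty.1 hf 2).contDiffAt (by simp)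
  exact hs _ _

lemma dirDeriv_add {f g : W → V} (hf : IsSmooth f) (hg : IsSmooth g) (v x : W) :
    dirDeriv v (fun x => f x + g x) x = dirDeriv v f x + dirDeriv v g x :=
  congrFun (IsSmooth.dirDeriv_add hf hg v) x

lemma dirDeriv_sum {κ : Type*} (s : Finset κ) {f : κ → W → V} (hf : ∀ i, IsSmooth (f i))
    (v x : W) : dirDeriv v (fun x => ∑ i ∈ s, f i x) x = ∑ i ∈ s, dirDeriv v (f i) x := by
  classical
  induction s using Finset.induction_on with
  | empty => simpa using dirDeriv_const (0 : V) v x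
  | insert a s ha ih =>
    simp only [Finset.sum_insert ha]
    rw [dirDeriv_add (hf a) (by simpa [Finset.sum_fn] using IsSmooth.sum s fun i _ => hf i), ih]

lemma IsSmooth.fun_sum {κ : Type*} (s : Finset κ) {f : κ → W → V} (hf : ∀ i, IsSmooth (f i)) :
    IsSmooth (fun x => ∑ i ∈ s, f i x) := by
  simpa [Finset.sum_fn] using IsSmooth.sum s fun i _ => hf i

/-- Quotienting by `N` turns membership into the vanishing of a map, and linear maps commute with
derivatives; no closedness argument is needed. -/
lemma dirDeriv_mem (N : Submodule ℝ V) {f : W → V} (hf : IsSmooth f) (hN : ∀ x, f x ∈ N)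
    (v x : W) : dirDeriv v f x ∈ N := by
  have h := dirDeriv_linear_comp N.mkQ hf v x
  have h0 : (fun x => N.mkQ (f x)) = fun _ => 0 := by
    funext x; simpa using hN x
  rw [h0, dirDeriv_const] at h
  simpa using h.symm

/-- A family of linear maps is smooth if it is pointwise smooth. -/
lemma IsSmooth.hom {A : W → V →ₗ[ℝ] U} (hA : ∀ w, IsSmooth (fun x => A x w)) : IsSmooth A := by
  let b := finBasis ℝ V
  have h : A = fun x => ∑ i, (b.coord i).smulRight (A x (b i)) := by
    funext x
    refine b.ext fun j => ?_
    simp [Finsupp.single_apply]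
  rw [h]
  refine IsSmooth.fun_sum _ fun i => ?_
  have := IsSmooth.linear_comp (LinearMap.smulRightₗ (R := ℝ) (M := U) (M₂ := V) (b.coord i)) (hA (b i))
  simpa using this

lemma dirDeriv_hom_apply {A : W → V →ₗ[ℝ] U} (hA : IsSmooth A) (w : V) (v x : W) :
    dirDeriv v A x w = dirDeriv v (fun x => A x w) x :=
  (dirDeriv_linear_comp (LinearMap.applyₗ w) hA v x).symm

lemma IsSmooth.hom_apply {A : W → V →ₗ[ℝ] U} (hA : IsSmooth A) {f : W → V} (hf : IsSmooth f) :
    IsSmooth (fun x => A x (f x)) :=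
  IsSmooth.bilin LinearMap.id hA hf

lemma dirDeriv_hom {A : W → V →ₗ[ℝ] U} (hA : IsSmooth A) {f : W → V} (hf : IsSmooth f)
    (v x : W) :
    dirDeriv v (fun x => A x (f x)) x = dirDeriv v A x (f x) + A x (dirDeriv v f x) :=
  dirDeriv_bilin LinearMap.id hA hf v x

/-- The inverse of a smooth family of linear isomorphisms is smooth. -/
lemma IsSmooth.equiv_symm {A : W → V ≃ₗ[ℝ] U} (hA : IsSmooth (fun x => (A x).toLinearMap)) :
    IsSmooth (fun x => (A x).symm.toLinearMap) := by
  let n := Fin (finrank ℝ V)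
  let cV := coords V
  -- The single isomorphism `A 0` identifies `U` with the coordinate space of `V`. The whole family
  -- then lives in one Banach algebra of endomorphisms, where inversion is smooth at units.
  let cU : U ≃ₗ[ℝ] (n → ℝ) := (A 0).symm ≪≫ₗ cV
  let T : (V →ₗ[ℝ] U) →ₗ[ℝ] ((n → ℝ) →L[ℝ] (n → ℝ)) :=
    LinearMap.toContinuousLinearMap.toLinearMap ∘ₗ
      (LinearEquiv.arrowCongr cV cU).toLinearMap
  let T' : ((n → ℝ) →L[ℝ] (n → ℝ)) ≃ₗ[ℝ] (U →ₗ[ℝ] V) :=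
    LinearMap.toContinuousLinearMap.symm ≪≫ₗ (LinearEquiv.arrowCongr cU cV).symm
  have h1 := hA.contDiff (coords W).symm.toLinearMap T
  refine IsSmooth.of_contDiff (coords W).symm T'.symm ?_
  have e1 : ∀ x, T ((A x).toLinearMap) * T'.symm ((A x).symm.toLinearMap) = 1 := by
    intro x
    ext v
    simp [T, T', cU, LinearEquiv.arrowCongr_apply]
  have e2 : ∀ x, T'.symm ((A x).symm.toLinearMap) * T ((A x).toLinearMap) = 1 := by
    intro x
    ext v
    simp [T, T', cU, LinearEquiv.arrowCongr_apply]
  let u : (Fin (finrank ℝ W) → ℝ) → ((n → ℝ) →L[ℝ] (n → ℝ))ˣ := fun x => ⟨_, _, e1 ((coords W).symm x), e2 _⟩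
  have h2 : (fun x => T'.symm ((A ((coords W).symm x)).symm.toLinearMap)) =
      fun x => Ring.inverse (T ((A ((coords W).symm x)).toLinearMap)) := by
    funext x
    exact (Ring.inverse_unit (u x)).symm
  rw [h2]
  rw [contDiff_iff_contDiffAt]
  intro x
  exact (contDiffAt_ringInverse ℝ (u x)).comp x h1.contDiffAt

end SmoothCalculus

/-! ### Integrals over [0, 1] depending smoothly on a parameter. -/

section ParametricIntegral

open MeasureTheory intervalIntegral

/-- The derivative of the integrand is continuous, hence bounded on the compact set `closedBall x 1
× [0, 1]`; this constant bound allows differentiation under the integral sign. -/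
lemma hasFDerivAt_integral_unitInterval {E F : Type*} [NormedAddCommGroup E] [NormedSpace ℝ E]
    [FiniteDimensional ℝ E] [NormedAddCommGroup F] [NormedSpace ℝ F] [CompleteSpace F]
    {G : E × ℝ → F} (hG : ContDiff ℝ ∞ G) (x : E) :
    HasFDerivAt (fun x => ∫ t in (0 : ℝ)..1, G (x, t))
      (∫ t in (0 : ℝ)..1, (fderiv ℝ G (x, t)).comp (ContinuousLinearMap.inl ℝ E ℝ)) x := by
  have hc : Continuous fun p : E × ℝ => (fderiv ℝ G p).comp (ContinuousLinearMap.inl ℝ E ℝ) :=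
    (hG.continuous_fderiv (by simp)).clm_comp continuous_const
  obtain ⟨C, hC⟩ := ((isCompact_closedBall x 1).prod (isCompact_Icc (a := (0 : ℝ)) (b := 1)))
    |>.exists_bound_of_continuousOn hc.continuousOn
  refine hasFDerivAt_integral_of_dominated_of_fderiv_le (bound := fun _ => C)
    (F' := fun x t => (fderiv ℝ G (x, t)).comp (ContinuousLinearMap.inl ℝ E ℝ))
    (Metric.closedBall_mem_nhds x one_pos) ?_ ?_ ?_ ?_ ?_ ?_
  · exact Filter.Eventually.of_forall fun y =>
      (hG.continuous.comp (by fun_prop)).aestronglyMeasurable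
  · exact (hG.continuous.comp (by fun_prop)).intervalIntegrable _ _
  · exact (hc.comp (by fun_prop : Continuous fun t : ℝ => (x, t))).aestronglyMeasurable
  · refine Filter.Eventually.of_forall fun t ht y hy => hC (y, t) ⟨hy, ?_⟩
    rw [Set.uIoc_of_le zero_le_one] at ht
    exact ⟨ht.1.le, ht.2⟩
  · exact intervalIntegrable_const
  · refine Filter.Eventually.of_forall fun t _ y _ => ?_
    have h1 : HasFDerivAt G (fderiv ℝ G (y, t)) (y, t) :=
      (hG.differentiable (by simp) _).hasFDerivAt
    exact h1.comp y (hasFDerivAt_prodMk_left y t)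

/-- The derivative is again an integral of the same shape, with values in `E →L[ℝ] F`. The induction
therefore quantifies over `F`, and both spaces sit in one universe; coordinate spaces are the only
ones needed. -/
lemma contDiff_integral_unitInterval_nat {E : Type} [NormedAddCommGroup E] [NormedSpace ℝ E]
    [FiniteDimensional ℝ E] (n : ℕ) : ∀ {F : Type} [NormedAddCommGroup F] [NormedSpace ℝ F]
    [CompleteSpace F] {G : E × ℝ → F}, ContDiff ℝ ∞ G →
    ContDiff ℝ n (fun x => ∫ t in (0 : ℝ)..1, G (x, t)) := by
  induction n with
  | zero =>
    intro F _ _ _ G hG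
    have h : Differentiable ℝ (fun x => ∫ t in (0 : ℝ)..1, G (x, t)) :=
      fun x => (hasFDerivAt_integral_unitInterval hG x).differentiableAt
    exact contDiff_zero.2 h.continuous
  | succ n ih =>
    intro F _ _ _ G hG
    refine (contDiff_succ_iff_hasFDerivAt).2
      ⟨_, ?_, fun x => hasFDerivAt_integral_unitInterval hG x⟩
    exact ih (G := fun p => (fderiv ℝ G p).comp (ContinuousLinearMap.inl ℝ E ℝ))
      ((hG.fderiv_right (m := ∞) (by simp)).clm_comp contDiff_const)

variable {W V U : Type*}
  [AddCommGroup W] [Module ℝ W] [FiniteDimensional ℝ W]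
  [AddCommGroup V] [Module ℝ V] [FiniteDimensional ℝ V]
  [AddCommGroup U] [Module ℝ U] [FiniteDimensional ℝ U]

/-- The integral over the unit interval of a family of maps `W → V`. -/
def unitIntegral (G : W × ℝ → V) : W → V :=
  fun x => (coords V).symm (∫ t in (0 : ℝ)..1, coords V (G (x, t)))

/-- The family `G`, read in coordinates of `W` and `V`. -/
def familyInCoords (G : W × ℝ → V) :
    (Fin (finrank ℝ W) → ℝ) × ℝ → (Fin (finrank ℝ V) → ℝ) :=
  fun p => coords V (G (((coords W).symm.toLinearMap.prodMap LinearMap.id) p))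

lemma IsSmooth.contDiff_family {G : W × ℝ → V} (hG : IsSmooth G) :
    ContDiff ℝ ∞ (familyInCoords G) :=
  hG.contDiff _ (coords V).toLinearMap

lemma IsSmooth.intervalIntegrable {G : W × ℝ → V} (hG : IsSmooth G) (x : W) :
    IntervalIntegrable (fun t => coords V (G (x, t))) volume 0 1 := by
  have := (hG.contDiff_family.continuous.comp
    (by fun_prop : Continuous fun t : ℝ => (coords W x, t))).intervalIntegrable
      (μ := volume) 0 1
  simpa [familyInCoords, Function.comp_def] using this

lemma inCoords_unitIntegral (G : W × ℝ → V) :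
    inCoords (unitIntegral G) = fun y => ∫ t in (0 : ℝ)..1, familyInCoords G (y, t) := by
  funext y
  simp [inCoords, unitIntegral, familyInCoords]

lemma IsSmooth.unitIntegral {G : W × ℝ → V} (hG : IsSmooth G) : IsSmooth (unitIntegral G) := by
  unfold IsSmooth
  rw [inCoords_unitIntegral]
  exact contDiff_infty.2 fun n => contDiff_integral_unitInterval_nat n hG.contDiff_family

lemma dirDeriv_unitIntegral {G : W × ℝ → V} (hG : IsSmooth G) (v x : W) :
    dirDeriv v (unitIntegral G) x = unitIntegral (dirDeriv (v, (0 : ℝ)) G) x := by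
  apply (coords V).injective
  rw [coords_dirDeriv, inCoords_unitIntegral,
    (hasFDerivAt_integral_unitInterval hG.contDiff_family (coords W x)).fderiv]
  have hc : Continuous fun t : ℝ => (fderiv ℝ (familyInCoords G) (coords W x, t)).comp
      (ContinuousLinearMap.inl ℝ (Fin (finrank ℝ W) → ℝ) ℝ) :=
    ((hG.contDiff_family.continuous_fderiv (by simp)).clm_comp continuous_const).comp
      (by fun_prop : Continuous fun t : ℝ => (coords W x, t))
  rw [ContinuousLinearMap.intervalIntegral_apply (hc.intervalIntegrable _ _)]
  simp only [DynR.unitIntegral, LinearEquiv.apply_symm_apply]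
  congr 1
  funext t
  obtain ⟨D, hD, hD'⟩ := hG.hasFDerivAt ((coords W).symm.toLinearMap.prodMap LinearMap.id)
    (coords V).toLinearMap (coords W x, t)
  have : fderiv ℝ (familyInCoords G) (coords W x, t) = D := hD.fderiv
  rw [this]
  simp [hD']

lemma unitIntegral_linear_comp (L : V →ₗ[ℝ] U) {G : W × ℝ → V} (hG : IsSmooth G) (x : W) :
    unitIntegral (fun p => L (G p)) x = L (unitIntegral G x) := by
  apply (coords U).injective
  let L' := ((coords U).toLinearMap ∘ₗ L ∘ₗ (coords V).symm.toLinearMap).toContinuousLinearMap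
  have := L'.intervalIntegral_comp_comm (hG.intervalIntegrable x)
  simpa [L', unitIntegral] using this

lemma unitIntegral_mem (N : Submodule ℝ V) {G : W × ℝ → V} (hG : IsSmooth G) (hN : ∀ p, G p ∈ N)
    (x : W) : unitIntegral G x ∈ N := by
  have h := unitIntegral_linear_comp N.mkQ hG x
  have h0 : (fun p => N.mkQ (G p)) = fun _ => 0 := by
    funext x; simpa using hN x
  rw [h0] at h
  have h1 : unitIntegral (fun _ : W × ℝ => (0 : V ⧸ N)) x = 0 := by simp [unitIntegral]
  rw [h1] at h
  simpa using h.symm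

lemma unitIntegral_add {G G' : W × ℝ → V} (hG : IsSmooth G) (hG' : IsSmooth G') (x : W) :
    unitIntegral (fun p => G p + G' p) x = unitIntegral G x + unitIntegral G' x := by
  simp only [unitIntegral, map_add]
  rw [integral_add (hG.intervalIntegrable x) (hG'.intervalIntegrable x), map_add]

lemma unitIntegral_sum {κ : Type*} (s : Finset κ) {G : κ → W × ℝ → V} (hG : ∀ i, IsSmooth (G i))
    (x : W) :
    unitIntegral (fun p => ∑ i ∈ s, G i p) x = ∑ i ∈ s, unitIntegral (G i) x := by
  simp only [unitIntegral, map_sum]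
  rw [integral_finsetSum fun i _ => (hG i).intervalIntegrable x, map_sum]

lemma unitIntegral_deriv {G : W × ℝ → V} (hG : IsSmooth G) (x : W) :
    unitIntegral (dirDeriv ((0 : W), (1 : ℝ)) G) x = G (x, 1) - G (x, 0) := by
  apply (coords V).injective
  have h : ∀ t, HasDerivAt (fun t => coords V (G (x, t)))
      (coords V (dirDeriv ((0 : W), (1 : ℝ)) G (x, t))) t := by
    intro t
    obtain ⟨D, hD, hD'⟩ := hG.hasFDerivAt ((coords W).symm.toLinearMap.prodMap LinearMap.id)
      (coords V).toLinearMap (coords W x, t)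
    have h1 := hD.comp_hasDerivAt t ((hasDerivAt_const t (coords W x)).prodMk (hasDerivAt_id t))
    simpa [Function.comp_def, hD'] using h1
  have := integral_eq_sub_of_hasDerivAt (a := 0) (b := 1) (fun t _ => h t)
    ((hG.dirDeriv _).intervalIntegrable x)
  simpa [unitIntegral] using this

end ParametricIntegral

/-! ### Contractions, induced maps and degree in the exterior algebra. -/

section Exterior

open ExteriorAlgebra (ι)

variable {U U' X : Type*} [AddCommGroup U] [Module ℝ U] [AddCommGroup U'] [Module ℝ U']
  [AddCommGroup X] [Module ℝ X]

instance exteriorAlgebra_finiteDimensional [FiniteDimensional ℝ U] :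
    FiniteDimensional ℝ (ExteriorAlgebra ℝ U) :=
  (Module.finBasis ℝ U).ExteriorAlgebra.finiteDimensional_of_finite

/-- The contraction of a multivector by a covector. -/
def contract : Dual ℝ U →ₗ[ℝ] ExteriorAlgebra ℝ U →ₗ[ℝ] ExteriorAlgebra ℝ U :=
  CliffordAlgebra.contractLeft (Q := (0 : QuadraticForm ℝ U))

lemma contract_ι_mul (f : Dual ℝ U) (u : U) (b : ExteriorAlgebra ℝ U) :
    contract f (ι ℝ u * b) = f u • b - ι ℝ u * contract f b :=
  CliffordAlgebra.contractLeft_ι_mul f u b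

lemma contract_algebraMap (f : Dual ℝ U) (c : ℝ) :
    contract f (algebraMap ℝ (ExteriorAlgebra ℝ U) c) = 0 :=
  CliffordAlgebra.contractLeft_algebraMap (Q := (0 : QuadraticForm ℝ U)) f c

lemma contract_one (f : Dual ℝ U) : contract f (1 : ExteriorAlgebra ℝ U) = 0 :=
  CliffordAlgebra.contractLeft_one (Q := (0 : QuadraticForm ℝ U)) f

lemma contract_ι (f : Dual ℝ U) (u : U) :
    contract f (ι ℝ u) = algebraMap ℝ (ExteriorAlgebra ℝ U) (f u) :=
  CliffordAlgebra.contractLeft_ι (Q := (0 : QuadraticForm ℝ U)) f u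

lemma contract_comm (f g : Dual ℝ U) (w : ExteriorAlgebra ℝ U) :
    contract f (contract g w) = -contract g (contract f w) :=
  CliffordAlgebra.contractLeft_comm (Q := (0 : QuadraticForm ℝ U)) _ _ w

lemma contract_self (f : Dual ℝ U) (w : ExteriorAlgebra ℝ U) :
    contract f (contract f w) = 0 :=
  CliffordAlgebra.contractLeft_contractLeft (Q := (0 : QuadraticForm ℝ U)) _ w

/-- The maps are linear but need not be multiplicative. This is the tool for comparing two operators
that obey the same Leibniz rule: they agree once they agree on 1 and the rule propagates equality
through multiplication by a generator. -/
lemma exterior_linearMap_ext {F G : ExteriorAlgebra ℝ U →ₗ[ℝ] X} (h1 : F 1 = G 1)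
    (h : ∀ u b, F b = G b → F (ι ℝ u * b) = G (ι ℝ u * b)) : F = G := by
  refine LinearMap.ext fun w => ?_
  induction w using CliffordAlgebra.left_induction with
  | algebraMap c => rw [Algebra.algebraMap_eq_smul_one, map_smul, map_smul]; exact congrArg _ h1
  | add x y hx hy => rw [map_add, map_add, hx, hy]
  | ι_mul x m hx => exact h m x hx

lemma ι_mul_ι_mul (u v : U) (b : ExteriorAlgebra ℝ U) :
    ι ℝ u * (ι ℝ v * b) = -(ι ℝ v * (ι ℝ u * b)) := by
  rw [← mul_assoc, ← mul_assoc, eq_neg_iff_add_eq_zero, ← add_mul, ExteriorAlgebra.ι_add_mul_swap,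
    zero_mul]

lemma ι_mul_mem {k : ℕ} (u : U) {w : ExteriorAlgebra ℝ U} (hw : w ∈ ⋀[ℝ]^k U) :
    ι ℝ u * w ∈ ⋀[ℝ]^(k + 1) U := by
  change _ ∈ LinearMap.range (ι ℝ) ^ (k + 1)
  rw [pow_succ']
  exact Submodule.mul_mem_mul ⟨u, rfl⟩ hw

@[elab_as_elim]
lemma exteriorPower_succ_induction {k : ℕ} {p : ExteriorAlgebra ℝ U → Prop}
    (hm : ∀ u, ∀ b ∈ ⋀[ℝ]^k U, p (ι ℝ u * b)) (ha : ∀ x y, p x → p y → p (x + y))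
    {w : ExteriorAlgebra ℝ U} (hw : w ∈ ⋀[ℝ]^(k + 1) U) : p w := by
  change _ ∈ LinearMap.range (ι ℝ) ^ (k + 1) at hw
  rw [pow_succ'] at hw
  refine Submodule.mul_induction_on hw ?_ ha
  rintro _ ⟨u, rfl⟩ b hb
  exact hm u b hb

lemma mem_exteriorPower_zero {w : ExteriorAlgebra ℝ U} :
    w ∈ ⋀[ℝ]^0 U ↔ ∃ c : ℝ, algebraMap ℝ (ExteriorAlgebra ℝ U) c = w := by
  change _ ∈ LinearMap.range (ι ℝ) ^ 0 ↔ _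
  rw [pow_zero, Submodule.mem_one]

lemma contract_of_mem_zero (f : Dual ℝ U) {w : ExteriorAlgebra ℝ U} (hw : w ∈ ⋀[ℝ]^0 U) :
    contract f w = 0 := by
  obtain ⟨c, rfl⟩ := mem_exteriorPower_zero.1 hw
  exact contract_algebraMap f c

lemma contract_mem (f : Dual ℝ U) {k : ℕ} {w : ExteriorAlgebra ℝ U} (hw : w ∈ ⋀[ℝ]^(k + 1) U) :
    contract f w ∈ ⋀[ℝ]^k U := by
  induction k generalizing w with
  | zero =>
    refine exteriorPower_succ_induction (fun u b hb => ?_) (fun x y hx hy => ?_) hw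
    · rw [contract_ι_mul, contract_of_mem_zero f hb, mul_zero, sub_zero]
      exact Submodule.smul_mem _ _ hb
    · rw [map_add]; exact add_mem hx hy
  | succ k ih =>
    refine exteriorPower_succ_induction (fun u b hb => ?_) (fun x y hx hy => ?_) hw
    · rw [contract_ι_mul]
      exact sub_mem (Submodule.smul_mem _ _ hb) (ι_mul_mem u (ih hb))
    · rw [map_add]; exact add_mem hx hy

lemma map_mem (A : U →ₗ[ℝ] U') {k : ℕ} {w : ExteriorAlgebra ℝ U} (hw : w ∈ ⋀[ℝ]^k U) :
    ExteriorAlgebra.map A w ∈ ⋀[ℝ]^k U' := by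
  induction k generalizing w with
  | zero =>
    obtain ⟨c, rfl⟩ := mem_exteriorPower_zero.1 hw
    exact mem_exteriorPower_zero.2 ⟨c, by simp⟩
  | succ k ih =>
    refine exteriorPower_succ_induction (fun u b hb => ?_) (fun x y hx hy => ?_) hw
    · rw [map_mul, ExteriorAlgebra.map_apply_ι]
      exact ι_mul_mem _ (ih hb)
    · rw [map_add]; exact add_mem hx hy

lemma map_ι_mul (A : U →ₗ[ℝ] U') (u : U) (b : ExteriorAlgebra ℝ U) :
    ExteriorAlgebra.map A (ι ℝ u * b) = ι ℝ (A u) * ExteriorAlgebra.map A b := by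
  rw [map_mul, ExteriorAlgebra.map_apply_ι]

lemma contract_map (A : U →ₗ[ℝ] U') (f : Dual ℝ U') (w : ExteriorAlgebra ℝ U) :
    contract f (ExteriorAlgebra.map A w) = ExteriorAlgebra.map A (contract (f ∘ₗ A) w) := by
  have : contract f ∘ₗ (ExteriorAlgebra.map A).toLinearMap =
      (ExteriorAlgebra.map A).toLinearMap ∘ₗ contract (f ∘ₗ A) := by
    refine exterior_linearMap_ext (by simp [contract_one]) fun u b hb => ?_
    simp only [LinearMap.comp_apply, AlgHom.toLinearMap_apply] at hb ⊢
    rw [map_ι_mul, contract_ι_mul, contract_ι_mul, hb, map_sub, map_ι_mul, map_smul]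
    simp
  exact LinearMap.congr_fun this w

/-- Bivectors are central. -/
lemma bivector_mul_ι {P : ExteriorAlgebra ℝ U} (hP : P ∈ ⋀[ℝ]^2 U) (u : U) :
    P * ι ℝ u = ι ℝ u * P := by
  have hP' : P ∈ ⋀[ℝ]^(1 + 1) U := by rwa [one_add_one_eq_two]
  refine exteriorPower_succ_induction (fun v b hb => ?_) (fun x y hx hy => ?_) hP'
  · have hb' : b ∈ ⋀[ℝ]^(0 + 1) U := by rwa [zero_add]
    refine exteriorPower_succ_induction (fun v' b hb => ?_) (fun x y hx hy => ?_) hb'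
    · obtain ⟨c, rfl⟩ := mem_exteriorPower_zero.1 hb
      rw [← Algebra.commutes c (ι ℝ v')]
      have h1 := ι_mul_ι_mul u v (ι ℝ v')
      have h2 := ι_mul_ι_mul u v' 1
      simp only [mul_one] at h2
      have h3 : ι ℝ u * (ι ℝ v * ι ℝ v') = ι ℝ v * (ι ℝ v' * ι ℝ u) := by
        rw [h1, h2]; simp
      rw [← Algebra.smul_def, mul_smul_comm, smul_mul_assoc, mul_smul_comm, h3, mul_assoc]
    · rw [mul_add, add_mul, mul_add, hx, hy]
  · rw [add_mul, mul_add, hx, hy]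

/-- The degree operator acts on `∧^k` as multiplication by `k`. -/
lemma sum_ι_mul_contract {κ : Type*} [Fintype κ] (v : κ → U) (f : κ → Dual ℝ U)
    (hvf : ∀ u, ∑ j, f j u • v j = u) {k : ℕ} {w : ExteriorAlgebra ℝ U} (hw : w ∈ ⋀[ℝ]^k U) :
    ∑ j, ι ℝ (v j) * contract (f j) w = (k : ℝ) • w := by
  induction k generalizing w with
  | zero => simp [contract_of_mem_zero _ hw]
  | succ k ih =>
    refine exteriorPower_succ_induction (fun u b hb => ?_) (fun x y hx hy => ?_) hw
    · simp only [contract_ι_mul, mul_sub, ι_mul_ι_mul _ u, mul_smul_comm, sub_neg_eq_add,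
        Finset.sum_add_distrib]
      rw [← Finset.mul_sum, ih hb]
      have : ∑ j, f j u • (ι ℝ (v j) * b) = ι ℝ u * b := by
        conv_rhs => rw [← hvf u]
        simp [Finset.sum_mul]
      rw [this, mul_smul_comm]
      push_cast
      rw [add_smul, one_smul, add_comm]
    · simp only [map_add, mul_add, Finset.sum_add_distrib, hx, hy, smul_add]

end Exterior

/-! ### Cartan calculus on ∧(H × 𝔤*). -/

section Cartan

open ExteriorAlgebra (ι)

variable {H 𝔤 X : Type*} [AddCommGroup H] [Module ℝ H] [LieRing 𝔤] [LieAlgebra ℝ 𝔤]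
  [AddCommGroup X] [Module ℝ X]

variable (H 𝔤) in
/-- The exterior algebra of `H × 𝔤*`: translation invariant and left invariant differential forms
on the product of `H*` and a Lie group with Lie algebra `𝔤`. -/
abbrev Forms := ExteriorAlgebra ℝ (H × Dual ℝ 𝔤)

variable (𝔤) in
/-- The forms of degree one along `H*`. -/
def hForm : H →ₗ[ℝ] Forms H 𝔤 := ι ℝ ∘ₗ LinearMap.inl ℝ H (Dual ℝ 𝔤)

variable (H) in
/-- The left invariant forms of degree one. -/
def gForm : Dual ℝ 𝔤 →ₗ[ℝ] Forms H 𝔤 := ι ℝ ∘ₗ LinearMap.inr ℝ H (Dual ℝ 𝔤)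

/-- Contraction with a left invariant vector field. -/
def gContract : 𝔤 →ₗ[ℝ] Forms H 𝔤 →ₗ[ℝ] Forms H 𝔤 :=
  contract ∘ₗ (LinearMap.snd ℝ H (Dual ℝ 𝔤)).dualMap ∘ₗ Dual.eval ℝ 𝔤

/-- Contraction with a constant vector field on `H*`. -/
def hContract : Dual ℝ H →ₗ[ℝ] Forms H 𝔤 →ₗ[ℝ] Forms H 𝔤 :=
  contract ∘ₗ (LinearMap.fst ℝ H (Dual ℝ 𝔤)).dualMap

lemma ι_eq_add (u : H × Dual ℝ 𝔤) : ι ℝ u = hForm 𝔤 u.1 + gForm H u.2 := by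
  simp [hForm, gForm, ← map_add]

lemma gContract_gForm_mul (x : 𝔤) (ξ : Dual ℝ 𝔤) (b : Forms H 𝔤) :
    gContract x (gForm H ξ * b) = ξ x • b - gForm H ξ * gContract x b := by
  simp [gContract, gForm, contract_ι_mul]

lemma gContract_hForm_mul (x : 𝔤) (v : H) (b : Forms H 𝔤) :
    gContract x (hForm 𝔤 v * b) = -(hForm 𝔤 v * gContract x b) := by
  simp [gContract, hForm, contract_ι_mul]

lemma hContract_gForm_mul (θ : Dual ℝ H) (ξ : Dual ℝ 𝔤) (b : Forms H 𝔤) :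
    hContract θ (gForm H ξ * b) = -(gForm H ξ * hContract θ b) := by
  simp [hContract, gForm, contract_ι_mul]

lemma hContract_hForm_mul (θ : Dual ℝ H) (v : H) (b : Forms H 𝔤) :
    hContract θ (hForm 𝔤 v * b) = θ v • b - hForm 𝔤 v * hContract θ b := by
  simp [hContract, hForm, contract_ι_mul]

lemma gForm_mul_gForm_mul (ξ η : Dual ℝ 𝔤) (b : Forms H 𝔤) :
    gForm H ξ * (gForm H η * b) = -(gForm H η * (gForm H ξ * b)) := ι_mul_ι_mul _ _ _

lemma gForm_mul_hForm_mul (ξ : Dual ℝ 𝔤) (v : H) (b : Forms H 𝔤) :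
    gForm H ξ * (hForm 𝔤 v * b) = -(hForm 𝔤 v * (gForm H ξ * b)) := ι_mul_ι_mul _ _ _

lemma hForm_mul_hForm_mul (v v' : H) (b : Forms H 𝔤) :
    hForm 𝔤 v * (hForm 𝔤 v' * b) = -(hForm 𝔤 v' * (hForm 𝔤 v * b)) := ι_mul_ι_mul _ _ _

lemma gContract_comm (x y : 𝔤) (w : Forms H 𝔤) :
    gContract x (gContract y w) = -gContract y (gContract x w) := contract_comm _ _ _

lemma gContract_hContract (x : 𝔤) (θ : Dual ℝ H) (w : Forms H 𝔤) :
    gContract x (hContract θ w) = -hContract θ (gContract x w) := contract_comm _ _ _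

lemma gForm_mul_mem (ξ : Dual ℝ 𝔤) {k : ℕ} {w : Forms H 𝔤} (hw : w ∈ ⋀[ℝ]^k (H × Dual ℝ 𝔤)) :
    gForm H ξ * w ∈ ⋀[ℝ]^(k + 1) (H × Dual ℝ 𝔤) := ι_mul_mem _ hw

lemma hForm_mul_mem (v : H) {k : ℕ} {w : Forms H 𝔤} (hw : w ∈ ⋀[ℝ]^k (H × Dual ℝ 𝔤)) :
    hForm 𝔤 v * w ∈ ⋀[ℝ]^(k + 1) (H × Dual ℝ 𝔤) := ι_mul_mem _ hw

lemma gContract_mem (x : 𝔤) {k : ℕ} {w : Forms H 𝔤} (hw : w ∈ ⋀[ℝ]^(k + 1) (H × Dual ℝ 𝔤)) :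
    gContract x w ∈ ⋀[ℝ]^k (H × Dual ℝ 𝔤) := contract_mem _ hw

lemma gContract_of_mem_zero (x : 𝔤) {w : Forms H 𝔤} (hw : w ∈ ⋀[ℝ]^0 (H × Dual ℝ 𝔤)) :
    gContract x w = 0 := contract_of_mem_zero _ hw

lemma hContract_mem (θ : Dual ℝ H) {k : ℕ} {w : Forms H 𝔤}
    (hw : w ∈ ⋀[ℝ]^(k + 1) (H × Dual ℝ 𝔤)) :
    hContract θ w ∈ ⋀[ℝ]^k (H × Dual ℝ 𝔤) := contract_mem _ hw

lemma hContract_of_mem_zero (θ : Dual ℝ H) {w : Forms H 𝔤} (hw : w ∈ ⋀[ℝ]^0 (H × Dual ℝ 𝔤)) :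
    hContract θ w = 0 := contract_of_mem_zero _ hw

variable [FiniteDimensional ℝ 𝔤]

/-- A bilinear expression in a basis and its dual basis: moving an endomorphism to the dual. -/
lemma sum_coord_comp (B : Dual ℝ 𝔤 →ₗ[ℝ] 𝔤 →ₗ[ℝ] X) (T : 𝔤 →ₗ[ℝ] 𝔤) :
    ∑ a, B ((finBasis ℝ 𝔤).coord a ∘ₗ T) (finBasis ℝ 𝔤 a) =
      ∑ a, B ((finBasis ℝ 𝔤).coord a) (T (finBasis ℝ 𝔤 a)) := by
  have h1 : ∀ a, (finBasis ℝ 𝔤).coord a ∘ₗ T =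
      ∑ b, (finBasis ℝ 𝔤).coord a (T (finBasis ℝ 𝔤 b)) • (finBasis ℝ 𝔤).coord b := by
    intro a
    refine (finBasis ℝ 𝔤).ext fun c => ?_
    simp [Finsupp.single_apply]
  have h2 : ∀ a, T (finBasis ℝ 𝔤 a) =
      ∑ b, (finBasis ℝ 𝔤).coord b (T (finBasis ℝ 𝔤 a)) • finBasis ℝ 𝔤 b := fun a =>
    ((finBasis ℝ 𝔤).sum_repr _).symm
  simp only [h1]
  conv_rhs => enter [2, a]; rw [h2 a]
  simp only [map_sum, map_smul, LinearMap.sum_apply, LinearMap.smul_apply]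
  exact Finset.sum_comm

lemma sum_apply_coord (ξ : Dual ℝ 𝔤) : ∑ a, ξ (finBasis ℝ 𝔤 a) • (finBasis ℝ 𝔤).coord a = ξ := by
  refine (finBasis ℝ 𝔤).ext fun c => ?_
  simp

lemma sum_coord_apply (x : 𝔤) : ∑ a, (finBasis ℝ 𝔤).coord a x • finBasis ℝ 𝔤 a = x :=
  (finBasis ℝ 𝔤).sum_repr x

/-- The bilinear expression `form ∧ contraction`. -/
def formContract (w : Forms H 𝔤) : Dual ℝ 𝔤 →ₗ[ℝ] 𝔤 →ₗ[ℝ] Forms H 𝔤 :=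
  (LinearMap.mul ℝ (Forms H 𝔤)).compl₁₂ (gForm H) (gContract.flip w)

omit [FiniteDimensional ℝ 𝔤] in
lemma formContract_apply (w : Forms H 𝔤) (ξ : Dual ℝ 𝔤) (x : 𝔤) :
    formContract w ξ x = gForm H ξ * gContract x w := rfl

/-- The Lie derivative along a left invariant vector field. -/
def gLie : 𝔤 →ₗ[ℝ] Forms H 𝔤 →ₗ[ℝ] Forms H 𝔤 :=
  LinearMap.mk₂ ℝ (fun x w => -∑ a, gForm H ((finBasis ℝ 𝔤).coord a) *
      gContract ⁅x, finBasis ℝ 𝔤 a⁆ w)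
    (by intro x y w; simp [mul_add, Finset.sum_add_distrib]; abel)
    (by intro c x w; simp [Finset.smul_sum])
    (by intro x w w'; simp [mul_add, Finset.sum_add_distrib]; abel)
    (by intro c x w; simp [Finset.smul_sum])

lemma gLie_apply (x : 𝔤) (w : Forms H 𝔤) : gLie x w =
    -∑ a, gForm H ((finBasis ℝ 𝔤).coord a) * gContract ⁅x, finBasis ℝ 𝔤 a⁆ w := rfl

/-- The coadjoint action. -/
def coad (x : 𝔤) (ξ : Dual ℝ 𝔤) : Dual ℝ 𝔤 := -(ξ ∘ₗ (LieAlgebra.ad ℝ 𝔤 x : 𝔤 →ₗ[ℝ] 𝔤))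

omit [FiniteDimensional ℝ 𝔤] in
lemma coad_apply (x : 𝔤) (ξ : Dual ℝ 𝔤) (y : 𝔤) : coad x ξ y = -ξ ⁅x, y⁆ := rfl

lemma gLie_gForm_mul (x : 𝔤) (ξ : Dual ℝ 𝔤) (b : Forms H 𝔤) :
    gLie x (gForm H ξ * b) = gForm H (coad x ξ) * b + gForm H ξ * gLie x b := by
  have h : gForm H (coad x ξ) =
      -∑ a, ξ ⁅x, finBasis ℝ 𝔤 a⁆ • gForm H ((finBasis ℝ 𝔤).coord a) := by
    conv_lhs => rw [← sum_apply_coord (coad x ξ)]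
    simp [coad_apply]
  simp only [gLie_apply, gContract_gForm_mul, h, mul_sub, Finset.sum_sub_distrib, neg_mul,
    Finset.sum_mul, mul_neg, Finset.mul_sum, gForm_mul_gForm_mul ξ, Finset.sum_neg_distrib,
    mul_smul_comm, smul_mul_assoc]
  abel

lemma gLie_hForm_mul (x : 𝔤) (v : H) (b : Forms H 𝔤) :
    gLie x (hForm 𝔤 v * b) = hForm 𝔤 v * gLie x b := by
  simp [gLie_apply, gContract_hForm_mul, gForm_mul_hForm_mul, Finset.mul_sum]

/-- Cartan's commutation rule. When y is contracted with the dual basis covectors, ∑ eᵃ(y) [x, e_a]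
= [x, y] produces the last term; the remaining terms only permute two anticommuting contractions. -/
lemma gContract_gLie (x y : 𝔤) (w : Forms H 𝔤) :
    gContract y (gLie x w) = gLie x (gContract y w) - gContract ⁅x, y⁆ w := by
  have h : gContract ⁅x, y⁆ w =
      ∑ a, (finBasis ℝ 𝔤).coord a y • gContract ⁅x, finBasis ℝ 𝔤 a⁆ w := by
    conv_lhs => rw [← sum_coord_apply y]
    simp only [lie_sum, lie_smul, map_sum, map_smul, LinearMap.sum_apply, LinearMap.smul_apply]
  simp only [gLie_apply, map_neg, map_sum, gContract_gForm_mul, Finset.sum_sub_distrib, h,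
    gContract_comm y, mul_neg, Finset.sum_neg_distrib]
  abel

lemma hContract_gLie (x : 𝔤) (θ : Dual ℝ H) (w : Forms H 𝔤) :
    hContract θ (gLie x w) = gLie x (hContract θ w) := by
  simp [gLie_apply, hContract_gForm_mul, gContract_hContract]

/-- By the Leibniz rule L_x acts on the dual basis covectors as well as on the contractions;
`sum_coord_comp` moves the first action back to the basis vectors, and Jacobi combines the two into
the bracket [x, y]. -/
lemma gLie_gLie (x y : 𝔤) (w : Forms H 𝔤) :
    gLie x (gLie y w) = gLie y (gLie x w) + gLie ⁅x, y⁆ w := by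
  have hc : ∀ z, gLie x (gContract z w) = gContract z (gLie x w) + gContract ⁅x, z⁆ w := by
    intro z; rw [gContract_gLie]; abel
  have h1 := sum_coord_comp ((formContract w).compl₂
    (LieAlgebra.ad ℝ 𝔤 y : 𝔤 →ₗ[ℝ] 𝔤)) (LieAlgebra.ad ℝ 𝔤 x : 𝔤 →ₗ[ℝ] 𝔤)
  simp only [LinearMap.compl₂_apply, formContract_apply, LieAlgebra.ad_apply] at h1
  conv_lhs => rw [gLie_apply y, map_neg, map_sum]
  simp only [gLie_gForm_mul, hc, coad, map_neg, neg_mul, Finset.sum_add_distrib, mul_add,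
    Finset.sum_neg_distrib, h1]
  rw [gLie_apply y, gLie_apply ⁅x, y⁆]
  simp only [lie_lie, map_sub, mul_sub, LinearMap.sub_apply, Finset.sum_sub_distrib]
  abel

/-- The Chevalley–Eilenberg differential, acting on the factor `∧𝔤*`. -/
def gDiff : Forms H 𝔤 →ₗ[ℝ] Forms H 𝔤 :=
  (1 / 2 : ℝ) • ∑ a, LinearMap.mulLeft ℝ (gForm H ((finBasis ℝ 𝔤).coord a)) ∘ₗ
    gLie (finBasis ℝ 𝔤 a)

lemma gDiff_apply (w : Forms H 𝔤) : gDiff w = (1 / 2 : ℝ) • ∑ a,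
    gForm H ((finBasis ℝ 𝔤).coord a) * gLie (finBasis ℝ 𝔤 a) w := by
  simp [gDiff, LinearMap.sum_apply]

variable (H) in
/-- The Chevalley–Eilenberg differential of a one-form. -/
def gDiffForm (ξ : Dual ℝ 𝔤) : Forms H 𝔤 := (1 / 2 : ℝ) • ∑ a,
    gForm H ((finBasis ℝ 𝔤).coord a) * gForm H (coad (finBasis ℝ 𝔤 a) ξ)

lemma gDiff_gForm_mul (ξ : Dual ℝ 𝔤) (b : Forms H 𝔤) :
    gDiff (gForm H ξ * b) = gDiffForm H ξ * b - gForm H ξ * gDiff b := by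
  simp only [gDiff_apply, gDiffForm, gLie_gForm_mul, mul_add, Finset.sum_add_distrib,
    gForm_mul_gForm_mul _ ξ, smul_add, smul_mul_assoc, mul_smul_comm, Finset.sum_mul, mul_assoc,
    Finset.mul_sum, Finset.sum_neg_distrib, smul_neg, sub_eq_add_neg]

lemma gDiff_hForm_mul (v : H) (b : Forms H 𝔤) :
    gDiff (hForm 𝔤 v * b) = -(hForm 𝔤 v * gDiff b) := by
  simp only [gDiff_apply, gLie_hForm_mul, gForm_mul_hForm_mul, Finset.sum_neg_distrib,
    mul_smul_comm, Finset.mul_sum, smul_neg]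

lemma hContract_gDiff (θ : Dual ℝ H) (w : Forms H 𝔤) :
    hContract θ (gDiff w) = -gDiff (hContract θ w) := by
  simp only [gDiff_apply, map_smul, map_sum, hContract_gForm_mul, hContract_gLie,
    Finset.sum_neg_distrib, smul_neg]

/-- Cartan's formula. The Lie derivative arises twice, once from eᵃ(x) L_{e_a} and once from the
commutator of contraction and Lie derivative, and the factor ½ in `gDiff` absorbs this. -/
lemma gContract_gDiff (x : 𝔤) (w : Forms H 𝔤) :
    gContract x (gDiff w) = gLie x w - gDiff (gContract x w) := by
  have h : ∑ a, (finBasis ℝ 𝔤).coord a x • gLie (finBasis ℝ 𝔤 a) w = gLie x w := by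
    conv_rhs => rw [← sum_coord_apply x]
    simp only [map_sum, map_smul, LinearMap.sum_apply, LinearMap.smul_apply]
  have h2 : ∑ a, gForm H ((finBasis ℝ 𝔤).coord a) * gContract ⁅finBasis ℝ 𝔤 a, x⁆ w =
      gLie x w := by
    rw [gLie_apply, ← Finset.sum_neg_distrib]
    refine Finset.sum_congr rfl fun a _ => ?_
    rw [← lie_skew x, map_neg, LinearMap.neg_apply, mul_neg, neg_neg]
  simp only [gDiff_apply, map_smul, map_sum, gContract_gForm_mul, gContract_gLie, mul_sub,
    Finset.sum_sub_distrib, h, h2]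
  module

lemma gLie_gDiff (x : 𝔤) (w : Forms H 𝔤) : gLie x (gDiff w) = gDiff (gLie x w) := by
  have h1 := sum_coord_comp ((LinearMap.mul ℝ (Forms H 𝔤)).compl₁₂ (gForm H) (gLie.flip w))
    (LieAlgebra.ad ℝ 𝔤 x : 𝔤 →ₗ[ℝ] 𝔤)
  simp only [LinearMap.compl₁₂_apply, LinearMap.flip_apply, LinearMap.mul_apply',
    LieAlgebra.ad_apply] at h1
  simp only [gDiff_apply, map_smul, map_sum, gLie_gForm_mul, gLie_gLie x, coad, map_neg, neg_mul,
    mul_add, Finset.sum_add_distrib, Finset.sum_neg_distrib, h1]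
  module

/-- Expanding the Lie derivative gives a sum against three odd forms eᵃ ∧ eᵇ ∧ eᶜ. A cyclic
permutation of them is even, so three times the sum is the sum of the cyclic Jacobi expression,
which vanishes. -/
lemma sum_form_form_lie (w : Forms H 𝔤) :
    ∑ a, ∑ b, gForm H ((finBasis ℝ 𝔤).coord a) * (gForm H ((finBasis ℝ 𝔤).coord b) *
      gLie ⁅finBasis ℝ 𝔤 a, finBasis ℝ 𝔤 b⁆ w) = 0 := by
  let T : (Fin (finrank ℝ 𝔤) → Fin (finrank ℝ 𝔤) → Fin (finrank ℝ 𝔤) → 𝔤) → Forms H 𝔤 :=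
    fun f => ∑ a, ∑ b, ∑ c, gForm H ((finBasis ℝ 𝔤).coord a) *
      (gForm H ((finBasis ℝ 𝔤).coord b) * (gForm H ((finBasis ℝ 𝔤).coord c) *
        gContract (f a b c) w))
  have hT : ∀ f, T f = T (fun a b c => f c a b) := by
    intro f
    simp only [T]
    rw [Finset.sum_comm]
    refine Finset.sum_congr rfl fun b _ => ?_
    rw [Finset.sum_comm]
    refine Finset.sum_congr rfl fun c _ => Finset.sum_congr rfl fun a _ => ?_
    rw [gForm_mul_gForm_mul, gForm_mul_gForm_mul ((finBasis ℝ 𝔤).coord a) ((finBasis ℝ 𝔤).coord c)]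
    simp only [mul_neg, neg_neg]
  let f : Fin (finrank ℝ 𝔤) → Fin (finrank ℝ 𝔤) → Fin (finrank ℝ 𝔤) → 𝔤 := fun a b c =>
    ⁅⁅finBasis ℝ 𝔤 a, finBasis ℝ 𝔤 b⁆, finBasis ℝ 𝔤 c⁆
  have h3 : T f + T (fun a b c => f b c a) + T (fun a b c => f c a b) = 0 := by
    simp only [T, ← Finset.sum_add_distrib, ← mul_add, ← LinearMap.add_apply, ← map_add]
    refine Finset.sum_eq_zero fun a _ => Finset.sum_eq_zero fun b _ =>
      Finset.sum_eq_zero fun c _ => ?_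
    have : f a b c + f b c a + f c a b = 0 := by
      have := lie_jacobi (finBasis ℝ 𝔤 a) (finBasis ℝ 𝔤 b) (finBasis ℝ 𝔤 c)
      simp only [f]
      rw [← lie_skew _ (finBasis ℝ 𝔤 c), ← lie_skew ⁅_, _⁆ (finBasis ℝ 𝔤 a),
        ← lie_skew ⁅_, _⁆ (finBasis ℝ 𝔤 b), ← neg_eq_zero, ← this]
      abel
    simp [this]
  rw [← hT f, hT (fun a b c => f b c a)] at h3
  have h4 : T f = 0 := by
    have : (3 : ℝ) • T f = 0 := by rw [← h3]; module
    simpa using this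
  simp only [gLie_apply, mul_neg, Finset.mul_sum, Finset.sum_neg_distrib]
  rw [neg_eq_zero]
  exact h4

/-- Applying the Leibniz rule to d w = ½ ∑ eᵇ ∧ L_b w and using that L_b commutes with d gives d²w =
½ ∑ deᵇ ∧ L_b w - d²w. The first sum vanishes by Jacobi, leaving 2 d²w = 0. -/
lemma gDiff_gDiff (w : Forms H 𝔤) : gDiff (gDiff w) = 0 := by
  have h1 : gDiff (gDiff w) = (1 / 2 : ℝ) • ∑ b, gDiffForm H ((finBasis ℝ 𝔤).coord b) *
      gLie (finBasis ℝ 𝔤 b) w - gDiff (gDiff w) := by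
    conv_lhs => rw [gDiff_apply w, map_smul, map_sum]
    simp only [gDiff_gForm_mul, ← gLie_gDiff, Finset.sum_sub_distrib, smul_sub]
    rw [← gDiff_apply (gDiff w)]
  have h2 : ∑ b, gDiffForm H ((finBasis ℝ 𝔤).coord b) * gLie (finBasis ℝ 𝔤 b) w = 0 := by
    have h3 : ∀ a, ∑ b, gForm H (coad (finBasis ℝ 𝔤 a) ((finBasis ℝ 𝔤).coord b)) *
        gLie (finBasis ℝ 𝔤 b) w = -∑ b, gForm H ((finBasis ℝ 𝔤).coord b) *
          gLie ⁅finBasis ℝ 𝔤 a, finBasis ℝ 𝔤 b⁆ w := by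
      intro a
      have h1 := sum_coord_comp ((LinearMap.mul ℝ (Forms H 𝔤)).compl₁₂ (gForm H) (gLie.flip w))
        (LieAlgebra.ad ℝ 𝔤 (finBasis ℝ 𝔤 a) : 𝔤 →ₗ[ℝ] 𝔤)
      simp only [LinearMap.compl₁₂_apply, LinearMap.flip_apply, LinearMap.mul_apply',
        LieAlgebra.ad_apply] at h1
      simp only [coad, map_neg, neg_mul, Finset.sum_neg_distrib, h1]
    simp only [gDiffForm, smul_mul_assoc, Finset.sum_mul, mul_assoc]
    rw [← Finset.smul_sum, Finset.sum_comm]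
    simp only [← Finset.mul_sum, h3]
    simp only [mul_neg, Finset.sum_neg_distrib, Finset.mul_sum, sum_form_form_lie]
    simp
  rw [h2, smul_zero, zero_sub] at h1
  have h4 : (2 : ℝ) • gDiff (gDiff w) = 0 := by
    rw [two_smul]
    nth_rewrite 1 [h1]
    simp
  simpa using h4

lemma gLie_mem (x : 𝔤) {k : ℕ} {w : Forms H 𝔤} (hw : w ∈ ⋀[ℝ]^k (H × Dual ℝ 𝔤)) :
    gLie x w ∈ ⋀[ℝ]^k (H × Dual ℝ 𝔤) := by
  rw [gLie_apply]
  refine neg_mem (sum_mem fun a _ => ?_)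
  cases k with
  | zero => simp [gContract_of_mem_zero _ hw]
  | succ k => exact gForm_mul_mem _ (gContract_mem _ hw)

lemma gDiff_mem {k : ℕ} {w : Forms H 𝔤} (hw : w ∈ ⋀[ℝ]^k (H × Dual ℝ 𝔤)) :
    gDiff w ∈ ⋀[ℝ]^(k + 1) (H × Dual ℝ 𝔤) := by
  rw [gDiff_apply]
  exact Submodule.smul_mem _ _ (sum_mem fun a _ => gForm_mul_mem _ (gLie_mem _ hw))

/-- The degree operator. -/
lemma sum_gForm_hForm {κ : Type*} [Fintype κ] [DecidableEq κ] (h : Basis κ ℝ H) {k : ℕ}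
    {w : Forms H 𝔤} (hw : w ∈ ⋀[ℝ]^k (H × Dual ℝ 𝔤)) :
    ∑ i, hForm 𝔤 (h i) * hContract (h.coord i) w +
      ∑ a, gForm H ((finBasis ℝ 𝔤).coord a) * gContract (finBasis ℝ 𝔤 a) w = (k : ℝ) • w := by
  have := sum_ι_mul_contract
    (Sum.elim (fun i => (h i, (0 : Dual ℝ 𝔤))) fun a => ((0 : H), (finBasis ℝ 𝔤).coord a))
    (Sum.elim (fun i => h.coord i ∘ₗ LinearMap.fst ℝ H (Dual ℝ 𝔤))
      fun a => Dual.eval ℝ 𝔤 (finBasis ℝ 𝔤 a) ∘ₗ LinearMap.snd ℝ H (Dual ℝ 𝔤)) ?_ hw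
  · rw [← this, Fintype.sum_sum_type]
    rfl
  · intro u
    rw [Fintype.sum_sum_type]
    ext1
    · simp [Prod.fst_sum, h.sum_repr u.1]
    · simp [Prod.snd_sum, sum_apply_coord u.2]

end Cartan

/-! ### Dictionary between forms in ∧𝔤* and alternating maps on 𝔤. -/

section Alternating

open ExteriorAlgebra (ι)

variable {H 𝔤 : Type*} [AddCommGroup H] [Module ℝ H] [LieRing 𝔤] [LieAlgebra ℝ 𝔤]

variable (H) in
/-- Iterated contraction: `x₁ ∧ … ∧ x_k` acts by `w ↦ x_k ⌋ … x₁ ⌋ w`. -/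
def iterContract : ExteriorAlgebra ℝ 𝔤 →ₐ[ℝ] (Module.End ℝ (Forms H 𝔤))ᵐᵒᵖ :=
  ExteriorAlgebra.lift ℝ ⟨(MulOpposite.opLinearEquiv ℝ).toLinearMap ∘ₗ gContract, fun x => by
    apply MulOpposite.unop_injective
    exact LinearMap.ext fun w => contract_self _ w⟩

lemma iterContract_ι (x : 𝔤) : iterContract H (ι ℝ x) = MulOpposite.op (gContract x) :=
  ExteriorAlgebra.lift_ι_apply _ _ _ _

/-- The alternating form `(x₁,…,x_k) ↦ ε (x_k ⌋ … x₁ ⌋ w)`. -/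
def toAlt (k : ℕ) : Forms H 𝔤 →ₗ[ℝ] 𝔤 [⋀^Fin k]→ₗ[ℝ] ℝ where
  toFun w := (ExteriorAlgebra.algebraMapInv.toLinearMap ∘ₗ LinearMap.applyₗ w ∘ₗ
    (MulOpposite.opLinearEquiv ℝ).symm.toLinearMap ∘ₗ
      (iterContract H).toLinearMap).compAlternatingMap (ExteriorAlgebra.ιMulti ℝ k)
  map_add' w w' := by ext; simp
  map_smul' c w := by ext; simp

lemma toAlt_zero (w : Forms H 𝔤) (y : Fin 0 → 𝔤) :
    toAlt 0 w y = ExteriorAlgebra.algebraMapInv w := by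
  simp [toAlt]

lemma toAlt_succ {k : ℕ} (w : Forms H 𝔤) (y : Fin (k + 1) → 𝔤) :
    toAlt (k + 1) w y = toAlt k (gContract (y 0) w) (Matrix.vecTail y) := by
  simp [toAlt, iterContract_ι]

lemma curryLeft_toAlt {k : ℕ} (w : Forms H 𝔤) (x : 𝔤) :
    (toAlt (k + 1) w).curryLeft x = toAlt k (gContract x w) := by
  ext y
  simp [toAlt_succ]

lemma algebraMapInv_ι_mul (u : H × Dual ℝ 𝔤) (w : Forms H 𝔤) :
    ExteriorAlgebra.algebraMapInv (ι ℝ u * w) = 0 := by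
  simp [ExteriorAlgebra.algebraMapInv]

/-- A factor from H anticommutes with every contraction by 𝔤, so it survives to the end and has no
scalar part. Thus `toAlt` forgets all components along H. -/
lemma toAlt_hForm_mul (k : ℕ) (v : H) (w : Forms H 𝔤) : toAlt k (hForm 𝔤 v * w) = 0 := by
  induction k generalizing w with
  | zero => ext y; rw [toAlt_zero]; exact algebraMapInv_ι_mul _ _
  | succ k ih => ext y; rw [toAlt_succ, gContract_hForm_mul, map_neg, ih]; simp

lemma toAlt_zero_gForm_mul (ξ : Dual ℝ 𝔤) (w : Forms H 𝔤) : toAlt 0 (gForm H ξ * w) = 0 := by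
  ext y; rw [toAlt_zero]; exact algebraMapInv_ι_mul _ _

/-- Contracting with the first argument either removes ξ, which is the zeroth summand of the
alternatization, or passes to the remaining factor with a sign, which gives the other summands by
induction. -/
lemma toAlt_gForm_mul (k : ℕ) (ξ : Dual ℝ 𝔤) (w : Forms H 𝔤) :
    toAlt (k + 1) (gForm H ξ * w) =
      AlternatingMap.alternatizeUncurryFin (ξ.smulRight (toAlt k w)) := by
  induction k generalizing w with
  | zero =>
    ext y
    rw [toAlt_succ, gContract_gForm_mul, map_sub, toAlt_zero_gForm_mul,
      AlternatingMap.alternatizeUncurryFin_apply]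
    simp [toAlt_zero]
  | succ k ih =>
    ext y
    rw [toAlt_succ, gContract_gForm_mul, map_sub, ih, AlternatingMap.alternatizeUncurryFin_apply,
      AlternatingMap.sub_apply, AlternatingMap.alternatizeUncurryFin_apply,
      Fin.sum_univ_succ (n := k + 1), sub_eq_add_neg, ← Finset.sum_neg_distrib]
    congr 1
    · have : (0 : Fin (k + 2)).removeNth y = Matrix.vecTail y := by
        funext m; simp [Matrix.vecTail, Fin.removeNth]
      simp [this]
    · refine Finset.sum_congr rfl fun j _ => ?_
      have h1 : Matrix.vecTail (j.succ.removeNth y) = j.removeNth (Matrix.vecTail y) := by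
        funext m
        simp [Matrix.vecTail, Fin.removeNth]
      have h2 : j.succ.removeNth y 0 = y 0 := by simp [Fin.removeNth]
      simp only [LinearMap.smulRight_apply, AlternatingMap.smul_apply, toAlt_succ w, h1, h2,
        Fin.val_succ, pow_succ]
      simp [Matrix.vecTail]

variable [FiniteDimensional ℝ 𝔤]

/-- In the induction the commutator term -[x, y₀] ⌋ w supplies exactly the summand in which x acts
on the first argument. -/
lemma toAlt_gLie (k : ℕ) (x : 𝔤) (w : Forms H 𝔤) :
    toAlt k (gLie x w) = lieDeriv x (toAlt k w) := by
  induction k generalizing w with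
  | zero =>
    ext y
    rw [gLie_apply, map_neg, map_sum]
    simp [toAlt_zero_gForm_mul, lieDeriv]
  | succ k ih =>
    ext y
    have h : ∀ (w : Forms H 𝔤) (y : Fin (k + 1) → 𝔤), lieDeriv x (toAlt (k + 1) w) y =
        -∑ j, toAlt (k + 1) w (Function.update y j ⁅x, y j⁆) := fun _ _ => rfl
    rw [toAlt_succ, gContract_gLie, map_sub, ih, h, Fin.sum_univ_succ]
    have h0 : Matrix.vecTail (Function.update y 0 ⁅x, y 0⁆) = Matrix.vecTail y := by
      funext m; simp [Matrix.vecTail]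
    have h1 : ∀ i : Fin k, Matrix.vecTail (Function.update y i.succ ⁅x, y i.succ⁆) =
        Function.update (Matrix.vecTail y) i ⁅x, Matrix.vecTail y i⁆ := by
      intro i; funext m
      by_cases hm : m = i
      · subst hm; simp [Matrix.vecTail]
      · simp [Matrix.vecTail, hm]
    have h2 : ∀ i : Fin k, Function.update y i.succ ⁅x, y i.succ⁆ 0 = y 0 := by
      intro i; simp [Function.update_of_ne (Fin.succ_ne_zero i).symm]
    simp only [toAlt_succ, Function.update_self, h0, h1, h2]
    simp only [AlternatingMap.sub_apply, lieDeriv, AlternatingMap.coe_mk, MultilinearMap.coe_mk]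
    abel

lemma toAlt_gDiff (k : ℕ) (w : Forms H 𝔤) : toAlt (k + 1) (gDiff w) = ceDiff k (toAlt k w) := by
  have h : lieDerivₗ k (toAlt k w) = ∑ a, ((finBasis ℝ 𝔤).coord a).smulRight
      (lieDeriv (finBasis ℝ 𝔤 a) (toAlt k w)) := by
    ext1 x
    conv_lhs => rw [← sum_coord_apply x]
    rw [map_sum, LinearMap.sum_apply]
    refine Finset.sum_congr rfl fun a _ => ?_
    rw [map_smul]; rfl
  rw [gDiff_apply, map_smul, map_sum]
  simp only [toAlt_gForm_mul, toAlt_gLie]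
  rw [ceDiff, LinearMap.smul_apply, LinearMap.comp_apply, h, map_sum]
  rfl

variable (H) in
/-- The left invariant form with given values, inverse to `toAlt`. -/
def ofAlt : (k : ℕ) → (𝔤 [⋀^Fin k]→ₗ[ℝ] ℝ) →ₗ[ℝ] Forms H 𝔤
  | 0 => Algebra.linearMap ℝ (Forms H 𝔤) ∘ₗ
      { toFun := fun α => α ![], map_add' := fun _ _ => rfl, map_smul' := fun _ _ => rfl }
  -- On forms of degree k + 1 without H-component, ∑ eᵃ ∧ (e_a ⌋ w) = (k + 1) w, so this division
  -- makes the recursion invert `toAlt`.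
  | k + 1 => ((k : ℝ) + 1)⁻¹ • ∑ a, LinearMap.mulLeft ℝ (gForm H ((finBasis ℝ 𝔤).coord a)) ∘ₗ
      ofAlt k ∘ₗ LinearMap.applyₗ (finBasis ℝ 𝔤 a) ∘ₗ AlternatingMap.curryLeftLinearMap

lemma ofAlt_zero (α : 𝔤 [⋀^Fin 0]→ₗ[ℝ] ℝ) : ofAlt H 0 α = algebraMap ℝ _ (α ![]) := rfl

lemma ofAlt_succ {k : ℕ} (α : 𝔤 [⋀^Fin (k + 1)]→ₗ[ℝ] ℝ) :
    ofAlt H (k + 1) α = ((k : ℝ) + 1)⁻¹ • ∑ a, gForm H ((finBasis ℝ 𝔤).coord a) *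
      ofAlt H k (α.curryLeft (finBasis ℝ 𝔤 a)) := by
  simp [ofAlt, LinearMap.sum_apply, AlternatingMap.curryLeftLinearMap]

variable (H 𝔤) in
/-- Forms of degree `k` without component along `H*`. -/
def gForms (k : ℕ) : Submodule ℝ (Forms H 𝔤) where
  carrier := {w | w ∈ ⋀[ℝ]^k (H × Dual ℝ 𝔤) ∧ ∀ θ : Dual ℝ H, hContract θ w = 0}
  add_mem' ha hb := ⟨add_mem ha.1 hb.1, fun θ => by rw [map_add, ha.2, hb.2, add_zero]⟩
  zero_mem' := ⟨zero_mem _, fun θ => map_zero _⟩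
  smul_mem' c _ ha := ⟨Submodule.smul_mem _ c ha.1, fun θ => by rw [map_smul, ha.2, smul_zero]⟩

omit [FiniteDimensional ℝ 𝔤] in
lemma gContract_mem_gForms (x : 𝔤) {k : ℕ} {w : Forms H 𝔤} (hw : w ∈ gForms H 𝔤 (k + 1)) :
    gContract x w ∈ gForms H 𝔤 k :=
  ⟨gContract_mem x hw.1, fun θ => by
    have := gContract_hContract x θ w
    rw [hw.2, map_zero, zero_eq_neg] at this
    exact this⟩

lemma gLie_mem_gForms (x : 𝔤) {k : ℕ} {w : Forms H 𝔤} (hw : w ∈ gForms H 𝔤 k) :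
    gLie x w ∈ gForms H 𝔤 k :=
  ⟨gLie_mem x hw.1, fun θ => by rw [hContract_gLie, hw.2, map_zero]⟩

lemma gDiff_mem_gForms {k : ℕ} {w : Forms H 𝔤} (hw : w ∈ gForms H 𝔤 k) :
    gDiff w ∈ gForms H 𝔤 (k + 1) :=
  ⟨gDiff_mem hw.1, fun θ => by rw [hContract_gDiff, hw.2, map_zero, neg_zero]⟩

lemma ofAlt_mem (k : ℕ) (α : 𝔤 [⋀^Fin k]→ₗ[ℝ] ℝ) : ofAlt H k α ∈ gForms H 𝔤 k := by
  induction k with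
  | zero =>
    have : ofAlt H 0 α ∈ ⋀[ℝ]^0 (H × Dual ℝ 𝔤) := mem_exteriorPower_zero.2 ⟨_, rfl⟩
    exact ⟨this, fun θ => hContract_of_mem_zero θ this⟩
  | succ k ih =>
    rw [ofAlt_succ]
    refine Submodule.smul_mem _ _ (sum_mem fun a _ => ?_)
    exact ⟨gForm_mul_mem _ (ih _).1, fun θ => by
      rw [hContract_gForm_mul, (ih _).2, mul_zero, neg_zero]⟩

lemma toAlt_ofAlt (k : ℕ) (α : 𝔤 [⋀^Fin k]→ₗ[ℝ] ℝ) : toAlt k (ofAlt H k α) = α := by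
  induction k with
  | zero =>
    ext y
    rw [toAlt_zero, ofAlt_zero]
    rw [ExteriorAlgebra.algebraMap_leftInverse (R := ℝ) (M := H × Dual ℝ 𝔤)]
    congr 1
    exact Subsingleton.elim _ _
  | succ k ih =>
    have h : α.curryLeft = ∑ a, ((finBasis ℝ 𝔤).coord a).smulRight
        (α.curryLeft (finBasis ℝ 𝔤 a)) := by
      ext1 x
      conv_lhs => rw [← sum_coord_apply x]
      rw [map_sum, LinearMap.sum_apply]
      refine Finset.sum_congr rfl fun a _ => ?_
      rw [map_smul]; rfl
    rw [ofAlt_succ, map_smul, map_sum]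
    simp only [toAlt_gForm_mul, ih]
    -- Alternatizing the curried form repeats each value of an already alternating map k + 1 times.
    have h2 : ∑ a, AlternatingMap.alternatizeUncurryFin (((finBasis ℝ 𝔤).coord a).smulRight
        (α.curryLeft (finBasis ℝ 𝔤 a))) = ((k : ℝ) + 1) • α := by
      have h3 := map_sum (AlternatingMap.alternatizeUncurryFinLM (R := ℝ) (N := ℝ) (n := k)) (fun a =>
        (((finBasis ℝ 𝔤).coord a).smulRight (α.curryLeft (finBasis ℝ 𝔤 a)))) Finset.univ
      rw [← h] at h3
      simp only [AlternatingMap.alternatizeUncurryFinLM_apply,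
        AlternatingMap.alternatizeUncurryFin_curryLeft] at h3
      rw [← h3]
      ext y
      simp
    rw [h2, smul_smul, inv_mul_cancel₀ (by positivity), one_smul]

/-- The degree operator reconstructs w from its contractions, and for w in `gForms` its H-half is
zero. So `toAlt` is injective there, which lets later identities be checked on alternating maps. -/
lemma ofAlt_toAlt [FiniteDimensional ℝ H] (k : ℕ) {w : Forms H 𝔤} (hw : w ∈ gForms H 𝔤 k) :
    ofAlt H k (toAlt k w) = w := by
  induction k generalizing w with
  | zero =>
    obtain ⟨c, rfl⟩ := mem_exteriorPower_zero.1 hw.1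
    rw [ofAlt_zero, toAlt_zero, ExteriorAlgebra.algebraMap_leftInverse (R := ℝ)]
  | succ k ih =>
    rw [ofAlt_succ]
    simp only [curryLeft_toAlt, ih (gContract_mem_gForms _ hw)]
    have := sum_gForm_hForm (finBasis ℝ H) hw.1
    simp only [hw.2, mul_zero, Finset.sum_const_zero, zero_add] at this
    rw [this, smul_smul]
    push_cast
    rw [inv_mul_cancel₀ (by positivity), one_smul]

lemma eq_of_toAlt_eq [FiniteDimensional ℝ H] {k : ℕ} {w w' : Forms H 𝔤}
    (hw : w ∈ gForms H 𝔤 k) (hw' : w' ∈ gForms H 𝔤 k) (h : toAlt k w = toAlt k w') : w = w' := by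
  rw [← ofAlt_toAlt k hw, h, ofAlt_toAlt k hw']

lemma gDiff_ofAlt [FiniteDimensional ℝ H] (k : ℕ) (α : 𝔤 [⋀^Fin k]→ₗ[ℝ] ℝ) :
    gDiff (ofAlt H k α) = ofAlt H (k + 1) (ceDiff k α) :=
  eq_of_toAlt_eq (gDiff_mem_gForms (ofAlt_mem k α)) (ofAlt_mem _ _) (by
    rw [toAlt_gDiff, toAlt_ofAlt, toAlt_ofAlt])

end Alternating

/-! ### Basic forms and relative cochains. -/

section Basic

variable {𝔤 : Type*} [LieRing 𝔤] [LieAlgebra ℝ 𝔤] [FiniteDimensional ℝ 𝔤]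

/-- The forms of degree `k` which are basic for the action of `𝔥`. -/
def basicForms (𝔥 : LieSubalgebra ℝ 𝔤) (k : ℕ) : Submodule ℝ (Forms 𝔥 𝔤) where
  carrier := {w | w ∈ ⋀[ℝ]^k (𝔥 × Dual ℝ 𝔤) ∧
    ∀ x : 𝔥, gContract (x : 𝔤) w = 0 ∧ gLie (x : 𝔤) w = 0}
  add_mem' ha hb := ⟨add_mem ha.1 hb.1, fun x => by
    rw [map_add, map_add, (ha.2 x).1, (hb.2 x).1, (ha.2 x).2, (hb.2 x).2, add_zero]
    exact ⟨rfl, rfl⟩⟩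
  zero_mem' := ⟨zero_mem _, fun x => ⟨map_zero _, map_zero _⟩⟩
  smul_mem' c _ ha := ⟨Submodule.smul_mem _ c ha.1, fun x => by
    rw [map_smul, map_smul, (ha.2 x).1, (ha.2 x).2, smul_zero]; exact ⟨rfl, rfl⟩⟩

variable {𝔥 : LieSubalgebra ℝ 𝔤}

lemma gDiff_mem_basicForms {k : ℕ} {w : Forms 𝔥 𝔤} (hw : w ∈ basicForms 𝔥 k) :
    gDiff w ∈ basicForms 𝔥 (k + 1) :=
  ⟨gDiff_mem hw.1, fun x => by
    rw [gContract_gDiff, (hw.2 x).1, (hw.2 x).2, gLie_gDiff, (hw.2 x).2]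
    simp⟩

lemma hForm_mul_mem_basicForms (v : 𝔥) {k : ℕ} {w : Forms 𝔥 𝔤} (hw : w ∈ basicForms 𝔥 k) :
    hForm 𝔤 v * w ∈ basicForms 𝔥 (k + 1) :=
  ⟨hForm_mul_mem v hw.1, fun x => by
    rw [gContract_hForm_mul, (hw.2 x).1, gLie_hForm_mul, (hw.2 x).2]
    simp⟩

lemma hContract_mem_basicForms (θ : Dual ℝ 𝔥) {k : ℕ} {w : Forms 𝔥 𝔤}
    (hw : w ∈ basicForms 𝔥 (k + 1)) : hContract θ w ∈ basicForms 𝔥 k :=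
  ⟨hContract_mem θ hw.1, fun x => by
    rw [gContract_hContract, (hw.2 x).1, ← hContract_gLie, (hw.2 x).2]
    simp⟩

omit [FiniteDimensional ℝ 𝔤] in
lemma toAlt_eq_zero_of_mem {k : ℕ} {w : Forms 𝔥 𝔤} (hw : ∀ x : 𝔥, gContract (x : 𝔤) w = 0)
    (y : Fin k → 𝔤) (hy : ∃ i, y i ∈ 𝔥) : toAlt k w y = 0 := by
  induction k generalizing w with
  | zero => obtain ⟨i, _⟩ := hy; exact i.elim0
  | succ k ih =>
    rw [toAlt_succ]
    obtain ⟨i, hi⟩ := hy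
    refine Fin.cases (fun h0 => ?_) (fun j hj => ?_) i hi
    · rw [hw ⟨_, h0⟩]; simp
    · refine ih (fun x => ?_) _ ⟨j, hj⟩
      rw [gContract_comm, hw x, map_zero, neg_zero]

lemma toAlt_mem_relCochains {k : ℕ} {w : Forms 𝔥 𝔤} (hw : w ∈ basicForms 𝔥 k) :
    toAlt k w ∈ relCochains 𝔥 k := by
  refine ⟨toAlt_eq_zero_of_mem fun x => (hw.2 x).1, fun x hx => ?_⟩
  have := toAlt_gLie k x w
  rw [(hw.2 ⟨x, hx⟩).2, map_zero] at this
  exact this.symm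

lemma ofAlt_mem_basicForms {k : ℕ} {α : 𝔤 [⋀^Fin k]→ₗ[ℝ] ℝ} (hα : α ∈ relCochains 𝔥 k) :
    ofAlt 𝔥 k α ∈ basicForms 𝔥 k := by
  refine ⟨(ofAlt_mem k α).1, fun x => ⟨?_, ?_⟩⟩
  · cases k with
    | zero => exact gContract_of_mem_zero _ (ofAlt_mem 0 α).1
    | succ k =>
      refine eq_of_toAlt_eq (gContract_mem_gForms _ (ofAlt_mem _ α)) (zero_mem _) ?_
      rw [← curryLeft_toAlt, toAlt_ofAlt, map_zero]
      ext y
      exact hα.1 _ ⟨0, x.2⟩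
  · refine eq_of_toAlt_eq (gLie_mem_gForms _ (ofAlt_mem _ α)) (zero_mem _) ?_
    rw [toAlt_gLie, toAlt_ofAlt, map_zero]
    exact hα.2 x x.2

lemma ceDiff_mem_relCochains {k : ℕ} {α : 𝔤 [⋀^Fin k]→ₗ[ℝ] ℝ} (hα : α ∈ relCochains 𝔥 k) :
    ceDiff k α ∈ relCochains 𝔥 (k + 1) := by
  rw [← toAlt_ofAlt (H := 𝔥) k α, ← toAlt_gDiff]
  exact toAlt_mem_relCochains (gDiff_mem_basicForms (ofAlt_mem_basicForms hα))

lemma ceDiff_ceDiff {k : ℕ} (α : 𝔤 [⋀^Fin k]→ₗ[ℝ] ℝ) : ceDiff (k + 1) (ceDiff k α) = 0 := by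
  -- The factor H plays no role in this identity; the zero subalgebra is merely a convenient choice.
  rw [← toAlt_ofAlt (H := (⊥ : LieSubalgebra ℝ 𝔤)) k α, ← toAlt_gDiff, ← toAlt_gDiff, gDiff_gDiff,
    map_zero]

variable (𝔥) in
lemma relCoboundaries_le_relCocycles (k : ℕ) : relCoboundaries 𝔥 k ≤ relCocycles 𝔥 k := by
  cases k with
  | zero => exact bot_le
  | succ k =>
    rintro _ ⟨α, hα, rfl⟩
    exact ⟨ceDiff_mem_relCochains hα, ceDiff_ceDiff α⟩

end Basic

/-! ### Smooth families of induced maps on exterior algebras. -/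

section SmoothMap

open ExteriorAlgebra (ι)

variable {W U U' : Type*} [AddCommGroup W] [Module ℝ W] [FiniteDimensional ℝ W]
  [AddCommGroup U] [Module ℝ U] [FiniteDimensional ℝ U]
  [AddCommGroup U'] [Module ℝ U'] [FiniteDimensional ℝ U']

lemma IsSmooth.mul {f g : W → ExteriorAlgebra ℝ U} (hf : IsSmooth f) (hg : IsSmooth g) :
    IsSmooth (fun x => f x * g x) :=
  IsSmooth.bilin (LinearMap.mul ℝ (ExteriorAlgebra ℝ U)) hf hg

lemma dirDeriv_mul {f g : W → ExteriorAlgebra ℝ U} (hf : IsSmooth f) (hg : IsSmooth g) (v x : W) :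
    dirDeriv v (fun x => f x * g x) x = dirDeriv v f x * g x + f x * dirDeriv v g x :=
  dirDeriv_bilin (LinearMap.mul ℝ (ExteriorAlgebra ℝ U)) hf hg v x

/-- The map of exterior algebras induced by a smooth family of linear maps is smooth. -/
lemma IsSmooth.map {A : W → U →ₗ[ℝ] U'} (hA : IsSmooth A) :
    IsSmooth (fun x => (ExteriorAlgebra.map (A x)).toLinearMap) := by
  refine IsSmooth.hom fun w => ?_
  induction w using CliffordAlgebra.left_induction with
  | algebraMap c =>
    have : (fun x => (ExteriorAlgebra.map (A x)).toLinearMap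
        (algebraMap ℝ (ExteriorAlgebra ℝ U) c)) = fun _ => algebraMap ℝ _ c := by
      funext x; simp
    exact this ▸ IsSmooth.const _
  | add x y hx hy => 
    simp only [map_add]
    exact hx.add hy
  | ι_mul b u hb =>
    have : (fun x => (ExteriorAlgebra.map (A x)).toLinearMap (ι ℝ u * b)) =
        fun x => ι ℝ (A x u) * (ExteriorAlgebra.map (A x)).toLinearMap b := by
      funext x; exact map_ι_mul _ _ _
    exact this ▸ IsSmooth.mul (IsSmooth.linear_comp (ι ℝ)
      (hA.hom_apply (IsSmooth.const u))) hb

/-- The product rule applied to ∧A(u ∧ b) = A u ∧ ∧A(b). With `dirDeriv_map_one` it determines the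
derivative of ∧A by recursion on products, in the form required by `exterior_linearMap_ext`. -/
lemma dirDeriv_map_ι_mul {A : W → U →ₗ[ℝ] U'} (hA : IsSmooth A) (v x : W) (u : U)
    (b : ExteriorAlgebra ℝ U) :
    dirDeriv v (fun x => (ExteriorAlgebra.map (A x)).toLinearMap) x (ι ℝ u * b) =
      ι ℝ (dirDeriv v A x u) * ExteriorAlgebra.map (A x) b +
        ι ℝ (A x u) * dirDeriv v (fun x => (ExteriorAlgebra.map (A x)).toLinearMap) x b := by
  have : (fun x => (ExteriorAlgebra.map (A x)).toLinearMap (ι ℝ u * b)) =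
      fun x => ι ℝ (A x u) * (ExteriorAlgebra.map (A x)).toLinearMap b := by
    funext x; exact map_ι_mul _ _ _
  have hu : IsSmooth (fun x => A x u) := hA.hom_apply (IsSmooth.const u)
  rw [dirDeriv_hom_apply hA.map, this, dirDeriv_mul (IsSmooth.linear_comp (ι ℝ) hu)
    (hA.map.hom_apply (IsSmooth.const b)), dirDeriv_linear_comp (ι ℝ) hu,
    dirDeriv_hom_apply hA, dirDeriv_hom_apply hA.map]
  rfl

lemma dirDeriv_map_one {A : W → U →ₗ[ℝ] U'} (hA : IsSmooth A) (v x : W) :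
    dirDeriv v (fun x => (ExteriorAlgebra.map (A x)).toLinearMap) x 1 = 0 := by
  rw [dirDeriv_hom_apply hA.map]
  have : (fun x => (ExteriorAlgebra.map (A x)).toLinearMap 1) =
      fun _ => (1 : ExteriorAlgebra ℝ U') := by
    funext x; simp
  rw [this, dirDeriv_const]

end SmoothMap

/-! ### Leibniz and contraction rules for the Schouten bracket with a bivector. -/

section Schouten

open ExteriorAlgebra (ι)

variable {𝔤 : Type*} [LieRing 𝔤] [LieAlgebra ℝ 𝔤] [FiniteDimensional ℝ 𝔤]

lemma schouten_eq (P Q : ExteriorAlgebra ℝ 𝔤) : schouten P Q = ∑ a, ∑ b,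
    ι ℝ ⁅finBasis ℝ 𝔤 a, finBasis ℝ 𝔤 b⁆ * contract ((finBasis ℝ 𝔤).coord a) P *
      contract ((finBasis ℝ 𝔤).coord b) Q := schouten_apply P Q

lemma sum_ι_lie_mul (x : 𝔤) (f : Fin (finrank ℝ 𝔤) → ExteriorAlgebra ℝ 𝔤) :
    ∑ a, ∑ b, (finBasis ℝ 𝔤).coord a x • (ι ℝ ⁅finBasis ℝ 𝔤 a, finBasis ℝ 𝔤 b⁆ * f b) =
      ∑ b, ι ℝ ⁅x, finBasis ℝ 𝔤 b⁆ * f b := by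
  rw [Finset.sum_comm]
  refine Finset.sum_congr rfl fun b _ => ?_
  conv_rhs => rw [← sum_coord_apply x]
  simp only [sum_lie, smul_lie, map_sum, map_smul, Finset.sum_mul, smul_mul_assoc]

lemma sum_ι_lie_mul' (x : 𝔤) (f : Fin (finrank ℝ 𝔤) → ExteriorAlgebra ℝ 𝔤) :
    ∑ a, ∑ b, (finBasis ℝ 𝔤).coord b x • (ι ℝ ⁅finBasis ℝ 𝔤 a, finBasis ℝ 𝔤 b⁆ * f a) =
      ∑ a, ι ℝ ⁅finBasis ℝ 𝔤 a, x⁆ * f a := by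
  refine Finset.sum_congr rfl fun b _ => ?_
  conv_rhs => rw [← sum_coord_apply x]
  simp only [lie_sum, lie_smul, map_sum, map_smul, Finset.sum_mul, smul_mul_assoc]

lemma schouten_ι (x : 𝔤) (Q : ExteriorAlgebra ℝ 𝔤) : schouten (ι ℝ x) Q =
    ∑ b, ι ℝ ⁅x, finBasis ℝ 𝔤 b⁆ * contract ((finBasis ℝ 𝔤).coord b) Q := by
  rw [schouten_eq, ← sum_ι_lie_mul]
  refine Finset.sum_congr rfl fun a _ => Finset.sum_congr rfl fun b _ => ?_
  rw [contract_ι, ← Algebra.commutes, ← Algebra.smul_def, smul_mul_assoc]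

lemma schouten_ι_ι_mul (x u : 𝔤) (Q : ExteriorAlgebra ℝ 𝔤) :
    schouten (ι ℝ x) (ι ℝ u * Q) = ι ℝ ⁅x, u⁆ * Q + ι ℝ u * schouten (ι ℝ x) Q := by
  have h : ι ℝ ⁅x, u⁆ * Q =
      ∑ b, (finBasis ℝ 𝔤).coord b u • (ι ℝ ⁅x, finBasis ℝ 𝔤 b⁆ * Q) := by
    conv_lhs => rw [← sum_coord_apply u]
    simp only [lie_sum, lie_smul, map_sum, map_smul, Finset.sum_mul, smul_mul_assoc]
  simp only [schouten_ι, contract_ι_mul, mul_sub, mul_smul_comm, ι_mul_ι_mul _ u, Finset.mul_sum,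
    sub_neg_eq_add, Finset.sum_add_distrib]
  rw [h]

lemma schouten_right_ι (P : ExteriorAlgebra ℝ 𝔤) (u : 𝔤) : schouten P (ι ℝ u) =
    ∑ a, ι ℝ ⁅finBasis ℝ 𝔤 a, u⁆ * contract ((finBasis ℝ 𝔤).coord a) P := by
  rw [schouten_eq, ← sum_ι_lie_mul']
  refine Finset.sum_congr rfl fun a _ => Finset.sum_congr rfl fun b _ => ?_
  rw [contract_ι, ← Algebra.commutes, ← Algebra.smul_def]

lemma schouten_right_one (P : ExteriorAlgebra ℝ 𝔤) : schouten P 1 = 0 := by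
  simp [schouten_eq, contract_one]

/-- The Schouten bracket with a bivector is an odd derivation. -/
lemma schouten_ι_mul {P : ExteriorAlgebra ℝ 𝔤} (hP : P ∈ ⋀[ℝ]^2 𝔤) (u : 𝔤)
    (Q : ExteriorAlgebra ℝ 𝔤) :
    schouten P (ι ℝ u * Q) = schouten P (ι ℝ u) * Q - ι ℝ u * schouten P Q := by
  -- The product [e_a, e_b] ∧ (eᵃ ⌋ P) is again a bivector, hence central.
  have hc : ∀ a b, ι ℝ ⁅finBasis ℝ 𝔤 a, finBasis ℝ 𝔤 b⁆ *
      contract ((finBasis ℝ 𝔤).coord a) P * ι ℝ u =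
      ι ℝ u * (ι ℝ ⁅finBasis ℝ 𝔤 a, finBasis ℝ 𝔤 b⁆ * contract ((finBasis ℝ 𝔤).coord a) P) :=
    fun a b => bivector_mul_ι (ι_mul_mem (k := 1) _ (contract_mem _ hP)) u
  simp only [schouten_eq, contract_ι_mul, contract_ι, mul_sub, Finset.sum_sub_distrib,
    Finset.sum_mul, Finset.mul_sum]
  congr 1
  · refine Finset.sum_congr rfl fun a _ => Finset.sum_congr rfl fun b _ => ?_
    rw [mul_smul_comm, mul_assoc _ (algebraMap _ _ _), ← Algebra.smul_def, mul_smul_comm]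
  · refine Finset.sum_congr rfl fun a _ => Finset.sum_congr rfl fun b _ => ?_
    rw [← mul_assoc, hc, mul_assoc (ι ℝ u)]

omit [FiniteDimensional ℝ 𝔤] in
lemma ι_sharp {P : ExteriorAlgebra ℝ 𝔤} (hP : P ∈ ⋀[ℝ]^2 𝔤) (ξ : Dual ℝ 𝔤) :
    ι ℝ (sharp P ξ) = contract ξ P := by
  have h : contract ξ P ∈ LinearMap.range (ι ℝ : 𝔤 →ₗ[ℝ] ExteriorAlgebra ℝ 𝔤) ^ 1 :=
    contract_mem (k := 1) ξ hP
  rw [pow_one] at h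
  obtain ⟨u, hu⟩ := h
  have : sharp P ξ = ExteriorAlgebra.ιInv (contract ξ P) := rfl
  rw [this, ← hu, ExteriorAlgebra.ι_leftInverse]

omit [FiniteDimensional ℝ 𝔤] in
lemma sharp_skew {P : ExteriorAlgebra ℝ 𝔤} (hP : P ∈ ⋀[ℝ]^2 𝔤) (ξ η : Dual ℝ 𝔤) :
    ξ (sharp P η) = -η (sharp P ξ) := by
  have h := contract_comm ξ η P
  rw [← ι_sharp hP, ← ι_sharp hP, contract_ι, contract_ι, ← map_neg] at h
  exact (ExteriorAlgebra.algebraMap_inj (R := ℝ) 𝔤 _ _).1 h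

lemma schouten_right_ι_of_invariant {P : ExteriorAlgebra ℝ 𝔤} {x : 𝔤}
    (h0 : schouten (ι ℝ x) P = 0) : schouten P (ι ℝ x) = 0 := by
  rw [schouten_right_ι]
  rw [schouten_ι] at h0
  rw [← neg_eq_zero, ← h0, ← Finset.sum_neg_distrib]
  refine Finset.sum_congr rfl fun a _ => ?_
  rw [← lie_skew x, map_neg, neg_mul]

/-- Contracting [x, P] = 0 with ξ leaves one term where x acts on the covector and one where it acts
on P^# ξ; their cancellation is the equivariance of P^#. -/
lemma lie_sharp {P : ExteriorAlgebra ℝ 𝔤} (hP : P ∈ ⋀[ℝ]^2 𝔤) {x : 𝔤}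
    (h0 : schouten (ι ℝ x) P = 0) (ξ : Dual ℝ 𝔤) : ⁅x, sharp P ξ⁆ = sharp P (coad x ξ) := by
  apply (ExteriorAlgebra.ι_inj ℝ _ _).1
  have h1 : contract ξ (schouten (ι ℝ x) P) = 0 := by rw [h0, map_zero]
  have h2 : ∑ b, ξ ⁅x, finBasis ℝ 𝔤 b⁆ • contract ((finBasis ℝ 𝔤).coord b) P =
      -contract (coad x ξ) P := by
    conv_rhs => rw [← sum_apply_coord (coad x ξ)]
    simp [coad_apply]
  have h3 : ∑ b, ι ℝ ⁅x, finBasis ℝ 𝔤 b⁆ * contract ξ (contract ((finBasis ℝ 𝔤).coord b) P) =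
      -ι ℝ ⁅x, sharp P ξ⁆ := by
    conv_rhs => rw [← sum_coord_apply (sharp P ξ)]
    simp only [lie_sum, lie_smul, map_sum, map_smul, ← Finset.sum_neg_distrib]
    refine Finset.sum_congr rfl fun b _ => ?_
    rw [contract_comm, ← ι_sharp hP ξ, contract_ι, mul_neg, ← Algebra.commutes, ← Algebra.smul_def]
  rw [schouten_ι, map_sum] at h1
  simp only [contract_ι_mul, Finset.sum_sub_distrib, h2, h3] at h1
  rw [ι_sharp hP]
  rw [sub_neg_eq_add, add_comm, ← sub_eq_add_neg, sub_eq_zero] at h1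
  exact h1

/-- The covector may meet the bracket [e_a, e_b], which gives the quadratic sum, or either copy of
P. The last two cases contribute equally, whence the 2 that the ½ in the Yang–Baxter equation
cancels. -/
lemma contract_schouten_self {P : ExteriorAlgebra ℝ 𝔤} (hP : P ∈ ⋀[ℝ]^2 𝔤) (ξ : Dual ℝ 𝔤) :
    contract ξ (schouten P P) = ∑ a, ∑ b, ξ ⁅finBasis ℝ 𝔤 a, finBasis ℝ 𝔤 b⁆ •
      (contract ((finBasis ℝ 𝔤).coord a) P * contract ((finBasis ℝ 𝔤).coord b) P) -
      (2 : ℝ) • schouten P (ι ℝ (sharp P ξ)) := by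
  have h1 : ∀ a b, contract ξ (contract ((finBasis ℝ 𝔤).coord a) P *
      contract ((finBasis ℝ 𝔤).coord b) P) =
      (finBasis ℝ 𝔤).coord b (sharp P ξ) • contract ((finBasis ℝ 𝔤).coord a) P -
        (finBasis ℝ 𝔤).coord a (sharp P ξ) • contract ((finBasis ℝ 𝔤).coord b) P := by
    intro a b
    rw [← ι_sharp hP ((finBasis ℝ 𝔤).coord a), ← ι_sharp hP ((finBasis ℝ 𝔤).coord b),
      contract_ι_mul, contract_ι, sharp_skew hP ξ, sharp_skew hP ξ, ← Algebra.commutes,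
      ← Algebra.smul_def]
    simp only [neg_smul]
    abel
  have h2 : ∑ b, ι ℝ ⁅sharp P ξ, finBasis ℝ 𝔤 b⁆ * contract ((finBasis ℝ 𝔤).coord b) P =
      -∑ b, ι ℝ ⁅finBasis ℝ 𝔤 b, sharp P ξ⁆ * contract ((finBasis ℝ 𝔤).coord b) P := by
    rw [← Finset.sum_neg_distrib]
    refine Finset.sum_congr rfl fun a _ => ?_
    rw [← lie_skew, map_neg, neg_mul]
  simp only [schouten_eq P P, map_sum, mul_assoc, contract_ι_mul, h1, mul_sub, mul_smul_comm,
    Finset.sum_sub_distrib]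
  rw [sum_ι_lie_mul, sum_ι_lie_mul', h2, schouten_right_ι, two_smul]
  abel

end Schouten

/-! ### The map from forms to multivectors and its compatibility with the differentials. -/

section Frame

open ExteriorAlgebra (ι)

variable {𝔤 : Type*} [LieRing 𝔤] [LieAlgebra ℝ 𝔤] [FiniteDimensional ℝ 𝔤]
  {𝔥 : LieSubalgebra ℝ 𝔤} {κ : Type*} [Fintype κ] [DecidableEq κ]

/-- The map `(v, ξ) ↦ v - r(λ)^# ξ`. -/
def frame (r : SmoothMaps 𝔥) (l : Dual ℝ 𝔥) : 𝔥 × Dual ℝ 𝔤 →ₗ[ℝ] 𝔤 :=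
  𝔥.toSubmodule.subtype.coprod (-sharp (r.1 l))

lemma frame_apply (r : SmoothMaps 𝔥) (l : Dual ℝ 𝔥) (u : 𝔥 × Dual ℝ 𝔤) :
    frame r l u = u.1 - sharp (r.1 l) u.2 := by
  simp [frame, sub_eq_add_neg]

/-- The map from forms to multivectors induced by `frame`. -/
def frameMap (r : SmoothMaps 𝔥) (l : Dual ℝ 𝔥) : Forms 𝔥 𝔤 →ₗ[ℝ] ExteriorAlgebra ℝ 𝔤 :=
  (ExteriorAlgebra.map (frame r l)).toLinearMap

lemma frameMap_one (r : SmoothMaps 𝔥) (l : Dual ℝ 𝔥) : frameMap r l 1 = 1 := by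
  simp [frameMap]

lemma frameMap_mul (r : SmoothMaps 𝔥) (l : Dual ℝ 𝔥) (a b : Forms 𝔥 𝔤) :
    frameMap r l (a * b) = frameMap r l a * frameMap r l b := by
  simp [frameMap]

lemma frameMap_ι (r : SmoothMaps 𝔥) (l : Dual ℝ 𝔥) (u : 𝔥 × Dual ℝ 𝔤) :
    frameMap r l (ι ℝ u) = ι ℝ (frame r l u) := by
  simp [frameMap]

lemma frameMap_hForm (r : SmoothMaps 𝔥) (l : Dual ℝ 𝔥) (v : 𝔥) :
    frameMap r l (hForm 𝔤 v) = ι ℝ (v : 𝔤) := by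
  rw [show hForm 𝔤 v = ι ℝ (v, (0 : Dual ℝ 𝔤)) from rfl, frameMap_ι, frame_apply]
  simp

lemma frameMap_gForm {r : SmoothMaps 𝔥} {l : Dual ℝ 𝔥} (hr : r.1 l ∈ ⋀[ℝ]^2 𝔤) (ξ : Dual ℝ 𝔤) :
    frameMap r l (gForm 𝔥 ξ) = -contract ξ (r.1 l) := by
  rw [show gForm 𝔥 ξ = ι ℝ ((0 : 𝔥), ξ) from rfl, frameMap_ι, frame_apply, ← ι_sharp hr]
  simp

lemma isSmooth_frame (r : SmoothMaps 𝔥) : IsSmooth (frame r) := by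
  refine IsSmooth.hom fun u => ?_
  let L : ExteriorAlgebra ℝ 𝔤 →ₗ[ℝ] 𝔤 := -(ExteriorAlgebra.ιInv ∘ₗ contract u.2)
  have : (fun l => frame r l u) = (fun _ => (u.1 : 𝔤)) + fun l => L (r.1 l) := by
    funext l
    rw [frame_apply, sub_eq_add_neg]
    rfl
  rw [this]
  exact (IsSmooth.const _).add (IsSmooth.linear_comp L r.2)

lemma isSmooth_frameMap (r : SmoothMaps 𝔥) : IsSmooth (frameMap r) := (isSmooth_frame r).map

lemma ι_dirDeriv_frame {r : SmoothMaps 𝔥} (hr : ∀ l, r.1 l ∈ ⋀[ℝ]^2 𝔤) (v l : Dual ℝ 𝔥)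
    (u : 𝔥 × Dual ℝ 𝔤) :
    ι ℝ (dirDeriv v (frame r) l u) = -contract u.2 (dirDeriv v r.1 l) := by
  rw [dirDeriv_hom_apply (isSmooth_frame r),
    ← dirDeriv_linear_comp (ι ℝ) ((isSmooth_frame r).hom_apply (IsSmooth.const u))]
  let L : ExteriorAlgebra ℝ 𝔤 →ₗ[ℝ] ExteriorAlgebra ℝ 𝔤 := -contract u.2
  have : (fun l => ι ℝ (frame r l u)) = fun l => (fun _ => ι ℝ (u.1 : 𝔤)) l + L (r.1 l) := by
    funext l
    rw [frame_apply, map_sub, ι_sharp (hr l), sub_eq_add_neg]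
    rfl
  rw [this, dirDeriv_add (IsSmooth.const _) (IsSmooth.linear_comp L r.2), dirDeriv_const,
    dirDeriv_linear_comp L r.2, zero_add]
  rfl

lemma frameMap_gDiffForm {r : SmoothMaps 𝔥} {l : Dual ℝ 𝔥} (hr : r.1 l ∈ ⋀[ℝ]^2 𝔤)
    (ξ : Dual ℝ 𝔤) : frameMap r l (gDiffForm 𝔥 ξ) =
      -((1 / 2 : ℝ) • ∑ a, ∑ b, ξ ⁅finBasis ℝ 𝔤 a, finBasis ℝ 𝔤 b⁆ •
        (contract ((finBasis ℝ 𝔤).coord a) (r.1 l) *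
          contract ((finBasis ℝ 𝔤).coord b) (r.1 l))) := by
  have h : ∀ x, contract (coad x ξ) (r.1 l) =
      -∑ b, ξ ⁅x, finBasis ℝ 𝔤 b⁆ • contract ((finBasis ℝ 𝔤).coord b) (r.1 l) := by
    intro x
    conv_lhs => rw [← sum_apply_coord (coad x ξ)]
    simp [coad_apply]
  simp only [gDiffForm, map_smul, map_sum, frameMap_mul, frameMap_gForm hr, h, neg_mul,
    Finset.sum_neg_distrib, smul_neg, Finset.mul_sum, mul_smul_comm, neg_neg]

lemma cdybe_apply {h : Basis κ ℝ 𝔥} {r : SmoothMaps 𝔥} (hr : IsTriangular h r) (l : Dual ℝ 𝔥) :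
    ∑ i, ι ℝ (h i : 𝔤) * dirDeriv (h.dualBasis i) r.1 l +
      (1 / 2 : ℝ) • schouten (r.1 l) (r.1 l) = 0 := by
  have := congrFun (congrArg Subtype.val hr.cdybe) l
  simpa [wedgeDeriv, bracket] using this

/-- This is the Yang–Baxter equation contracted with ξ = `u.2`. The term hᵢ ∧ ∂ᵢr splits into ξ(hᵢ)
∂ᵢr and -hᵢ ∧ (ξ ⌋ ∂ᵢr), while ½ [r, r] gives minus the image of dξ and -[r, r^# ξ]. The component
`u.1` contributes nothing because r has zero weight. -/
lemma contract_cdybe {h : Basis κ ℝ 𝔥} {r : SmoothMaps 𝔥} (hr : IsTriangular h r) (l : Dual ℝ 𝔥)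
    (u : 𝔥 × Dual ℝ 𝔤) :
    ∑ i, ι ℝ (h i : 𝔤) * ι ℝ (dirDeriv (h.dualBasis i) (frame r) l u) +
      schouten (r.1 l) (ι ℝ (frame r l u)) =
    frameMap r l (gDiffForm 𝔥 u.2) - ∑ i, u.2 (h i) • dirDeriv (h.dualBasis i) r.1 l := by
  have h1 := congrArg (contract u.2) (cdybe_apply hr l)
  rw [map_add, map_sum, map_zero, map_smul, contract_schouten_self (hr.bivector l)] at h1
  simp only [contract_ι_mul, Finset.sum_sub_distrib] at h1
  simp only [ι_dirDeriv_frame hr.bivector, frameMap_gDiffForm (hr.bivector l), frame_apply, map_sub,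
    schouten_right_ι_of_invariant (hr.zero_weight l _), mul_neg, Finset.sum_neg_distrib]
  rw [← sub_eq_zero]
  refine Eq.trans ?_ h1
  module

/-- Compatibility of `frameMap` with the differentials, for constant forms. -/
lemma frameMap_gDiff {h : Basis κ ℝ 𝔥} {r : SmoothMaps 𝔥} (hr : IsTriangular h r) (l : Dual ℝ 𝔥)
    (w : Forms 𝔥 𝔤) :
    ∑ i, ι ℝ (h i : 𝔤) * dirDeriv (h.dualBasis i) (frameMap r) l w +
      schouten (r.1 l) (frameMap r l w) =
    frameMap r l (gDiff w) -
      ∑ i, dirDeriv (h.dualBasis i) r.1 l * frameMap r l (gContract (h i : 𝔤) w) := by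
  have key : ∑ i, LinearMap.mulLeft ℝ (ι ℝ (h i : 𝔤)) ∘ₗ dirDeriv (h.dualBasis i) (frameMap r) l +
      schouten (r.1 l) ∘ₗ frameMap r l = frameMap r l ∘ₗ gDiff -
      ∑ i, LinearMap.mulLeft ℝ (dirDeriv (h.dualBasis i) r.1 l) ∘ₗ frameMap r l ∘ₗ
        gContract (h i : 𝔤) := by
    refine exterior_linearMap_ext ?_ fun u b hb => ?_
    · have h1 : ∀ x : 𝔤, gContract x (1 : Forms 𝔥 𝔤) = 0 := fun x => contract_one _
      have h2 : ∀ v, dirDeriv v (frameMap r) l 1 = 0 := fun v =>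
        dirDeriv_map_one (isSmooth_frame r) v l
      simp [h1, h2, frameMap_one, schouten_right_one, gDiff_apply, gLie_apply]
    · have h1 : ∀ v, dirDeriv v (frameMap r) l (ι ℝ u * b) =
          ι ℝ (dirDeriv v (frame r) l u) * frameMap r l b +
            ι ℝ (frame r l u) * dirDeriv v (frameMap r) l b := fun v =>
        dirDeriv_map_ι_mul (isSmooth_frame r) v l u b
      have h2 : gDiff (ι ℝ u * b) = gDiffForm 𝔥 u.2 * b - ι ℝ u * gDiff b := by
        rw [ι_eq_add, add_mul, map_add, gDiff_gForm_mul, gDiff_hForm_mul, add_mul]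
        abel
      have h3 : ∀ x : 𝔤, gContract x (ι ℝ u * b) = u.2 x • b - ι ℝ u * gContract x b := by
        intro x
        rw [ι_eq_add, add_mul, map_add, gContract_gForm_mul, gContract_hForm_mul, add_mul]
        abel
      -- A derivative of r is still a bivector, hence central.
      have h4 : ∀ v, dirDeriv v r.1 l * ι ℝ (frame r l u) =
          ι ℝ (frame r l u) * dirDeriv v r.1 l := fun v =>
        bivector_mul_ι (dirDeriv_mem _ r.2 hr.bivector v l) _
      have h5 := contract_cdybe hr l u
      simp only [LinearMap.add_apply, LinearMap.sub_apply, LinearMap.comp_apply,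
        LinearMap.sum_apply, LinearMap.mulLeft_apply] at hb ⊢
      -- The left-hand operator is an odd derivation along the homomorphism `frameMap`, so on u ∧ b
      -- it reduces to the generator u, handled by `h5`, and to b, handled by `hb`.
      have e1 : ∑ i, ι ℝ (h i : 𝔤) * dirDeriv (h.dualBasis i) (frameMap r) l (ι ℝ u * b) +
          schouten (r.1 l) (frameMap r l (ι ℝ u * b)) =
          (∑ i, ι ℝ (h i : 𝔤) * ι ℝ (dirDeriv (h.dualBasis i) (frame r) l u) +
            schouten (r.1 l) (ι ℝ (frame r l u))) * frameMap r l b -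
          ι ℝ (frame r l u) * (∑ i, ι ℝ (h i : 𝔤) * dirDeriv (h.dualBasis i) (frameMap r) l b +
            schouten (r.1 l) (frameMap r l b)) := by
        rw [frameMap_mul, frameMap_ι, schouten_ι_mul (hr.bivector l)]
        simp only [h1, mul_add, ι_mul_ι_mul _ (frame r l u), Finset.sum_add_distrib,
          Finset.sum_neg_distrib, add_mul, Finset.sum_mul, Finset.mul_sum, mul_assoc]
        abel
      rw [e1, hb, h5]
      simp only [h2, h3, map_sub, map_smul, frameMap_mul, frameMap_ι, mul_sub, sub_mul,
        Finset.sum_sub_distrib, Finset.sum_mul, Finset.mul_sum, ← mul_assoc, h4, mul_smul_comm,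
        smul_mul_assoc]
      abel
  have := LinearMap.congr_fun key w
  simpa [LinearMap.sum_apply] using this

/-- The restriction of the Lie derivative to `𝔥` corresponds to the adjoint action. -/
lemma frameMap_gLie [IsLieAbelian 𝔥] {h : Basis κ ℝ 𝔥} {r : SmoothMaps 𝔥} (hr : IsTriangular h r)
    (l : Dual ℝ 𝔥) (x : 𝔥) (w : Forms 𝔥 𝔤) :
    frameMap r l (gLie (x : 𝔤) w) = schouten (ι ℝ (x : 𝔤)) (frameMap r l w) := by
  have key : frameMap r l ∘ₗ gLie (x : 𝔤) = schouten (ι ℝ (x : 𝔤)) ∘ₗ frameMap r l := by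
    refine exterior_linearMap_ext ?_ fun u b hb => ?_
    · have h1 : ∀ x : 𝔤, gContract x (1 : Forms 𝔥 𝔤) = 0 := fun x => contract_one _
      simp [h1, frameMap_one, schouten_right_one, gLie_apply]
    · simp only [LinearMap.comp_apply] at hb ⊢
      -- `gLie` acts trivially on the factor 𝔥, so the adjoint action on 𝔥 has to be trivial as
      -- well; commutativity of 𝔥 enters here.
      have h0 : ⁅(x : 𝔤), (u.1 : 𝔤)⁆ = 0 := by
        have := congrArg (Subtype.val) (trivial_lie_zero 𝔥 𝔥 x u.1)
        simpa using this
      rw [frameMap_mul, frameMap_ι, schouten_ι_ι_mul, ← hb, frame_apply, lie_sub, h0,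
        lie_sharp (hr.bivector l) (hr.zero_weight l x), ι_eq_add, add_mul, map_add,
        gLie_hForm_mul, gLie_gForm_mul]
      simp only [map_add, frameMap_mul, frameMap_hForm, frameMap_gForm (hr.bivector l), map_sub,
        ι_sharp (hr.bivector l), map_neg, sub_mul, zero_sub, neg_mul]
      abel
  exact LinearMap.congr_fun key w

end Frame

/-! ### Non-degeneracy and the inverse of the frame map on horizontal forms. -/

section Coframe

open ExteriorAlgebra (ι)

variable {𝔤 : Type*} [LieRing 𝔤] [LieAlgebra ℝ 𝔤] [FiniteDimensional ℝ 𝔤]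
  {𝔥 : LieSubalgebra ℝ 𝔤} {κ : Type*} [Fintype κ] [DecidableEq κ]

variable (𝔥) in
/-- The space `𝔥 × 𝔥^⊥` of horizontal covectors. -/
def HorizontalSpace : Type _ := 𝔥 × 𝔥.toSubmodule.dualAnnihilator

instance : AddCommGroup (HorizontalSpace 𝔥) :=
  inferInstanceAs (AddCommGroup (𝔥 × 𝔥.toSubmodule.dualAnnihilator))

instance : Module ℝ (HorizontalSpace 𝔥) :=
  inferInstanceAs (Module ℝ (𝔥 × 𝔥.toSubmodule.dualAnnihilator))

instance : FiniteDimensional ℝ (HorizontalSpace 𝔥) :=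
  inferInstanceAs (FiniteDimensional ℝ (𝔥 × 𝔥.toSubmodule.dualAnnihilator))

variable (𝔥) in
/-- The inclusion of `𝔥 × 𝔥^⊥` into `𝔥 × 𝔤*`. -/
def horizontalIncl : HorizontalSpace 𝔥 →ₗ[ℝ] 𝔥 × Dual ℝ 𝔤 :=
  LinearMap.prodMap LinearMap.id 𝔥.toSubmodule.dualAnnihilator.subtype

/-- Maximal rank makes 𝔤_λ all of 𝔤, which is surjectivity; since dim 𝔥 + dim 𝔥^⊥ = dim 𝔤,
injectivity follows. -/
lemma frame_horizontalIncl_bijective {r : SmoothMaps 𝔥} (hnd : IsNondegenerate r)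
    (l : Dual ℝ 𝔥) : Function.Bijective (frame r l ∘ₗ horizontalIncl 𝔥) := by
  have htop : gSub r l = ⊤ := by
    apply Submodule.eq_top_of_finrank_eq
    have := hnd l
    unfold rankAt at this
    omega
  have hsurj : Function.Surjective (frame r l ∘ₗ horizontalIncl 𝔥) := by
    intro y
    have hy : y ∈ gSub r l := htop ▸ Submodule.mem_top
    obtain ⟨v, hv, z, ⟨ξ, hξ, rfl⟩, rfl⟩ := Submodule.mem_sup.1 hy
    refine ⟨(⟨v, hv⟩, -⟨ξ, hξ⟩), ?_⟩
    refine (frame_apply r l _).trans ?_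
    change v - sharp (r.1 l) (-ξ) = v + sharp (r.1 l) ξ
    rw [map_neg, sub_neg_eq_add]
  refine ⟨?_, hsurj⟩
  refine (LinearMap.injective_iff_surjective_of_finrank_eq_finrank ?_).2 hsurj
  have : Module.Free ℝ 𝔥.toSubmodule.dualAnnihilator :=
    @Module.Free.of_divisionRing ℝ 𝔥.toSubmodule.dualAnnihilator _ _ _
  exact (Module.finrank_prod (R := ℝ) (M := 𝔥) (M' := 𝔥.toSubmodule.dualAnnihilator)).trans
    (Subspace.finrank_add_finrank_dualAnnihilator_eq 𝔥.toSubmodule)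

/-- The isomorphism `𝔥 × 𝔥^⊥ ≃ 𝔤` given by a non-degenerate `r`. -/
def frameEquiv {r : SmoothMaps 𝔥} (hnd : IsNondegenerate r) (l : Dual ℝ 𝔥) :
    HorizontalSpace 𝔥 ≃ₗ[ℝ] 𝔤 :=
  LinearEquiv.ofBijective _ (frame_horizontalIncl_bijective hnd l)

/-- The inverse of `frameEquiv`, with values in `𝔥 × 𝔤*`. -/
def coframe {r : SmoothMaps 𝔥} (hnd : IsNondegenerate r) (l : Dual ℝ 𝔥) :
    𝔤 →ₗ[ℝ] 𝔥 × Dual ℝ 𝔤 :=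
  horizontalIncl 𝔥 ∘ₗ (frameEquiv hnd l).symm.toLinearMap

/-- The map from multivectors to forms induced by `coframe`. -/
def coframeMap {r : SmoothMaps 𝔥} (hnd : IsNondegenerate r) (l : Dual ℝ 𝔥) :
    ExteriorAlgebra ℝ 𝔤 →ₗ[ℝ] Forms 𝔥 𝔤 :=
  (ExteriorAlgebra.map (coframe hnd l)).toLinearMap

lemma isSmooth_coframeMap {r : SmoothMaps 𝔥} (hnd : IsNondegenerate r) :
    IsSmooth (coframeMap hnd) := by
  refine IsSmooth.map ?_
  have h1 : IsSmooth (fun l => (frameEquiv hnd l).toLinearMap) :=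
    IsSmooth.hom fun u => (isSmooth_frame r).hom_apply (IsSmooth.const (horizontalIncl 𝔥 u))
  exact IsSmooth.hom fun x =>
    IsSmooth.linear_comp (horizontalIncl 𝔥) (h1.equiv_symm.hom_apply (IsSmooth.const x))

lemma frame_coframe {r : SmoothMaps 𝔥} (hnd : IsNondegenerate r) (l : Dual ℝ 𝔥) :
    frame r l ∘ₗ coframe hnd l = LinearMap.id := by
  ext x
  exact (frameEquiv hnd l).apply_symm_apply x

lemma frameMap_coframeMap {r : SmoothMaps 𝔥} (hnd : IsNondegenerate r) (l : Dual ℝ 𝔥)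
    (P : ExteriorAlgebra ℝ 𝔤) : frameMap r l (coframeMap hnd l P) = P := by
  have := congrArg (fun f => f P) (ExteriorAlgebra.map_comp_map (coframe hnd l) (frame r l))
  rw [frame_coframe, ExteriorAlgebra.map_id] at this
  exact this

lemma coframe_frame {r : SmoothMaps 𝔥} (hnd : IsNondegenerate r) (l : Dual ℝ 𝔥)
    (v : 𝔥) {ξ : Dual ℝ 𝔤} (hξ : ξ ∈ 𝔥.toSubmodule.dualAnnihilator) :
    coframe hnd l (frame r l (v, ξ)) = (v, ξ) := by
  have := (frameEquiv hnd l).symm_apply_apply (v, ⟨ξ, hξ⟩)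
  exact congrArg (horizontalIncl 𝔥) this

lemma gContract_coframeMap {r : SmoothMaps 𝔥} (hnd : IsNondegenerate r) (l : Dual ℝ 𝔥)
    (x : 𝔥) (P : ExteriorAlgebra ℝ 𝔤) : gContract (x : 𝔤) (coframeMap hnd l P) = 0 := by
  have h : (((LinearMap.snd ℝ 𝔥 (Dual ℝ 𝔤)).dualMap ∘ₗ Dual.eval ℝ 𝔤) (x : 𝔤)) ∘ₗ
      coframe hnd l = 0 := by
    ext y
    exact (Submodule.mem_dualAnnihilator _).1 ((frameEquiv hnd l).symm y).2.2 x x.2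
  have := contract_map (coframe hnd l)
    (((LinearMap.snd ℝ 𝔥 (Dual ℝ 𝔤)).dualMap ∘ₗ Dual.eval ℝ 𝔤) (x : 𝔤)) P
  rw [h, map_zero, LinearMap.zero_apply, map_zero] at this
  exact this

/-- `coframe` inverts `frame` only on 𝔥 × 𝔥^⊥, so w has to be written with covectors from 𝔥^⊥. The
degree operator does this: it expresses w through products of one-forms with contractions of w, and
horizontality allows each eᵃ to be replaced by a covector vanishing on 𝔥. The contractions are again
horizontal, so induction on the degree applies. -/
lemma coframeMap_frameMap {r : SmoothMaps 𝔥} (hnd : IsNondegenerate r) (l : Dual ℝ 𝔥) {k : ℕ}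
    {w : Forms 𝔥 𝔤} (hw : w ∈ ⋀[ℝ]^k (𝔥 × Dual ℝ 𝔤))
    (hx : ∀ x : 𝔥, gContract (x : 𝔤) w = 0) : coframeMap hnd l (frameMap r l w) = w := by
  induction k generalizing w with
  | zero =>
    obtain ⟨c, rfl⟩ := mem_exteriorPower_zero.1 hw
    simp [coframeMap, frameMap]
  | succ k ih =>
    obtain ⟨g, hg⟩ := LinearMap.exists_leftInverse_of_injective 𝔥.toSubmodule.subtype
      (Submodule.ker_subtype _)
    -- A projection along 𝔥: contraction of w does not distinguish x from T x, and every ξ ∘ T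
    -- annihilates 𝔥.
    let T : 𝔤 →ₗ[ℝ] 𝔤 := LinearMap.id - 𝔥.toSubmodule.subtype ∘ₗ g
    have hT : ∀ x : 𝔤, gContract (T x) w = gContract x w := by
      intro x
      have := hx (g x)
      simp only [T, LinearMap.sub_apply, map_sub, LinearMap.comp_apply, LinearMap.id_apply]
      erw [this]
      rw [sub_zero]
    have hT2 : ∀ ξ : Dual ℝ 𝔤, ξ ∘ₗ T ∈ 𝔥.toSubmodule.dualAnnihilator := by
      intro ξ
      rw [Submodule.mem_dualAnnihilator]
      intro x hx
      have := LinearMap.congr_fun hg ⟨x, hx⟩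
      simp only [LinearMap.comp_apply, Submodule.subtype_apply, LinearMap.id_apply] at this
      simp [T, this]
    have h1 := sum_coord_comp (formContract w) T
    simp only [formContract_apply, hT] at h1
    have h2 := sum_gForm_hForm (finBasis ℝ 𝔥) hw
    rw [← h1] at h2
    have h3 : ∀ θ, coframeMap hnd l (frameMap r l (hContract θ w)) = hContract θ w := fun θ =>
      ih (hContract_mem θ hw) fun x => by rw [gContract_hContract, hx, map_zero, neg_zero]
    have h4 : ∀ y : 𝔤, coframeMap hnd l (frameMap r l (gContract y w)) = gContract y w := fun y =>
      ih (gContract_mem y hw) fun x => by rw [gContract_comm, hx, map_zero, neg_zero]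
    have h5 : ∀ v b, coframeMap hnd l (frameMap r l (hForm 𝔤 v * b)) =
        hForm 𝔤 v * coframeMap hnd l (frameMap r l b) := by
      intro v b
      rw [show hForm 𝔤 v = ι ℝ (v, (0 : Dual ℝ 𝔤)) from rfl, frameMap_mul, frameMap_ι]
      refine (map_ι_mul _ _ _).trans ?_
      rw [coframe_frame hnd l v (zero_mem _)]
      rfl
    have h6 : ∀ ξ ∈ 𝔥.toSubmodule.dualAnnihilator, ∀ b,
        coframeMap hnd l (frameMap r l (gForm 𝔥 ξ * b)) =
          gForm 𝔥 ξ * coframeMap hnd l (frameMap r l b) := by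
      intro ξ hξ b
      rw [show gForm 𝔥 ξ = ι ℝ ((0 : 𝔥), ξ) from rfl, frameMap_mul, frameMap_ι]
      refine (map_ι_mul _ _ _).trans ?_
      rw [coframe_frame hnd l 0 hξ]
      rfl
    have h7 := congrArg (fun w => coframeMap hnd l (frameMap r l w)) h2
    simp only [map_add, map_sum, h5, h6 _ (hT2 _), h3, h4, map_smul] at h7
    rw [h2] at h7
    have h0 : ((k + 1 : ℕ) : ℝ) ≠ 0 := by positivity
    exact (smul_right_injective _ h0 h7).symm

variable (𝔥) in
/-- The `𝔥`-invariant multivectors of degree `k`. -/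
def invariantMultivectors (k : ℕ) : Submodule ℝ (ExteriorAlgebra ℝ 𝔤) where
  carrier := {P | P ∈ ⋀[ℝ]^k 𝔤 ∧ ∀ x : 𝔥, schouten (ι ℝ (x : 𝔤)) P = 0}
  add_mem' ha hb := ⟨add_mem ha.1 hb.1, fun x => by rw [map_add, ha.2, hb.2, add_zero]⟩
  zero_mem' := ⟨zero_mem _, fun x => map_zero _⟩
  smul_mem' c _ ha := ⟨Submodule.smul_mem _ c ha.1, fun x => by rw [map_smul, ha.2, smul_zero]⟩

lemma frameMap_mem [IsLieAbelian 𝔥] {h : Basis κ ℝ 𝔥} {r : SmoothMaps 𝔥} (hr : IsTriangular h r)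
    (l : Dual ℝ 𝔥) {k : ℕ} {w : Forms 𝔥 𝔤} (hw : w ∈ basicForms 𝔥 k) :
    frameMap r l w ∈ invariantMultivectors 𝔥 k :=
  ⟨map_mem _ hw.1, fun x => by rw [← frameMap_gLie hr, (hw.2 x).2, map_zero]⟩

lemma coframeMap_mem [IsLieAbelian 𝔥] {h : Basis κ ℝ 𝔥} {r : SmoothMaps 𝔥}
    (hr : IsTriangular h r) (hnd : IsNondegenerate r)
    (l : Dual ℝ 𝔥) {k : ℕ} {P : ExteriorAlgebra ℝ 𝔤} (hP : P ∈ invariantMultivectors 𝔥 k) :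
    coframeMap hnd l P ∈ basicForms 𝔥 k := by
  refine ⟨map_mem _ hP.1, fun x => ⟨gContract_coframeMap hnd l x P, ?_⟩⟩
  -- Invariance is tested after `frameMap`, where it holds by assumption. Coming back requires the
  -- Lie derivative to be horizontal, which is true because 𝔥 is closed under the bracket.
  rw [← coframeMap_frameMap hnd l (gLie_mem (x : 𝔤) (map_mem _ hP.1)) (w := gLie (x : 𝔤)
    (coframeMap hnd l P)), frameMap_gLie hr, frameMap_coframeMap, hP.2, map_zero]
  intro y
  rw [gContract_gLie, gContract_coframeMap, map_zero, ← LieSubalgebra.coe_bracket,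
    gContract_coframeMap, sub_zero]

end Coframe

/-! ### The Poincaré lemma along H*. -/

section Homotopy

open ExteriorAlgebra (ι)

variable {H 𝔤 : Type*} [AddCommGroup H] [Module ℝ H] [LieRing 𝔤] [LieAlgebra ℝ 𝔤]
  {κ : Type*} [Fintype κ] [DecidableEq κ]

variable (H 𝔤) in
/-- The dilation of the factor `H` of `H × 𝔤*`. -/
def scale (t : ℝ) : H × Dual ℝ 𝔤 →ₗ[ℝ] H × Dual ℝ 𝔤 :=
  LinearMap.prodMap (t • LinearMap.id) LinearMap.id

variable (H 𝔤) in
/-- The map of forms induced by the dilation of `H`. -/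
def scaleMap (t : ℝ) : Forms H 𝔤 →ₗ[ℝ] Forms H 𝔤 := (ExteriorAlgebra.map (scale H 𝔤 t)).toLinearMap

lemma scaleMap_one (w : Forms H 𝔤) : scaleMap H 𝔤 1 w = w := by
  have : scale H 𝔤 1 = LinearMap.id := by
    simp [scale, LinearMap.prodMap_id]
  simp [scaleMap, this]

lemma scaleMap_hForm_mul (t : ℝ) (v : H) (w : Forms H 𝔤) :
    scaleMap H 𝔤 t (hForm 𝔤 v * w) = t • (hForm 𝔤 v * scaleMap H 𝔤 t w) := by
  refine (map_ι_mul _ _ _).trans ?_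
  have : ι ℝ (scale H 𝔤 t (LinearMap.inl ℝ H (Dual ℝ 𝔤) v)) = t • hForm 𝔤 v := by
    rw [hForm, LinearMap.comp_apply, ← map_smul]
    congr 1
    simp [scale]
  rw [this, smul_mul_assoc]
  rfl

lemma scaleMap_gForm_mul (t : ℝ) (ξ : Dual ℝ 𝔤) (w : Forms H 𝔤) :
    scaleMap H 𝔤 t (gForm H ξ * w) = gForm H ξ * scaleMap H 𝔤 t w := by
  refine (map_ι_mul _ _ _).trans ?_
  have : scale H 𝔤 t (LinearMap.inr ℝ H (Dual ℝ 𝔤) ξ) = LinearMap.inr ℝ H (Dual ℝ 𝔤) ξ := by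
    simp [scale]
  rw [this]
  rfl

lemma gContract_scaleMap (t : ℝ) (x : 𝔤) (w : Forms H 𝔤) :
    gContract x (scaleMap H 𝔤 t w) = scaleMap H 𝔤 t (gContract x w) := by
  refine (contract_map _ _ _).trans ?_
  rfl

lemma hContract_scaleMap_zero (θ : Dual ℝ H) (w : Forms H 𝔤) :
    hContract θ (scaleMap H 𝔤 0 w) = 0 := by
  refine (contract_map _ _ _).trans ?_
  have : ((LinearMap.fst ℝ H (Dual ℝ 𝔤)).dualMap θ) ∘ₗ scale H 𝔤 0 = 0 := by
    ext u <;> simp [scale]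
  rw [this]
  simp

lemma scaleMap_mem (t : ℝ) {k : ℕ} {w : Forms H 𝔤} (hw : w ∈ ⋀[ℝ]^k (H × Dual ℝ 𝔤)) :
    scaleMap H 𝔤 t w ∈ ⋀[ℝ]^k (H × Dual ℝ 𝔤) := map_mem _ hw

/-- Dilating H does not affect values on vectors of 𝔤. This holds also at t = 0, where all
H-components are lost. -/
lemma toAlt_scaleMap (t : ℝ) (k : ℕ) (w : Forms H 𝔤) :
    toAlt k (scaleMap H 𝔤 t w) = toAlt k w := by
  induction k generalizing w with
  | zero =>
    ext y
    rw [toAlt_zero, toAlt_zero]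
    have : ExteriorAlgebra.algebraMapInv.comp (ExteriorAlgebra.map (scale H 𝔤 t)) =
        ExteriorAlgebra.algebraMapInv := by
      ext <;> simp [ExteriorAlgebra.algebraMapInv]
    exact DFunLike.congr_fun this w
  | succ k ih => ext y; rw [toAlt_succ, toAlt_succ, gContract_scaleMap, ih]

variable (H 𝔤) in
lemma scale_eq (u : H × Dual ℝ 𝔤) : (fun t => scale H 𝔤 t u) =
    (fun _ : ℝ => ((0 : H), u.2)) +
      ⇑(LinearMap.toSpanSingleton ℝ (H × Dual ℝ 𝔤) (u.1, 0)) := by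
  funext t
  simp [scale, LinearMap.prodMap_apply]

variable [FiniteDimensional ℝ 𝔤]

lemma gLie_scaleMap (t : ℝ) (x : 𝔤) (w : Forms H 𝔤) :
    gLie x (scaleMap H 𝔤 t w) = scaleMap H 𝔤 t (gLie x w) := by
  simp [gLie_apply, gContract_scaleMap, scaleMap_gForm_mul]

lemma gDiff_scaleMap (t : ℝ) (w : Forms H 𝔤) :
    gDiff (scaleMap H 𝔤 t w) = scaleMap H 𝔤 t (gDiff w) := by
  simp [gDiff_apply, gLie_scaleMap, scaleMap_gForm_mul]

lemma scaleMap_mem_basicForms {𝔥 : LieSubalgebra ℝ 𝔤} (t : ℝ) {k : ℕ} {w : Forms 𝔥 𝔤}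
    (hw : w ∈ basicForms 𝔥 k) : scaleMap 𝔥 𝔤 t w ∈ basicForms 𝔥 k :=
  ⟨scaleMap_mem t hw.1, fun x => by
    rw [gContract_scaleMap, gLie_scaleMap, (hw.2 x).1, (hw.2 x).2, map_zero]
    exact ⟨rfl, rfl⟩⟩

variable [FiniteDimensional ℝ H]

/-- At t = 0 the form has no component along H, so it is determined by its alternating map; this
identifies the endpoint of the homotopy with a left invariant form. -/
lemma scaleMap_zero_eq {k : ℕ} {w : Forms H 𝔤} (hw : w ∈ ⋀[ℝ]^k (H × Dual ℝ 𝔤)) :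
    scaleMap H 𝔤 0 w = ofAlt H k (toAlt k w) := by
  rw [← ofAlt_toAlt k (w := scaleMap H 𝔤 0 w)
    ⟨scaleMap_mem 0 hw, fun θ => hContract_scaleMap_zero θ w⟩, toAlt_scaleMap]

variable (H 𝔤) in
lemma isSmooth_scale : IsSmooth (scale H 𝔤) :=
  IsSmooth.hom fun u => scale_eq H 𝔤 u ▸ (IsSmooth.const _).add (IsSmooth.linear _)

variable (H 𝔤) in
lemma isSmooth_scaleMap : IsSmooth (scaleMap H 𝔤) := (isSmooth_scale H 𝔤).map

lemma dirDeriv_scale (t : ℝ) (u : H × Dual ℝ 𝔤) :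
    dirDeriv (1 : ℝ) (scale H 𝔤) t u = (u.1, 0) := by
  rw [dirDeriv_hom_apply (isSmooth_scale H 𝔤), scale_eq,
    IsSmooth.dirDeriv_add (IsSmooth.const _) (IsSmooth.linear _), Pi.add_apply, dirDeriv_const,
    dirDeriv_linear]
  simp

/-- In H-degree p the dilation is multiplication by tᵖ, and contraction followed by multiplication
counts p, so the right side is p tᵖ⁻¹ w. Contracting before scaling avoids a division by t. The
proof compares Leibniz rules instead of splitting by H-degree. -/
lemma dirDeriv_scaleMap (h : Basis κ ℝ H) (t : ℝ) (w : Forms H 𝔤) :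
    dirDeriv (1 : ℝ) (scaleMap H 𝔤) t w =
      ∑ i, hForm 𝔤 (h i) * scaleMap H 𝔤 t (hContract (h.dualBasis i) w) := by
  have key : dirDeriv (1 : ℝ) (scaleMap H 𝔤) t =
      ∑ i, LinearMap.mulLeft ℝ (hForm 𝔤 (h i)) ∘ₗ scaleMap H 𝔤 t ∘ₗ
        hContract (h.dualBasis i) := by
    refine exterior_linearMap_ext ?_ fun u b hb => ?_
    · have h1 : ∀ θ, hContract θ (1 : Forms H 𝔤) = 0 := fun θ => contract_one _
      have h2 : dirDeriv (1 : ℝ) (scaleMap H 𝔤) t 1 = 0 :=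
        dirDeriv_map_one (isSmooth_scale H 𝔤) 1 t
      simp [h1, h2, LinearMap.sum_apply]
    · have h1 : dirDeriv (1 : ℝ) (scaleMap H 𝔤) t (ι ℝ u * b) =
          ι ℝ (dirDeriv (1 : ℝ) (scale H 𝔤) t u) * scaleMap H 𝔤 t b +
            ι ℝ (scale H 𝔤 t u) * dirDeriv (1 : ℝ) (scaleMap H 𝔤) t b :=
        dirDeriv_map_ι_mul (isSmooth_scale H 𝔤) 1 t u b
      have h2 : ∀ θ, hContract θ (ι ℝ u * b) = θ u.1 • b - ι ℝ u * hContract θ b := fun θ =>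
        contract_ι_mul _ _ _
      have h3 : ∀ c, scaleMap H 𝔤 t (ι ℝ u * c) = ι ℝ (scale H 𝔤 t u) * scaleMap H 𝔤 t c :=
        fun c => map_ι_mul _ _ _
      have h4 : ∀ v c, hForm 𝔤 v * (ι ℝ (scale H 𝔤 t u) * c) =
          -(ι ℝ (scale H 𝔤 t u) * (hForm 𝔤 v * c)) := fun v c => ι_mul_ι_mul _ _ _
      have h5 : ∑ i, h.dualBasis i u.1 • hForm 𝔤 (h i) = hForm 𝔤 u.1 := by
        conv_rhs => rw [← h.sum_repr u.1, map_sum]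
        simp only [map_smul, Basis.dualBasis_apply]
      rw [h1, hb, dirDeriv_scale]
      simp only [LinearMap.sum_apply, LinearMap.comp_apply, LinearMap.mulLeft_apply, h2, map_sub,
        map_smul, h3, h4, sub_neg_eq_add, Finset.sum_add_distrib,
        Finset.mul_sum]
      simp only [← smul_mul_assoc]
      rw [← Finset.sum_mul, h5]
      rfl
  rw [key]
  simp [LinearMap.sum_apply]

/-- The differential `∑ᵢ hᵢ ∧ ∂/∂λⁱ + d` on the forms with values depending on `λ`. -/
def totalDiff (h : Basis κ ℝ H) (σ : Dual ℝ H → Forms H 𝔤) (l : Dual ℝ H) : Forms H 𝔤 :=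
  ∑ i, hForm 𝔤 (h i) * dirDeriv (h.dualBasis i) σ l + gDiff (σ l)

variable {σ : Dual ℝ H → Forms H 𝔤}

lemma IsSmooth.hForm_mul (v : H) {W : Type*} [AddCommGroup W] [Module ℝ W] [FiniteDimensional ℝ W]
    {f : W → Forms H 𝔤} (hf : IsSmooth f) : IsSmooth (fun l => hForm 𝔤 v * f l) :=
  IsSmooth.linear_comp (LinearMap.mulLeft ℝ (hForm 𝔤 v)) hf

lemma IsSmooth.totalDiff (h : Basis κ ℝ H) (hσ : IsSmooth σ) : IsSmooth (totalDiff h σ) :=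
  (IsSmooth.fun_sum _ fun _ => (hσ.dirDeriv _).hForm_mul _).add
    (IsSmooth.linear_comp gDiff hσ)

lemma dirDeriv_totalDiff (h : Basis κ ℝ H) (hσ : IsSmooth σ) (v l : Dual ℝ H) :
    dirDeriv v (totalDiff h σ) l = totalDiff h (dirDeriv v σ) l := by
  have h1 : ∀ i, IsSmooth fun l => hForm 𝔤 (h i) * dirDeriv (h.dualBasis i) σ l := fun i =>
    (hσ.dirDeriv (h.dualBasis i)).hForm_mul (h i)
  refine (dirDeriv_add (IsSmooth.fun_sum _ h1) (IsSmooth.linear_comp gDiff hσ) v l).trans ?_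
  rw [dirDeriv_sum _ h1, dirDeriv_linear_comp gDiff hσ]
  congr 1
  refine Finset.sum_congr rfl fun i _ => ?_
  rw [dirDeriv_comm hσ (h.dualBasis i) v]
  exact dirDeriv_linear_comp (LinearMap.mulLeft ℝ (hForm 𝔤 (h i)))
    (hσ.dirDeriv (h.dualBasis i)) v l

/-- Symmetric second derivatives meet the antisymmetric products hᵢ ∧ hⱼ, the mixed terms cancel
because `gDiff` anticommutes with hᵢ ∧, and `gDiff` squares to zero. -/
lemma totalDiff_totalDiff (h : Basis κ ℝ H) (hσ : IsSmooth σ) (l : Dual ℝ H) :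
    totalDiff h (totalDiff h σ) l = 0 := by
  have h1 : ∑ i, ∑ j, hForm 𝔤 (h i) * (hForm 𝔤 (h j) *
      dirDeriv (h.dualBasis j) (dirDeriv (h.dualBasis i) σ) l) = 0 := by
    set X := ∑ i, ∑ j, hForm 𝔤 (h i) * (hForm 𝔤 (h j) *
      dirDeriv (h.dualBasis j) (dirDeriv (h.dualBasis i) σ) l) with hX
    have h2 : X = -X := by
      conv_lhs => rw [hX, Finset.sum_comm]
      simp only [hX, ← Finset.sum_neg_distrib]
      refine Finset.sum_congr rfl fun i _ => Finset.sum_congr rfl fun j _ => ?_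
      rw [hForm_mul_hForm_mul, dirDeriv_comm hσ]
    have h3 : (2 : ℝ) • X = 0 := by
      rw [two_smul]
      nth_rewrite 1 [h2]
      simp
    simpa using h3
  unfold totalDiff at *
  have h2 := fun v => dirDeriv_totalDiff h hσ v l
  unfold totalDiff at h2
  simp only [h2, mul_add, Finset.mul_sum, Finset.sum_add_distrib, h1, map_add, map_sum,
    gDiff_hForm_mul, gDiff_gDiff, Finset.sum_neg_distrib]
  simp

lemma totalDiff_mem_basicForms {𝔥 : LieSubalgebra ℝ 𝔤} (h : Basis κ ℝ 𝔥)
    {σ : Dual ℝ 𝔥 → Forms 𝔥 𝔤} (hσ : IsSmooth σ) {k : ℕ} (hb : ∀ l, σ l ∈ basicForms 𝔥 k)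
    (l : Dual ℝ 𝔥) : totalDiff h σ l ∈ basicForms 𝔥 (k + 1) :=
  add_mem (sum_mem fun _ _ => hForm_mul_mem_basicForms _ (dirDeriv_mem _ hσ hb _ _))
    (gDiff_mem_basicForms (hb l))

/-- The derivative terms carry a factor from H and are invisible to `toAlt`. Evaluation at a point λ
is therefore a chain map to alternating forms, and a left inverse of the inclusion of constant
families. -/
lemma toAlt_totalDiff (h : Basis κ ℝ H) (k : ℕ) (l : Dual ℝ H) :
    toAlt (k + 1) (totalDiff h σ l) = ceDiff k (toAlt k (σ l)) := by
  simp [totalDiff, toAlt_hForm_mul, toAlt_gDiff]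

/-- The pullback of a family of forms by the dilations. -/
def pullDilation (σ : Dual ℝ H → Forms H 𝔤) (p : Dual ℝ H × ℝ) : Forms H 𝔤 :=
  scaleMap H 𝔤 p.2 (σ (p.2 • p.1))

/-- The integrand of the homotopy operator. -/
def homotopyIntegrand (σ : Dual ℝ H → Forms H 𝔤) (p : Dual ℝ H × ℝ) : Forms H 𝔤 :=
  scaleMap H 𝔤 p.2 (hContract p.1 (σ (p.2 • p.1)))

/-- The homotopy operator of the Poincaré lemma. -/
def homotopy (σ : Dual ℝ H → Forms H 𝔤) : Dual ℝ H → Forms H 𝔤 :=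
  unitIntegral (homotopyIntegrand σ)

section Dilation

variable {W V : Type*} [AddCommGroup W] [Module ℝ W] [FiniteDimensional ℝ W]
  [AddCommGroup V] [Module ℝ V] [FiniteDimensional ℝ V]

variable (W) in
lemma isSmooth_dilation : IsSmooth (fun p : W × ℝ => p.2 • p.1) :=
  IsSmooth.bilin (LinearMap.lsmul ℝ W) (IsSmooth.linear (LinearMap.snd ℝ W ℝ))
    (IsSmooth.linear (LinearMap.fst ℝ W ℝ))

lemma dirDeriv_dilation (q p : W × ℝ) :
    dirDeriv q (fun p : W × ℝ => p.2 • p.1) p = q.2 • p.1 + p.2 • q.1 := by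
  have := dirDeriv_bilin (LinearMap.lsmul ℝ W) (IsSmooth.linear (LinearMap.snd ℝ W ℝ))
    (IsSmooth.linear (LinearMap.fst ℝ W ℝ)) q p
  rw [dirDeriv_linear, dirDeriv_linear] at this
  exact this

lemma dirDeriv_comp_dilation {f : W → V} (hf : IsSmooth f) (q p : W × ℝ) :
    dirDeriv q (fun p : W × ℝ => f (p.2 • p.1)) p =
      dirDeriv (q.2 • p.1 + p.2 • q.1) f (p.2 • p.1) := by
  rw [dirDeriv_comp hf (isSmooth_dilation W), dirDeriv_dilation]

end Dilation

variable (H 𝔤) in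
lemma isSmooth_scaleMap_snd : IsSmooth (fun p : Dual ℝ H × ℝ => scaleMap H 𝔤 p.2) :=
  (isSmooth_scaleMap H 𝔤).comp (IsSmooth.linear (LinearMap.snd ℝ (Dual ℝ H) ℝ))

lemma dirDeriv_scaleMap_snd (q p : Dual ℝ H × ℝ) :
    dirDeriv q (fun p : Dual ℝ H × ℝ => scaleMap H 𝔤 p.2) p =
      dirDeriv q.2 (scaleMap H 𝔤) p.2 := by
  have := dirDeriv_comp (isSmooth_scaleMap H 𝔤) (IsSmooth.linear (LinearMap.snd ℝ (Dual ℝ H) ℝ)) q p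
  rw [dirDeriv_linear] at this
  exact this

lemma isSmooth_hContract_dilation (hσ : IsSmooth σ) :
    IsSmooth (fun p : Dual ℝ H × ℝ => hContract p.1 (σ (p.2 • p.1))) :=
  IsSmooth.bilin hContract (IsSmooth.linear (LinearMap.fst ℝ (Dual ℝ H) ℝ))
    (hσ.comp (isSmooth_dilation (Dual ℝ H)))

lemma isSmooth_homotopyIntegrand (hσ : IsSmooth σ) : IsSmooth (homotopyIntegrand σ) :=
  (isSmooth_scaleMap_snd H 𝔤).hom_apply (isSmooth_hContract_dilation hσ)

lemma isSmooth_pullDilation (hσ : IsSmooth σ) : IsSmooth (pullDilation σ) :=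
  (isSmooth_scaleMap_snd H 𝔤).hom_apply (hσ.comp (isSmooth_dilation (Dual ℝ H)))

lemma dirDeriv_homotopyIntegrand (hσ : IsSmooth σ) (v : Dual ℝ H) (p : Dual ℝ H × ℝ) :
    dirDeriv (v, (0 : ℝ)) (homotopyIntegrand σ) p =
      scaleMap H 𝔤 p.2 (hContract v (σ (p.2 • p.1))) +
        p.2 • scaleMap H 𝔤 p.2 (hContract p.1 (dirDeriv v σ (p.2 • p.1))) := by
  have h1 := dirDeriv_hom (isSmooth_scaleMap_snd H 𝔤) (isSmooth_hContract_dilation hσ)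
    (v, (0 : ℝ)) p
  have h2 := dirDeriv_bilin (hContract (H := H) (𝔤 := 𝔤))
    (IsSmooth.linear (LinearMap.fst ℝ (Dual ℝ H) ℝ))
    (hσ.comp (isSmooth_dilation (Dual ℝ H))) (v, (0 : ℝ)) p
  rw [dirDeriv_linear, dirDeriv_comp_dilation hσ] at h2
  have h3 : dirDeriv (p.2 • v) σ (p.2 • p.1) = p.2 • dirDeriv v σ (p.2 • p.1) :=
    map_smul (dirDerivₗ σ (p.2 • p.1)) p.2 v
  have h4 : dirDeriv (0 : ℝ) (scaleMap H 𝔤) p.2 = 0 := map_zero (dirDerivₗ (scaleMap H 𝔤) p.2)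
  simp only [zero_smul, zero_add, h3, map_smul] at h2
  rw [dirDeriv_scaleMap_snd, h4, LinearMap.zero_apply, zero_add] at h1
  refine h1.trans ?_
  refine (congrArg _ h2).trans ?_
  rw [map_add, map_smul]
  rfl

lemma dirDeriv_pullDilation (h : Basis κ ℝ H) (hσ : IsSmooth σ) (p : Dual ℝ H × ℝ) :
    dirDeriv ((0 : Dual ℝ H), (1 : ℝ)) (pullDilation σ) p =
      ∑ i, hForm 𝔤 (h i) * scaleMap H 𝔤 p.2 (hContract (h.dualBasis i) (σ (p.2 • p.1))) +
        ∑ i, p.1 (h i) • scaleMap H 𝔤 p.2 (dirDeriv (h.dualBasis i) σ (p.2 • p.1)) := by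
  have h1 := dirDeriv_hom (isSmooth_scaleMap_snd H 𝔤) (hσ.comp (isSmooth_dilation (Dual ℝ H)))
    ((0 : Dual ℝ H), (1 : ℝ)) p
  rw [dirDeriv_scaleMap_snd, dirDeriv_comp_dilation hσ, dirDeriv_scaleMap h] at h1
  refine h1.trans ?_
  congr 1
  have h2 : (1 : ℝ) • p.1 + p.2 • (0 : Dual ℝ H) = ∑ i, p.1 (h i) • h.dualBasis i := by
    refine h.ext fun j => ?_
    simp
  have h3 := map_sum (dirDerivₗ σ (p.2 • p.1)) (fun i => p.1 (h i) • h.dualBasis i) Finset.univ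
  simp only [map_smul, dirDerivₗ_apply] at h3
  change scaleMap H 𝔤 p.2 (dirDeriv ((1 : ℝ) • p.1 + p.2 • (0 : Dual ℝ H)) σ (p.2 • p.1)) = _
  rw [h2, h3, map_sum]
  simp only [map_smul]

/-- Cartan's formula for the dilations λ ↦ tλ, integrated over t in [0, 1]: the t-derivative of the
pullback is D applied to the contraction plus the contraction of D, and the endpoints are σ itself
and its value at 0 without H-components. -/
lemma totalDiff_homotopy_add (h : Basis κ ℝ H) (hσ : IsSmooth σ) (l : Dual ℝ H) :
    totalDiff h (homotopy σ) l + homotopy (totalDiff h σ) l = σ l - scaleMap H 𝔤 0 (σ 0) := by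
  have hG := isSmooth_homotopyIntegrand hσ
  have hG' := isSmooth_homotopyIntegrand (hσ.totalDiff h)
  have hGi : ∀ i, IsSmooth fun p => hForm 𝔤 (h i) *
      dirDeriv (h.dualBasis i, (0 : ℝ)) (homotopyIntegrand σ) p := fun i =>
    (hG.dirDeriv _).hForm_mul (h i)
  have hGd : IsSmooth fun p => gDiff (homotopyIntegrand σ p) := IsSmooth.linear_comp gDiff hG
  have h1 : totalDiff h (homotopy σ) l = unitIntegral (fun p =>
      ∑ i, hForm 𝔤 (h i) * dirDeriv (h.dualBasis i, (0 : ℝ)) (homotopyIntegrand σ) p +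
        gDiff (homotopyIntegrand σ p)) l := by
    refine Eq.trans ?_ (unitIntegral_add (IsSmooth.fun_sum _ hGi) hGd l).symm
    rw [unitIntegral_sum _ hGi, unitIntegral_linear_comp gDiff hG]
    unfold totalDiff homotopy
    congr 1
    refine Finset.sum_congr rfl fun i _ => ?_
    rw [dirDeriv_unitIntegral hG]
    exact (unitIntegral_linear_comp (LinearMap.mulLeft ℝ (hForm 𝔤 (h i))) (hG.dirDeriv _) l).symm
  -- Cartan's formula before integration. The terms in which hᵢ multiplies a contracted derivative
  -- cancel, as do those with `gDiff`, since contraction along H* anticommutes with both.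
  have h2 : (fun p => (∑ i, hForm 𝔤 (h i) *
      dirDeriv (h.dualBasis i, (0 : ℝ)) (homotopyIntegrand σ) p +
        gDiff (homotopyIntegrand σ p)) + homotopyIntegrand (totalDiff h σ) p) =
      dirDeriv ((0 : Dual ℝ H), (1 : ℝ)) (pullDilation σ) := by
    funext p
    rw [dirDeriv_pullDilation h hσ]
    simp only [dirDeriv_homotopyIntegrand hσ]
    unfold homotopyIntegrand totalDiff
    simp only [map_add, map_sum, hContract_hForm_mul, map_sub, map_smul, scaleMap_hForm_mul,
      hContract_gDiff, map_neg, gDiff_scaleMap, mul_add, Finset.sum_add_distrib,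
      Finset.sum_sub_distrib, mul_smul_comm]
    abel
  rw [h1]
  refine (unitIntegral_add ((IsSmooth.fun_sum _ hGi).add hGd) hG' l).symm.trans ?_
  refine (congrArg (fun F => unitIntegral F l) h2).trans ?_
  rw [unitIntegral_deriv (isSmooth_pullDilation hσ)]
  simp [pullDilation, scaleMap_one]

lemma homotopy_mem_basicForms {𝔥 : LieSubalgebra ℝ 𝔤} {σ : Dual ℝ 𝔥 → Forms 𝔥 𝔤}
    (hσ : IsSmooth σ) {k : ℕ} (hb : ∀ l, σ l ∈ basicForms 𝔥 (k + 1)) (l : Dual ℝ 𝔥) :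
    homotopy σ l ∈ basicForms 𝔥 k :=
  unitIntegral_mem _ (isSmooth_homotopyIntegrand hσ)
    (fun _ => scaleMap_mem_basicForms _ (hContract_mem_basicForms _ (hb _))) l

lemma homotopy_of_mem_zero (hσ : IsSmooth σ) (hb : ∀ l, σ l ∈ ⋀[ℝ]^0 (H × Dual ℝ 𝔤)) :
    homotopy σ = 0 := by
  funext l
  refine (Submodule.mem_bot ℝ).1 (unitIntegral_mem ⊥ (isSmooth_homotopyIntegrand hσ)
    (fun p => ?_) l)
  rw [Submodule.mem_bot, homotopyIntegrand, hContract_of_mem_zero _ (hb _), map_zero]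

lemma IsSmooth.homotopy (hσ : IsSmooth σ) : IsSmooth (homotopy σ) :=
  (isSmooth_homotopyIntegrand hσ).unitIntegral

end Homotopy

/-! ### Isomorphisms of subquotients. -/

section Subquotient

variable {V V' : Type*} [AddCommGroup V] [Module ℝ V] [AddCommGroup V'] [Module ℝ V']

lemma subquotient_equiv {Z B : Submodule ℝ V} {Z' B' : Submodule ℝ V'} (J : V' →ₗ[ℝ] V)
    (hZ : ∀ a ∈ Z', J a ∈ Z) (hB : ∀ a ∈ B', J a ∈ B) (hinj : ∀ a ∈ Z', J a ∈ B → a ∈ B')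
    (hsurj : ∀ b ∈ Z, ∃ a ∈ Z', b - J a ∈ B) :
    Nonempty (Subquotient Z B ≃ₗ[ℝ] Subquotient Z' B') := by
  let F : (Z' ⧸ B'.submoduleOf Z') →ₗ[ℝ] (Z ⧸ B.submoduleOf Z) :=
    Submodule.mapQ _ _ (J.restrict hZ) fun a ha => hB _ ha
  have hF : Function.Bijective F := by
    refine ⟨?_, fun q => ?_⟩
    · rw [← LinearMap.ker_eq_bot, LinearMap.ker_eq_bot']
      intro q hq
      obtain ⟨a, rfl⟩ := Submodule.Quotient.mk_surjective _ q
      have h1 : (J.restrict hZ a) ∈ B.submoduleOf Z := (Submodule.Quotient.mk_eq_zero _).1 hq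
      exact (Submodule.Quotient.mk_eq_zero _).2 (hinj _ a.2 h1)
    · obtain ⟨b, rfl⟩ := Submodule.Quotient.mk_surjective _ q
      obtain ⟨a, ha, hab⟩ := hsurj _ b.2
      refine ⟨Submodule.Quotient.mk ⟨a, ha⟩, ?_⟩
      refine ((Submodule.Quotient.eq (B.submoduleOf Z)).2 ?_).symm
      exact hab
  exact ⟨(LinearEquiv.ofBijective F hF).symm⟩

end Subquotient

/-! ### The comparison map and its effect on cohomology. -/

section Comparison

open ExteriorAlgebra (ι)

variable {𝔤 : Type*} [LieRing 𝔤] [LieAlgebra ℝ 𝔤] [FiniteDimensional ℝ 𝔤] {𝔥 : LieSubalgebra ℝ 𝔤}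
  {κ : Type*} [Fintype κ] [DecidableEq κ] {h : Basis κ ℝ 𝔥} {r : SmoothMaps 𝔥} {k : ℕ}
  {σ : Dual ℝ 𝔥 → Forms 𝔥 𝔤}

/-- The smooth map `λ ↦ frameMap r λ (σ λ)`. -/
def frameSmooth (r : SmoothMaps 𝔥) (hσ : IsSmooth σ) : SmoothMaps 𝔥 :=
  ⟨fun l => frameMap r l (σ l), (isSmooth_frameMap r).hom_apply hσ⟩

lemma delta_apply (τ : SmoothMaps 𝔥) (l : Dual ℝ 𝔥) : (delta h r τ).1 l =
    ∑ i, ι ℝ (h i : 𝔤) * dirDeriv (h.dualBasis i) τ.1 l + schouten (r.1 l) (τ.1 l) := by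
  simp [delta, wedgeDeriv, bracket]

/-- The product rule separates the λ-dependence of `frameMap` from that of σ. The first is governed
by `frameMap_gDiff`, whose defect term vanishes because σ is horizontal. -/
lemma delta_frameSmooth (hr : IsTriangular h r) (hσ : IsSmooth σ)
    (hx : ∀ l (x : 𝔥), gContract (x : 𝔤) (σ l) = 0) :
    delta h r (frameSmooth r hσ) = frameSmooth r (hσ.totalDiff h) := by
  refine Subtype.ext (funext fun l => ?_)
  rw [delta_apply]
  have h1 : ∀ i, dirDeriv (h.dualBasis i) (frameSmooth r hσ).1 l =
      dirDeriv (h.dualBasis i) (frameMap r) l (σ l) +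
        frameMap r l (dirDeriv (h.dualBasis i) σ l) := fun i =>
    dirDeriv_hom (isSmooth_frameMap r) hσ (h.dualBasis i) l
  have h2 := frameMap_gDiff hr l (σ l)
  simp only [hx, map_zero, mul_zero, Finset.sum_const_zero, sub_zero] at h2
  have h3 : (frameSmooth r (hσ.totalDiff h)).1 l =
      ∑ i, ι ℝ (h i : 𝔤) * frameMap r l (dirDeriv (h.dualBasis i) σ l) +
        frameMap r l (gDiff (σ l)) := by
    change frameMap r l (totalDiff h σ l) = _
    simp only [totalDiff, map_add, map_sum, frameMap_mul, frameMap_hForm]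
  rw [h3, ← h2]
  simp only [h1, mul_add, Finset.sum_add_distrib]
  change _ + schouten (r.1 l) (frameMap r l (σ l)) = _
  abel

lemma frameSmooth_mem [IsLieAbelian 𝔥] (hr : IsTriangular h r) (hσ : IsSmooth σ)
    (hb : ∀ l, σ l ∈ basicForms 𝔥 k) : frameSmooth r hσ ∈ cochains 𝔥 k :=
  fun l => frameMap_mem hr l (hb l)

lemma frameSmooth_injective (hnd : IsNondegenerate r) (hσ : IsSmooth σ)
    {σ' : Dual ℝ 𝔥 → Forms 𝔥 𝔤} (hσ' : IsSmooth σ') (hb : ∀ l, σ l ∈ basicForms 𝔥 k)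
    (hb' : ∀ l, σ' l ∈ basicForms 𝔥 k) (heq : frameSmooth r hσ = frameSmooth r hσ') :
    σ = σ' := by
  funext l
  rw [← coframeMap_frameMap hnd l (hb l).1 fun x => ((hb l).2 x).1,
    ← coframeMap_frameMap hnd l (hb' l).1 fun x => ((hb' l).2 x).1]
  exact congrArg (fun τ : SmoothMaps 𝔥 => coframeMap hnd l (τ.1 l)) heq

/-- With `frameSmooth_injective` this identifies `cochains` with smooth families of basic forms; the
preimage is smooth because the inverse of a smooth family of isomorphisms is smooth. -/
lemma exists_frameSmooth_eq [IsLieAbelian 𝔥] (hr : IsTriangular h r) (hnd : IsNondegenerate r)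
    {τ : SmoothMaps 𝔥} (hτ : τ ∈ cochains 𝔥 k) :
    ∃ (σ : Dual ℝ 𝔥 → Forms 𝔥 𝔤) (hσ : IsSmooth σ),
      (∀ l, σ l ∈ basicForms 𝔥 k) ∧ frameSmooth r hσ = τ :=
  ⟨fun l => coframeMap hnd l (τ.1 l), (isSmooth_coframeMap hnd).hom_apply τ.2,
    fun l => coframeMap_mem hr hnd l (hτ l),
    Subtype.ext (funext fun l => frameMap_coframeMap hnd l (τ.1 l))⟩

lemma delta_mem_cochains [IsLieAbelian 𝔥] (hr : IsTriangular h r) (hnd : IsNondegenerate r)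
    {τ : SmoothMaps 𝔥} (hτ : τ ∈ cochains 𝔥 k) : delta h r τ ∈ cochains 𝔥 (k + 1) := by
  obtain ⟨σ, hσ, hb, rfl⟩ := exists_frameSmooth_eq hr hnd hτ
  rw [delta_frameSmooth hr hσ fun l x => ((hb l).2 x).1]
  exact frameSmooth_mem hr _ (totalDiff_mem_basicForms h hσ hb)

/-- The identity is transported from D² = 0 on families of basic forms, so no graded Jacobi identity
for the Schouten bracket is needed. -/
lemma delta_delta [IsLieAbelian 𝔥] (hr : IsTriangular h r) (hnd : IsNondegenerate r)
    {τ : SmoothMaps 𝔥} (hτ : τ ∈ cochains 𝔥 k) : delta h r (delta h r τ) = 0 := by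
  obtain ⟨σ, hσ, hb, rfl⟩ := exists_frameSmooth_eq hr hnd hτ
  have hb' := totalDiff_mem_basicForms h hσ hb
  rw [delta_frameSmooth hr hσ fun l x => ((hb l).2 x).1,
    delta_frameSmooth hr (hσ.totalDiff h) fun l x => ((hb' l).2 x).1]
  refine Subtype.ext (funext fun l => ?_)
  change frameMap r l (totalDiff h (totalDiff h σ) l) = 0
  rw [totalDiff_totalDiff h hσ, map_zero]

lemma coboundaries_le_cocycles [IsLieAbelian 𝔥] (hr : IsTriangular h r) (hnd : IsNondegenerate r)
    (k : ℕ) : coboundaries h r k ≤ cocycles h r k := by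
  cases k with
  | zero => exact bot_le
  | succ k =>
    rintro _ ⟨τ, hτ, rfl⟩
    exact ⟨delta_mem_cochains hr hnd hτ, delta_delta hr hnd hτ⟩

/-- The comparison map from alternating forms on `𝔤` to smooth maps `𝔥* → ∧𝔤`. -/
def comparison (r : SmoothMaps 𝔥) (k : ℕ) : (𝔤 [⋀^Fin k]→ₗ[ℝ] ℝ) →ₗ[ℝ] SmoothMaps 𝔥 where
  toFun α := frameSmooth r (IsSmooth.const (ofAlt 𝔥 k α))
  map_add' α β := Subtype.ext (funext fun l => by
    change frameMap r l (ofAlt 𝔥 k (α + β)) =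
      frameMap r l (ofAlt 𝔥 k α) + frameMap r l (ofAlt 𝔥 k β)
    rw [map_add, map_add])
  map_smul' c α := Subtype.ext (funext fun l => by
    change frameMap r l (ofAlt 𝔥 k (c • α)) = c • frameMap r l (ofAlt 𝔥 k α)
    rw [map_smul, map_smul])

lemma delta_comparison [IsLieAbelian 𝔥] (hr : IsTriangular h r) {α : 𝔤 [⋀^Fin k]→ₗ[ℝ] ℝ}
    (hα : α ∈ relCochains 𝔥 k) :
    delta h r (comparison r k α) = comparison r (k + 1) (ceDiff k α) := by
  refine (delta_frameSmooth hr (IsSmooth.const (ofAlt 𝔥 k α)) fun _ x => ((ofAlt_mem_basicForms hα).2 x).1).trans ?_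
  refine Subtype.ext (funext fun l => ?_)
  change frameMap r l (totalDiff h (fun _ => ofAlt 𝔥 k α) l) =
    frameMap r l (ofAlt 𝔥 (k + 1) (ceDiff k α))
  simp only [totalDiff, dirDeriv_const, mul_zero, Finset.sum_const_zero, zero_add, gDiff_ofAlt]

lemma comparison_mem_cochains [IsLieAbelian 𝔥] (hr : IsTriangular h r)
    {α : 𝔤 [⋀^Fin k]→ₗ[ℝ] ℝ} (hα : α ∈ relCochains 𝔥 k) : comparison r k α ∈ cochains 𝔥 k :=
  frameSmooth_mem hr (IsSmooth.const (ofAlt 𝔥 k α)) fun _ => ofAlt_mem_basicForms hα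

lemma comparison_mem_cocycles [IsLieAbelian 𝔥] (hr : IsTriangular h r)
    {α : 𝔤 [⋀^Fin k]→ₗ[ℝ] ℝ} (hα : α ∈ relCocycles 𝔥 k) : comparison r k α ∈ cocycles h r k := by
  refine ⟨comparison_mem_cochains hr hα.1, LinearMap.mem_ker.2 ?_⟩
  have h1 : ceDiff k α = 0 := hα.2
  rw [delta_comparison hr hα.1, h1, map_zero]

lemma comparison_mem_coboundaries [IsLieAbelian 𝔥] (hr : IsTriangular h r)
    {α : 𝔤 [⋀^Fin k]→ₗ[ℝ] ℝ} (hα : α ∈ relCoboundaries 𝔥 k) :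
    comparison r k α ∈ coboundaries h r k := by
  cases k with
  | zero =>
    rw [(Submodule.mem_bot ℝ).1 hα, map_zero]
    exact zero_mem _
  | succ k =>
    obtain ⟨β, hβ, rfl⟩ := hα
    exact ⟨comparison r k β, comparison_mem_cochains hr hβ, delta_comparison hr hβ⟩

lemma mem_relCoboundaries_of_comparison [IsLieAbelian 𝔥] (hr : IsTriangular h r)
    (hnd : IsNondegenerate r) {α : 𝔤 [⋀^Fin k]→ₗ[ℝ] ℝ} (hα : α ∈ relCochains 𝔥 k)
    (hJ : comparison r k α ∈ coboundaries h r k) : α ∈ relCoboundaries 𝔥 k := by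
  cases k with
  | zero =>
    -- In degree zero only 0 is a coboundary, so the claim is injectivity of the comparison map.
    have h0 : comparison r 0 α = comparison r 0 0 := by
      rw [map_zero]
      exact (Submodule.mem_bot ℝ).1 hJ
    have h1 := frameSmooth_injective hnd (IsSmooth.const _) (IsSmooth.const _)
      (fun _ => ofAlt_mem_basicForms hα)
      (fun _ => ofAlt_mem_basicForms (zero_mem (relCochains 𝔥 0))) h0
    rw [← toAlt_ofAlt (H := 𝔥) 0 α, congrFun h1 0, toAlt_ofAlt]
    exact zero_mem _
  | succ k =>
    obtain ⟨τ, hτ, hτJ⟩ := hJ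
    obtain ⟨σ, hσ, hb, rfl⟩ := exists_frameSmooth_eq hr hnd hτ
    rw [delta_frameSmooth hr hσ fun l x => ((hb l).2 x).1] at hτJ
    have h1 := frameSmooth_injective hnd (hσ.totalDiff h) (IsSmooth.const _)
      (totalDiff_mem_basicForms h hσ hb)
      (fun _ => ofAlt_mem_basicForms hα) hτJ
    -- The primitive is the value at the origin of a primitive family, stripped of its 𝔥-components.
    refine ⟨toAlt k (σ 0), toAlt_mem_relCochains (hb 0), ?_⟩
    rw [← toAlt_totalDiff h, congrFun h1 0, toAlt_ofAlt]

/-- A cocycle corresponds to a D-closed family σ, so the homotopy formula loses its second term: σ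
minus the constant family built from σ(0) equals D of `homotopy σ`. The representative is thus
`toAlt k (σ 0)`. -/
lemma exists_sub_comparison_mem [IsLieAbelian 𝔥] (hr : IsTriangular h r)
    (hnd : IsNondegenerate r) {τ : SmoothMaps 𝔥} (hτ : τ ∈ cocycles h r k) :
    ∃ α ∈ relCocycles 𝔥 k, τ - comparison r k α ∈ coboundaries h r k := by
  obtain ⟨hτ, hker⟩ := hτ
  obtain ⟨σ, hσ, hb, rfl⟩ := exists_frameSmooth_eq hr hnd hτ
  have h0 : totalDiff h σ = 0 := by
    refine frameSmooth_injective hnd (hσ.totalDiff h) IsSmooth.zero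
      (totalDiff_mem_basicForms h hσ hb) (fun _ => zero_mem _) ?_
    rw [← delta_frameSmooth hr hσ fun l x => ((hb l).2 x).1, LinearMap.mem_ker.1 hker]
    exact Subtype.ext (funext fun l => (map_zero (frameMap r l)).symm)
  have hz : homotopy (totalDiff h σ) = 0 := by
    have h1 : homotopyIntegrand (0 : Dual ℝ 𝔥 → Forms 𝔥 𝔤) = 0 := by
      funext p
      simp [homotopyIntegrand]
    funext l
    rw [h0]
    exact (Submodule.mem_bot ℝ).1 (unitIntegral_mem ⊥ (isSmooth_homotopyIntegrand IsSmooth.zero)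
      (fun p => (Submodule.mem_bot ℝ).2 (congrFun h1 p)) l)
  have h2 : ∀ l, σ l - ofAlt 𝔥 k (toAlt k (σ 0)) = totalDiff h (homotopy σ) l := fun l => by
    rw [← scaleMap_zero_eq (hb 0).1, ← totalDiff_homotopy_add h hσ l, hz, Pi.zero_apply, add_zero]
  have h3 : frameSmooth r hσ - comparison r k (toAlt k (σ 0)) =
      frameSmooth r (hσ.homotopy.totalDiff h) := by
    refine Subtype.ext (funext fun l => ?_)
    change frameMap r l (σ l) - frameMap r l (ofAlt 𝔥 k (toAlt k (σ 0))) =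
      frameMap r l (totalDiff h (homotopy σ) l)
    rw [← map_sub, h2]
  refine ⟨toAlt k (σ 0), ⟨toAlt_mem_relCochains (hb 0), LinearMap.mem_ker.2 ?_⟩, ?_⟩
  · rw [← toAlt_totalDiff h, h0, Pi.zero_apply, map_zero]
  · rw [h3]
    cases k with
    | zero =>
      refine (Submodule.mem_bot ℝ).2 (Subtype.ext (funext fun l => ?_))
      change frameMap r l (totalDiff h (homotopy σ) l) = 0
      -- In degree zero there is nothing to contract, so the homotopy vanishes and the difference is
      -- zero itself, as the trivial coboundary space demands.
      have h4 : totalDiff h (homotopy σ) l = 0 := by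
        rw [homotopy_of_mem_zero hσ fun l => (hb l).1]
        change ∑ i, hForm 𝔤 (h i) * dirDeriv (h.dualBasis i)
          (fun _ : Dual ℝ 𝔥 => (0 : Forms 𝔥 𝔤)) l + gDiff 0 = 0
        simp [dirDeriv_const]
      rw [h4, map_zero]
    | succ k =>
      have hb' := homotopy_mem_basicForms hσ hb
      exact ⟨frameSmooth r hσ.homotopy, frameSmooth_mem hr _ hb',
        delta_frameSmooth hr _ fun l x => ((hb' l).2 x).1⟩

end Comparison

end DynR

end


theorem mainTheorem8 {𝔤 : Type*} [LieRing 𝔤] [LieAlgebra ℝ 𝔤] [FiniteDimensional ℝ 𝔤]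
    (𝔥 : LieSubalgebra ℝ 𝔤) [IsLieAbelian 𝔥]
    {ι : Type*} [Fintype ι] [DecidableEq ι] (h : Module.Basis ι ℝ 𝔥)
    (r : DynR.SmoothMaps 𝔥) (hr : DynR.IsTriangular h r) (hnd : DynR.IsNondegenerate r) :
    (∀ k, DynR.coboundaries h r k ≤ DynR.cocycles h r k) ∧
    (∀ k, DynR.relCoboundaries 𝔥 k ≤ DynR.relCocycles 𝔥 k) ∧
    ∀ k, Nonempty (DynR.Cohomology h r k ≃ₗ[ℝ] DynR.RelCohomology 𝔥 k) :=
  ⟨DynR.coboundaries_le_cocycles hr hnd, DynR.relCoboundaries_le_relCocycles 𝔥,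
    fun k => DynR.subquotient_equiv (DynR.comparison r k)
      (fun _ hα => DynR.comparison_mem_cocycles hr hα)
      (fun _ hα => DynR.comparison_mem_coboundaries hr hα)
      (fun _ hα => DynR.mem_relCoboundaries_of_comparison hr hnd hα.1)
      (fun _ hτ => DynR.exists_sub_comparison_mem hr hnd hτ)⟩
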